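/- Let $V\in L^1_{loc}(\mathbb R^n)$ have a weak gradient $\nabla V$, let $V$ be bounded from below and $e^{-V}\in L^1(\mathbb R^n)$, and let $G(x)$ be a matrix field on $\mathbb R^n$ that is symmetric positive definite for a.e. $x$. Assume $G,G^{-1}\in (L^1_{loc})^{n\times n}$ and $\nabla V,\ G^{-1/2}\nabla V\in (L^2_{loc})^n$. Put $$\mathcal M(v)=(2\pi)^{-n/2}e^{-|v|^2/2},\qquad \mathcal M_{eq}(x,v)=e^{-V(x)}\mathcal M(v)/Z,\qquad Z=(2\pi)^{n/2}\int e^{-V}dx,\qquad d\mu=\mathcal M_{eq}\,dv\,dx,$$ and let $L^2_{\mathcal M_{eq}}=\mathcal M_{eq}L^2(d\mu)$, with $\|f\|_{L^2_{\mathcal M_{eq}}}=\|f/\mathcal M_{eq}\|_{L^2(d\mu)}$. For $\epsilon>0$ let $$L_\epsilon f=\tfrac1\epsilon\,(v\cdot\nabla_xf-\nabla V\cdot\nabla_vf)-\tfrac1{\epsilon^2}\nabla_v\cdot\big(G(\nabla_vf+vf)\big),$$ as an operator in $L^2_{\mathcal M_{eq}}$ whose domain consists of the $f\in L^2_{\mathcal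 M_{eq}}$ that have a weak gradient $\nabla_vf\in L^1_{loc}$ with $\iint|G^{1/2}\nabla_v(f/\mathcal M_{eq})|^2d\mu<\infty$, and for which $L_\epsilon f$, taken in the sense of distributions, belongs to $L^2_{\mathcal M_{eq}}$. Assume that for every $\epsilon>0$ the operator $-L_\epsilon$ generates a strongly continuous semigroup $e^{-tL_\epsilon}$ in $L^2_{\mathcal M_{eq}}$. For every $\epsilon>0$ let $f_\epsilon$ be a mild-weak solution of $\partial_tf_\epsilon+L_\epsilon f_\epsilon=0$. This means that $f_\epsilon(t)=e^{-tL_\epsilon}f_\epsilon(0)$ for $t\ge0$, that $f_\epsilon\in C(\mathbb R_+;\mathcal D'(\mathbb R^n_x\times\mathbb R^n_v))\cap L^\infty_{loc}(\mathbb R_+;L^2_{\mathcal M_{eq}}\cap L^\infty)$, that $f_\epsilon$ has a weak gradient $\nabla_vf_\epsilon$ with $G(\nabla_vf_\epsilon+vf_\epsilon)\in L^1_{loc}([0,\infty)\times\mathbb R^n_x\times\mathbb R^n_v)$, and that for all $T>0$ and $\varphi\in C^1_c(\mathbb R^n_x\times\mathbb R^n_v)$ $$\iint f_\epsilon(T)\varphi\,dv\,dx-\iint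 f_\epsilon(0)\varphi\,dv\,dx-\frac1\epsilon\int_0^T\!\!\iint(v\cdot\nabla_x\varphi-\nabla V\cdot\nabla_v\varphi)f_\epsilon\,dv\,dx\,ds+\frac1{\epsilon^2}\int_0^T\!\!\iint\nabla_v\varphi\cdot G(\nabla_vf_\epsilon+vf_\epsilon)\,dv\,dx\,ds=0 .$$ Assume that $\sup_{\epsilon>0}\|f_\epsilon(0)\|_{L^2_{\mathcal M_{eq}}}<\infty$, and let $\rho_\epsilon(t,x)=\int f_\epsilon(t,x,v)\,dv$. Then $\rho_\epsilon(t,x)$ is well defined for every $t\ge0$ and a.e. $x$, and $\rho_\epsilon\in C([0,\infty),w\text{-}L^2(dx))$. Every sequence $\epsilon_k\to0$ of positive numbers has a subsequence along which $\rho_{\epsilon_k}$ converges to some $\rho\in C([0,\infty),w\text{-}L^2(dx))$ in $C([0,T],w\text{-}L^2(dx))$ for every $T>0$; that is, $\int\psi\rho_{\epsilon_k}(t)\,dx\to\int\psi\rho(t)\,dx$ uniformly on $[0,T]$ for every $\psi\in L^2(\mathbb R^n)$. Moreover $\rho$ is a distributional solution of the Smoluchowski equation $$\partial_t\rho=\nabla_x\cdot\big(G^{-1}(\nabla_x\rho+\nabla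 V\rho)\big):$$ for a.e. $t$ it has a weak gradient in $x$, the functions $\nabla_x\rho$ and $G^{-1}(\nabla_x\rho+\nabla V\rho)$ belong to $L^1_{loc}([0,\infty)\times\mathbb R^n)$, and for all $0\le t_1\le t_2$ and $\phi\in C_c^\infty(\mathbb R^n)$ $$\int\phi\,\rho(t_2)\,dx-\int\phi\,\rho(t_1)\,dx=-\int_{t_1}^{t_2}\!\!\int\nabla\phi\cdot G^{-1}(\nabla_x\rho+\nabla V\rho)\,dx\,ds .$$ -/

import Mathlib

open MeasureTheory Set Filter Topology
open scoped ENNReal NNReal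

noncomputable section

namespace KineticFP

/-- Euclidean space of dimension `n`. -/
abbrev E (n : ℕ) : Type := EuclideanSpace ℝ (Fin n)

/-- The action of an `n × n` matrix on a vector of Euclidean space. -/
def matVec {n : ℕ} (A : Matrix (Fin n) (Fin n) ℝ) (w : E n) : E n :=
  Matrix.toEuclideanLin A w

/-- `g` is the weak (distributional) gradient of `u` on `ℝⁿ`. -/
def IsWeakGrad {n : ℕ} (u : E n → ℝ) (g : E n → E n) : Prop :=
  LocallyIntegrable u volume ∧ LocallyIntegrable g volume ∧
    ∀ φ : E n → ℝ, ContDiff ℝ (⊤ : ℕ∞) φ → HasCompactSupport φ → ∀ w : E n,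
      ∫ x, u x * fderiv ℝ φ x w = -∫ x, inner ℝ (g x) w * φ x

/-- `g` is the weak gradient in the velocity variable `v` of `u = u(x, v)` on `ℝⁿ × ℝⁿ`. -/
def IsWeakVGrad {n : ℕ} (u : E n × E n → ℝ) (g : E n × E n → E n) : Prop :=
  LocallyIntegrable u volume ∧ LocallyIntegrable g volume ∧
    ∀ φ : E n × E n → ℝ, ContDiff ℝ (⊤ : ℕ∞) φ → HasCompactSupport φ → ∀ w : E n,
      ∫ p, u p * fderiv ℝ φ p (0, w) = -∫ p, inner ℝ (g p) w * φ p

/-- The standard Maxwellian `M(v) = exp (-|v|² / 2) / (2π)^(n/2)`. -/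
def maxwellian {n : ℕ} (v : E n) : ℝ :=
  Real.exp (-‖v‖ ^ 2 / 2) / (2 * Real.pi) ^ ((n : ℝ) / 2)

/-- The normalizing constant `Z = (2π)^(n/2) ∫ exp (-V) dx`. -/
def partitionConst {n : ℕ} (V : E n → ℝ) : ℝ :=
  (2 * Real.pi) ^ ((n : ℝ) / 2) * ∫ x, Real.exp (-V x)

/-- The equilibrium `M_eq(x, v) = exp (-V x) M(v) / Z`. -/
def equilibrium {n : ℕ} (V : E n → ℝ) (p : E n × E n) : ℝ :=
  Real.exp (-V p.1) * maxwellian p.2 / partitionConst V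

/-- The measure `dμ = M_eq dv dx`. -/
def eqMeasure {n : ℕ} (V : E n → ℝ) : Measure (E n × E n) :=
  volume.withDensity fun p => ENNReal.ofReal (equilibrium V p)

/-- The Hilbert space `L²(dμ)`. The weighted space `L²_{M_eq}` is `M_eq · L²(dμ)`: a function `f`
belongs to it when `f / M_eq` belongs to `L²(dμ)`. -/
abbrev L2eq {n : ℕ} (V : E n → ℝ) : Type := Lp ℝ 2 (eqMeasure V)

/-- The norm of `f` in `L²_{M_eq}`, with value `∞` when `f` is not in this space. -/
def normL2eq {n : ℕ} (V : E n → ℝ) (f : E n × E n → ℝ) : ℝ≥0∞ :=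
  eLpNorm (fun p => f p / equilibrium V p) 2 (eqMeasure V)

/-- The pairing of `L_ε u` with a test function `φ`, where `Du` is the weak `v`-gradient of `u`:
`-(1/ε) ∬ (v·∇ₓφ - ∇V·∇ᵥφ) u + (1/ε²) ∬ ∇ᵥφ · G (∇ᵥu + v u)`. -/
def kfpPairing {n : ℕ} (ε : ℝ) (gradV : E n → E n) (G : E n → Matrix (Fin n) (Fin n) ℝ)
    (φ u : E n × E n → ℝ) (Du : E n × E n → E n) : ℝ :=
  -(1 / ε) * (∫ p, fderiv ℝ φ p (p.2, -gradV p.1) * u p)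
    + (1 / ε ^ 2) * ∫ p, fderiv ℝ φ p (0, matVec (G p.1) (Du p + u p • p.2))

/-- The graph of the operator `L_ε` in `L²_{M_eq}`, written for `h = f / M_eq` and
`g = (L_ε f) / M_eq`: the function `f` has a weak `v`-gradient with
`∬ |G^{1/2} ∇ᵥ(f / M_eq)|² dμ < ∞`, and `L_ε f`, taken in the sense of distributions, belongs to
`L²_{M_eq}`. Note `M_eq ∇ᵥ(f / M_eq) = ∇ᵥf + v f` and `|G^{1/2} w|² = w · G w`. -/
def IsKFPOperator {n : ℕ} (ε : ℝ) (V : E n → ℝ) (gradV : E n → E n)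
    (G : E n → Matrix (Fin n) (Fin n) ℝ) (h g : L2eq V) : Prop :=
  ∃ (f : E n × E n → ℝ) (Df : E n × E n → E n),
    (∀ p, f p = equilibrium V p * h p) ∧
    IsWeakVGrad f Df ∧
    Integrable (fun p => inner ℝ (Df p + f p • p.2) (matVec (G p.1) (Df p + f p • p.2))
      / equilibrium V p) volume ∧
    ∀ φ : E n × E n → ℝ, ContDiff ℝ 1 φ → HasCompactSupport φ →
      ∫ p, (equilibrium V p * g p) * φ p = kfpPairing ε gradV G φ f Df

/-- `S` (on `t ≥ 0`) is a strongly continuous semigroup of bounded operators. -/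
structure IsC0Semigroup {X : Type*} [NormedAddCommGroup X] [NormedSpace ℝ X]
    (S : ℝ → X →L[ℝ] X) : Prop where
  zero : S 0 = ContinuousLinearMap.id ℝ X
  add : ∀ s t : ℝ, 0 ≤ s → 0 ≤ t → S (s + t) = (S s).comp (S t)
  cont : ∀ x : X, Tendsto (fun t => S t x) (𝓝[>] 0) (𝓝 x)

/-- The operator with graph `A` is the infinitesimal generator of `S`. -/
def IsGenerator {X : Type*} [NormedAddCommGroup X] [NormedSpace ℝ X]
    (S : ℝ → X →L[ℝ] X) (A : X → X → Prop) : Prop :=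
  ∀ x y : X, A x y ↔ Tendsto (fun t : ℝ => t⁻¹ • (S t x - x)) (𝓝[>] 0) (𝓝 y)

/-- `f` is a mild-weak solution of `∂ₜf + L_ε f = 0`, where `S t = exp (-t L_ε)` acts on
`h = f / M_eq`. -/
structure IsMildWeakSolution {n : ℕ} (ε : ℝ) (V : E n → ℝ) (gradV : E n → E n)
    (G : E n → Matrix (Fin n) (Fin n) ℝ) (S : ℝ → L2eq V →L[ℝ] L2eq V)
    (f : ℝ → E n × E n → ℝ) : Prop where
  /-- joint measurability in time and phase space -/
  meas : AEStronglyMeasurable (Function.uncurry f) (volume.restrict (Ioi (0 : ℝ) ×ˢ univ))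
  /-- `f(t) = exp (-t L_ε) f(0)` in `L²_{M_eq}` -/
  mild : ∃ h₀ : L2eq V, ∀ t : ℝ, 0 ≤ t →
    (fun p => f t p / equilibrium V p) =ᵐ[eqMeasure V] S t h₀
  /-- `f` is continuous in time with values in the distributions -/
  cont : ∀ φ : E n × E n → ℝ, ContDiff ℝ (⊤ : ℕ∞) φ → HasCompactSupport φ →
    ContinuousOn (fun t => ∫ p, f t p * φ p) (Ici 0)
  /-- `f` is locally bounded in time with values in `L²_{M_eq} ∩ L^∞` -/
  bdd : ∀ T : ℝ, 0 < T → ∃ C : ℝ≥0, ∀ᵐ t ∂(volume.restrict (Ioc 0 T)),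
    normL2eq V (f t) ≤ C ∧ eLpNorm (f t) ∞ volume ≤ C
  /-- the weak formulation, every term of which is well defined -/
  weak : ∃ Df : ℝ → E n × E n → E n,
    (∀ᵐ t ∂(volume.restrict (Ioi (0 : ℝ))), IsWeakVGrad (f t) (Df t)) ∧
    (∀ (T : ℝ) (K : Set (E n × E n)), 0 < T → IsCompact K →
      IntegrableOn (fun q : ℝ × (E n × E n) =>
        matVec (G q.2.1) (Df q.1 q.2 + f q.1 q.2 • q.2.2)) (Ioc 0 T ×ˢ K) volume) ∧
    ∀ (T : ℝ) (φ : E n × E n → ℝ), 0 < T → ContDiff ℝ 1 φ → HasCompactSupport φ →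
      (∫ p, f T p * φ p) - (∫ p, f 0 p * φ p)
        + (∫ s in (0 : ℝ)..T, kfpPairing ε gradV G φ (f s) (Df s)) = 0

/-- The hydrodynamical density `ρ(t, x) = ∫ f(t, x, v) dv`. -/
def density {n : ℕ} (f : ℝ → E n × E n → ℝ) (t : ℝ) (x : E n) : ℝ :=
  ∫ v, f t (x, v)

/-- `r` belongs to `C([0,∞), w-L²(dx))`. -/
def WeaklyContinuousL2 {n : ℕ} (r : ℝ → E n → ℝ) : Prop :=
  (∀ t : ℝ, 0 ≤ t → MemLp (r t) 2 volume) ∧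
    ∀ ψ : E n → ℝ, MemLp ψ 2 volume → ContinuousOn (fun t => ∫ x, ψ x * r t x) (Ici 0)

/-- `ρ` is a distributional solution on `[0,∞) × ℝⁿ` of the Smoluchowski equation
`∂ₜρ = ∇·(G⁻¹ (∇ρ + ∇V ρ))`: the weak gradient `∇ρ` and the flux `G⁻¹ (∇ρ + ∇V ρ)` are locally
integrable functions, and the equation holds against all test functions between any two times. -/
def IsSmoluchowskiSolution {n : ℕ} (gradV : E n → E n) (G : E n → Matrix (Fin n) (Fin n) ℝ)
    (ρ : ℝ → E n → ℝ) : Prop :=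
  AEStronglyMeasurable (Function.uncurry ρ) (volume.restrict (Ioi (0 : ℝ) ×ˢ univ)) ∧
  ∃ Dρ : ℝ → E n → E n,
    (∀ᵐ t ∂(volume.restrict (Ioi (0 : ℝ))), IsWeakGrad (ρ t) (Dρ t)) ∧
    (∀ (T : ℝ) (K : Set (E n)), 0 < T → IsCompact K →
      IntegrableOn (Function.uncurry Dρ) (Ioc 0 T ×ˢ K) volume ∧
      IntegrableOn (fun q : ℝ × E n =>
        matVec (G q.2)⁻¹ (Dρ q.1 q.2 + ρ q.1 q.2 • gradV q.2)) (Ioc 0 T ×ˢ K) volume) ∧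
    ∀ (t₁ t₂ : ℝ) (φ : E n → ℝ), 0 ≤ t₁ → t₁ ≤ t₂ →
      ContDiff ℝ (⊤ : ℕ∞) φ → HasCompactSupport φ →
      (∫ x, φ x * ρ t₂ x) - (∫ x, φ x * ρ t₁ x) =
        -∫ s in t₁..t₂, ∫ x,
          fderiv ℝ φ x (matVec (G x)⁻¹ (Dρ s x + ρ s x • gradV x))

end KineticFP

end

/-! Work with `h = f / M_eq` in `L²(μ)`, and put `R = G^{1/2}`, `Q = G^{-1/2}`. Transport is
antisymmetric there, and the velocity part is `R∇ᵥ` followed by its adjoint, so the dissipated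
quantity is `k = R∇ᵥh`. Formally, the energy identity bounds `k/ε` in `L²(dt ⊗ μ)`, uniformly in
`ε`. Testing the equation with `φ(x)` gives `d/dt ∫φρ = ∫ (k/ε)·Q∇φ dμ`. Testing with `(w·v)φ(x)`
gives `∫ρ(∂_wφ - ∂_wV φ) = ∫ (k/ε)·R(φw) dμ`, up to terms that vanish with `ε`. Both relations are
linear in `ρ` and `k/ε`, and their test fields `Q∇φ`, `R(φw)` do not depend on `v`. They therefore
pass to a weak limit `κ` of the velocity averages of `k/ε`. In the limit the second relation says
`∇ρ + ∇Vρ = -xWeight · Rκ`; applying `G⁻¹ = QQ` identifies the flux `-xWeight · Qκ` of the first.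

The obstacle is that `G` and `∇V` are rough, so elements of the maximal domain of `L_ε` need not be
limits of test functions in any obvious sense, and the energy identity cannot be obtained by direct
integration by parts. Instead, `exists_resolvent` solves `(λ + L_ε)u' = λu + g` by Lions' method,
inside the closure of the test functions, where an energy bound holds. The solution lies in the
maximal domain (`isKFPOperator_of_weak_form`). If `L_ε u = g`, then `u' - u` is an eigenvector of
the generator for `λ`, hence zero once `λ` exceeds the growth rate of the semigroup
(`eq_zero_of_eigenvector`). Thus `u = u'` inherits the energy bound, and large `λ` makes its error
term small (`exists_dissipation`). Contractivity of the semigroup follows.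

For general initial data the orbit is not in the domain, but its time integrals over the cells of a
mesh are. Starting from a nearby element of the domain, the discrete energy inequality
`sum_inner_integral_le` telescopes and bounds the dissipation of all cells together. `exists_flux`
assembles these into a step function `κ_ε`, bounded in `L²(dt ⊗ xMeasure)`, which satisfies both
moment relations up to `O(√ε)`.

In `exists_hydrodynamic_limit` one extracts weak limits of `κ_ε` and of the initial densities. By
the first relation, `ρ_ε(t)` tested with `φ` is its initial value plus the pairing of `κ_ε` with
`1_{(0,t]} Q∇φ`. This field depends continuously on `t`, so weak convergence of `κ_ε` is already
uniform for `t` in a compact interval. Density of test functions extends this to all of `L²(dx)`. -/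

noncomputable section

namespace KineticFP

/-! ### Weak solutions and weak compactness in Hilbert spaces -/

section HilbertSpace

variable {H : Type*} [NormedAddCommGroup H] [InnerProductSpace ℝ H] [CompleteSpace H]

/-- Lions' projection theorem, in the form of a coercive bilinear form on a pre-Hilbert space. -/
theorem exists_weak_solution_of_coercive {T : Type*} [AddCommGroup T] [Module ℝ T]
    (ι Λ : T →ₗ[ℝ] H) (hco : ∀ φ, inner ℝ (ι φ) (Λ φ) = ‖ι φ‖ ^ 2) (ξ : H) :
    ∃ u ∈ closure (range ι), (∀ φ, inner ℝ u (Λ φ) = inner ℝ ξ (ι φ)) ∧ ‖u‖ ≤ ‖ξ‖ := by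
  set F := (LinearMap.range ι).topologicalClosure with hF
  have hιF : ∀ φ, ι φ ∈ F := fun φ => Submodule.le_topologicalClosure _ ⟨φ, rfl⟩
  have : CompleteSpace F := (Submodule.isClosed_topologicalClosure _).completeSpace_coe
  -- Against vectors of `F`, `Λ` and its projection have the same inner products. Coercivity thus
  -- survives the projection, and a solution for `PΛ` can be projected back into `F`, the closure of
  -- the range of `ι`.
  set PΛ : T →ₗ[ℝ] H := (F.starProjection : H →ₗ[ℝ] H) ∘ₗ Λ with hPΛ
  have hP : ∀ u ∈ F, ∀ φ, inner ℝ u (PΛ φ) = inner ℝ u (Λ φ) := by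
    intro u hu φ
    have h1 : inner ℝ (F.starProjection u) (Λ φ) = inner ℝ u (F.starProjection (Λ φ)) :=
      F.inner_starProjection_left_eq_right u (Λ φ)
    rw [Submodule.starProjection_eq_self_iff.mpr hu] at h1
    simp [hPΛ, h1]
  have hbd : ∀ φ, ‖ι φ‖ ≤ ‖PΛ φ‖ := by
    intro φ
    have h1 : ‖ι φ‖ ^ 2 ≤ ‖ι φ‖ * ‖PΛ φ‖ := by
      rw [← hco, ← hP _ (hιF φ)]
      exact real_inner_le_norm _ _
    rcases (norm_nonneg (ι φ)).eq_or_lt with h | h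
    · rw [← h]; positivity
    · nlinarith
  set ℓ₀ : T →ₗ[ℝ] ℝ := (innerSL ℝ ξ : H →ₗ[ℝ] ℝ) ∘ₗ ι with hℓ₀
  have hℓ₀_apply : ∀ φ, ℓ₀ φ = inner ℝ ξ (ι φ) := fun φ => by simp [hℓ₀]
  have hker : LinearMap.ker PΛ ≤ LinearMap.ker ℓ₀ := by
    intro φ hφ
    rw [LinearMap.mem_ker] at hφ ⊢
    have h1 : ι φ = 0 := by
      have := hbd φ
      rw [hφ, norm_zero] at this
      exact norm_le_zero_iff.mp this
    simp [hℓ₀_apply, h1]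
  -- The functional `PΛ φ ↦ ⟪ξ, ι φ⟫` is well defined and has norm at most `‖ξ‖` because `‖ι φ‖ ≤
  -- ‖PΛ φ‖`. Hahn–Banach and Riesz then produce the solution with the same bound.
  set ℓ : LinearMap.range PΛ →ₗ[ℝ] ℝ :=
    ((LinearMap.ker PΛ).liftQ ℓ₀ hker) ∘ₗ (PΛ.quotKerEquivRange.symm : _ →ₗ[ℝ] _) with hℓ
  have hℓ_apply : ∀ φ, ℓ ⟨PΛ φ, φ, rfl⟩ = inner ℝ ξ (ι φ) := by
    intro φ
    have := LinearMap.quotKerEquivRange_symm_apply_image PΛ φ ⟨φ, rfl⟩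
    rw [← hℓ₀_apply]
    simp only [hℓ, LinearMap.comp_apply, LinearEquiv.coe_coe]
    rw [this]
    simp
  have hℓ_bd : ∀ y, ‖ℓ y‖ ≤ ‖ξ‖ * ‖y‖ := by
    rintro ⟨_, φ, rfl⟩
    rw [hℓ_apply]
    calc ‖inner ℝ ξ (ι φ)‖ ≤ ‖ξ‖ * ‖ι φ‖ := norm_inner_le_norm _ _
      _ ≤ ‖ξ‖ * ‖PΛ φ‖ := by gcongr; exact hbd φ
  obtain ⟨g, hg, hgn⟩ := exists_extension_norm_eq (LinearMap.range PΛ) (ℓ.mkContinuous ‖ξ‖ hℓ_bd)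
  set u₀ := (InnerProductSpace.toDual ℝ H).symm g with hu₀
  have hu₀n : ‖u₀‖ ≤ ‖ξ‖ := by
    rw [hu₀, LinearIsometryEquiv.norm_map, hgn]
    exact LinearMap.mkContinuous_norm_le _ (norm_nonneg _) _
  refine ⟨F.starProjection u₀, ?_, fun φ => ?_, ?_⟩
  · have h1 : (F : Set H) = closure (range ι) := by
      rw [hF, Submodule.topologicalClosure_coe, LinearMap.coe_range]
    rw [← h1]
    exact Submodule.starProjection_apply_mem _ _
  · rw [F.inner_starProjection_left_eq_right]
    have h1 : inner ℝ u₀ (PΛ φ) = g (PΛ φ) := by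
      rw [hu₀, InnerProductSpace.toDual_symm_apply]
    have h2 := hg ⟨PΛ φ, φ, rfl⟩
    simp only [LinearMap.mkContinuous_apply] at h2
    rw [hℓ_apply] at h2
    rw [← h2, ← h1]
    simp [hPΛ]
  · exact (F.norm_starProjection_apply_le u₀).trans hu₀n

/-- Bounded sequences of a separable Hilbert space have weakly convergent subsequences. -/
theorem exists_subseq_weak_tendsto [TopologicalSpace.SeparableSpace H] (x : ℕ → H) (C : ℝ)
    (hx : ∀ k, ‖x k‖ ≤ C) :
    ∃ (σ : ℕ → ℕ) (a : H), StrictMono σ ∧ ‖a‖ ≤ C ∧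
      ∀ y, Tendsto (fun k => inner ℝ (x (σ k)) y) atTop (𝓝 (inner ℝ a y)) := by
  have hs := WeakDual.isSeqCompact_closedBall ℝ H (0 : StrongDual ℝ H) C
  obtain ⟨f, hf, σ, hσ, hlim⟩ := hs
    (x := fun k => StrongDual.toWeakDual (InnerProductSpace.toDual ℝ H (x k)))
    (fun k => by simpa using hx k)
  refine ⟨σ, (InnerProductSpace.toDual ℝ H).symm (WeakDual.toStrongDual f), hσ, ?_, fun y => ?_⟩
  · rw [LinearIsometryEquiv.norm_map]
    simpa using hf
  · rw [InnerProductSpace.toDual_symm_apply]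
    have := ((WeakDual.eval_continuous y).tendsto f).comp hlim
    exact this

/-- A bounded sequence converges weakly when it converges against a dense set. -/
theorem exists_weak_limit_of_dense [TopologicalSpace.SeparableSpace H] (x : ℕ → H) (C : ℝ)
    (hx : ∀ k, ‖x k‖ ≤ C) (s : Set H) (hs : Dense s)
    (hlim : ∀ y ∈ s, ∃ c, Tendsto (fun k => inner ℝ (x k) y) atTop (𝓝 c)) :
    ∃ a : H, ‖a‖ ≤ C ∧ ∀ y, Tendsto (fun k => inner ℝ (x k) y) atTop (𝓝 (inner ℝ a y)) := by
  obtain ⟨σ, a, hσ, ha, hlim'⟩ := exists_subseq_weak_tendsto x C hx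
  have hC : 0 ≤ C := (norm_nonneg _).trans ha
  refine ⟨a, ha, fun y => ?_⟩
  rw [Metric.tendsto_atTop]
  intro δ hδ
  obtain ⟨z, hz, hyz⟩ := hs.exists_dist_lt y (ε := δ / (3 * (C + 1))) (by positivity)
  obtain ⟨c, hc⟩ := hlim z hz
  have hc' : c = inner ℝ a z := tendsto_nhds_unique (hc.comp hσ.tendsto_atTop) (hlim' z)
  obtain ⟨N, hN⟩ := (Metric.tendsto_atTop.mp hc) (δ / 3) (by positivity)
  refine ⟨N, fun k hk => ?_⟩
  have h1 : ∀ b : H, ‖b‖ ≤ C → |inner ℝ b (y - z)| ≤ δ / 3 := by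
    intro b hb
    calc |inner ℝ b (y - z)| ≤ ‖b‖ * ‖y - z‖ := abs_real_inner_le_norm _ _
      _ ≤ (C + 1) * (δ / (3 * (C + 1))) := by
          rw [← dist_eq_norm]; gcongr; linarith
      _ = δ / 3 := by field_simp
  have h2 := hN k hk
  rw [Real.dist_eq, hc'] at h2
  rw [Real.dist_eq]
  have e : inner ℝ (x k) y - inner ℝ a y
      = inner ℝ (x k) (y - z) + (inner ℝ (x k) z - inner ℝ a z) - inner ℝ a (y - z) := by
    simp only [inner_sub_right]; ring
  rw [e]
  have h3 := h1 _ (hx k)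
  have h4 := h1 _ ha
  rw [abs_le] at h3 h4
  rw [abs_lt] at h2 ⊢
  constructor <;> linarith [h2.1, h2.2, h3.1, h3.2, h4.1, h4.2]

omit [CompleteSpace H] in
/-- Weak convergence of a bounded sequence is uniform on compact sets. -/
theorem tendstoUniformlyOn_inner_of_isCompact (x : ℕ → H) (a : H) (C : ℝ)
    (hx : ∀ k, ‖x k‖ ≤ C)
    (hlim : ∀ y, Tendsto (fun k => inner ℝ (x k) y) atTop (𝓝 (inner ℝ a y)))
    (K : Set H) (hK : IsCompact K) :
    TendstoUniformlyOn (fun k y => inner ℝ (x k) y) (fun y => inner ℝ a y) atTop K := by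
  rw [Metric.tendstoUniformlyOn_iff]
  intro δ hδ
  set B := C + ‖a‖ + 1 with hB
  have hC : 0 ≤ C := (norm_nonneg _).trans (hx 0)
  have hBpos : 0 < B := by positivity
  obtain ⟨t, -, htf, hKt⟩ := hK.finite_cover_balls (e := δ / (2 * B)) (by positivity)
  have hev : ∀ᶠ k in atTop, ∀ z ∈ t, dist (inner ℝ (x k) z) (inner ℝ a z) < δ / 2 :=
    (htf.eventually_all).mpr fun z _ => (Metric.tendsto_nhds.mp (hlim z)) _ (by positivity)
  filter_upwards [hev] with k hk y hy
  obtain ⟨z, hz, hyz⟩ := mem_iUnion₂.mp (hKt hy)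
  have h2 := hk z hz
  rw [Metric.mem_ball, dist_eq_norm] at hyz
  rw [Real.dist_eq] at h2 ⊢
  have e : inner ℝ a y - inner ℝ (x k) y
      = inner ℝ (a - x k) (y - z) - (inner ℝ (x k) z - inner ℝ a z) := by
    simp only [inner_sub_right, inner_sub_left]; ring
  have h3 : |inner ℝ (a - x k) (y - z)| ≤ δ / 2 := by
    calc |inner ℝ (a - x k) (y - z)| ≤ ‖a - x k‖ * ‖y - z‖ := abs_real_inner_le_norm _ _
      _ ≤ B * (δ / (2 * B)) := by
          gcongr
          calc ‖a - x k‖ ≤ ‖a‖ + ‖x k‖ := norm_sub_le _ _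
            _ ≤ B := by rw [hB]; linarith [hx k]
      _ = δ / 2 := by field_simp
  rw [e]
  rw [abs_le] at h3
  rw [abs_lt] at h2 ⊢
  constructor <;> linarith [h2.1, h2.2, h3.1, h3.2]

end HilbertSpace

/-! ### Strongly continuous semigroups and their generators -/

namespace IsC0Semigroup

section Banach

variable {X : Type*} [NormedAddCommGroup X] [NormedSpace ℝ X] {S : ℝ → X →L[ℝ] X}

theorem add_apply (hS : IsC0Semigroup S) {s t : ℝ} (hs : 0 ≤ s) (ht : 0 ≤ t) (x : X) :
    S (s + t) x = S s (S t x) := by rw [hS.add s t hs ht]; rfl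

theorem zero_apply (hS : IsC0Semigroup S) (x : X) : S 0 x = x := by rw [hS.zero]; rfl

theorem comm_apply (hS : IsC0Semigroup S) {s t : ℝ} (hs : 0 ≤ s) (ht : 0 ≤ t) (x : X) :
    S s (S t x) = S t (S s x) := by
  rw [← hS.add_apply hs ht, add_comm, hS.add_apply ht hs]

/-- Otherwise the norms would blow up along some `t_n → 0`, while every orbit converges along `t_n`;
this contradicts the uniform boundedness principle. -/
theorem exists_bound_near_zero [CompleteSpace X] (hS : IsC0Semigroup S) :
    ∃ δ : ℝ, 0 < δ ∧ ∃ M : ℝ, 1 ≤ M ∧ ∀ t ∈ Icc 0 δ, ‖S t‖ ≤ M := by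
  by_contra! hcon
  have hseq : ∀ n : ℕ, ∃ t ∈ Icc (0 : ℝ) (1 / ((n : ℝ) + 1)), ((n : ℝ) + 1) < ‖S t‖ := fun n =>
    hcon (1 / ((n : ℝ) + 1)) (by positivity) ((n : ℝ) + 1) (by linarith [Nat.cast_nonneg (α := ℝ) n])
  choose t ht hbig using hseq
  have ht0 : Tendsto t atTop (𝓝 0) :=
    squeeze_zero (fun n => (ht n).1) (fun n => (ht n).2) tendsto_one_div_add_atTop_nhds_zero_nat
  have hcont : ∀ x, Tendsto (fun s => S s x) (𝓝[≥] 0) (𝓝 x) := by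
    intro x
    rw [← Ioi_insert, nhdsWithin_insert, tendsto_sup]
    refine ⟨?_, hS.cont x⟩
    rw [tendsto_pure_left]
    intro s hs
    rw [hS.zero_apply]
    exact mem_of_mem_nhds hs
  have hpt : ∀ x, ∃ C, ∀ n, ‖S (t n) x‖ ≤ C := by
    intro x
    have h1 : Tendsto (fun n => S (t n) x) atTop (𝓝 x) :=
      (hcont x).comp (tendsto_nhdsWithin_iff.mpr ⟨ht0, Eventually.of_forall fun n => (ht n).1⟩)
    obtain ⟨C, hC⟩ := h1.norm.bddAbove_range
    exact ⟨C, fun n => hC ⟨n, rfl⟩⟩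
  obtain ⟨C, hC⟩ := banach_steinhaus hpt
  obtain ⟨n, hn⟩ := exists_nat_gt C
  linarith [hC n, hbig n]

theorem exists_growth_bound [CompleteSpace X] (hS : IsC0Semigroup S) :
    ∃ M ω : ℝ, 0 < M ∧ 0 ≤ ω ∧ ∀ t, 0 ≤ t → ‖S t‖ ≤ M * Real.exp (ω * t) := by
  obtain ⟨δ, hδ, M, hM, hb⟩ := hS.exists_bound_near_zero
  have hM0 : 0 < M := by linarith
  have key : ∀ k : ℕ, ∀ t, 0 ≤ t → t ≤ (k + 1) * δ → ‖S t‖ ≤ M * M ^ k := by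
    intro k
    induction k with
    | zero =>
      intro t h0 h1
      simpa using hb t ⟨h0, by simpa using h1⟩
    | succ k ih =>
      intro t h0 h1
      by_cases h : t ≤ δ
      · calc ‖S t‖ ≤ M * 1 := by simpa using hb t ⟨h0, h⟩
          _ ≤ M * M ^ (k + 1) := by gcongr; exact one_le_pow₀ hM
      · push Not at h
        have e : t = δ + (t - δ) := by ring
        push_cast at h1
        calc ‖S t‖ = ‖(S δ).comp (S (t - δ))‖ := by
              rw [← hS.add _ _ hδ.le (by linarith), ← e]
          _ ≤ ‖S δ‖ * ‖S (t - δ)‖ := ContinuousLinearMap.opNorm_comp_le _ _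
          _ ≤ M * (M * M ^ k) := by
              gcongr
              · exact hb δ ⟨hδ.le, le_rfl⟩
              · exact ih _ (by linarith) (by linarith)
          _ = M * M ^ (k + 1) := by ring
  -- `t` is covered by `⌊t/δ⌋ + 1` steps of length at most `δ`, and `M ^ (t/δ) = exp (t log M / δ)`.
  refine ⟨M, Real.log M / δ, hM0, div_nonneg (Real.log_nonneg hM) hδ.le, fun t ht => ?_⟩
  have h1 := key ⌊t / δ⌋₊ t ht (by
    have := (Nat.lt_floor_add_one (t / δ)).le
    rwa [div_le_iff₀ hδ] at this)
  refine h1.trans ?_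
  gcongr
  rw [← Real.rpow_natCast, Real.rpow_def_of_pos hM0]
  refine Real.exp_le_exp.mpr ?_
  calc Real.log M * (⌊t / δ⌋₊ : ℝ) ≤ Real.log M * (t / δ) := by
        gcongr
        · exact Real.log_nonneg hM
        · exact Nat.floor_le (by positivity)
    _ = Real.log M / δ * t := by ring

/-- `S` carries information only for nonnegative times; the truncation `max t 0` extends each orbit
to a function continuous on all of `ℝ`, which can be integrated without side conditions. -/
theorem continuous_orbit [CompleteSpace X] (hS : IsC0Semigroup S) (x : X) :
    Continuous fun t => S (max t 0) x := by
  obtain ⟨M, ω, hM, hω, hb⟩ := hS.exists_growth_bound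
  have habs : Tendsto (fun r : ℝ => S |r| x) (𝓝 0) (𝓝 x) := by
    have hcont : Tendsto (fun s => S s x) (𝓝[≥] 0) (𝓝 x) := by
      rw [← Ioi_insert, nhdsWithin_insert, tendsto_sup]
      refine ⟨?_, hS.cont x⟩
      rw [tendsto_pure_left]
      intro s hs
      rw [hS.zero_apply]
      exact mem_of_mem_nhds hs
    refine hcont.comp (tendsto_nhdsWithin_iff.mpr ⟨?_, Eventually.of_forall fun r => abs_nonneg r⟩)
    simpa using (continuous_abs.tendsto (0 : ℝ))
  have hmono : ∀ s t : ℝ, 0 ≤ s → s ≤ t → ‖S t x - S s x‖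
      ≤ M * Real.exp (ω * s) * ‖S |t - s| x - x‖ := by
    intro s t hs hst
    rw [abs_of_nonneg (sub_nonneg.mpr hst)]
    have e : S t x = S s (S (t - s) x) := by
      rw [← hS.add_apply hs (sub_nonneg.mpr hst)]; congr 2; ring
    rw [e, ← map_sub]
    exact (S s).le_of_opNorm_le (hb s hs) _
  rw [continuous_iff_continuousAt]
  intro t₀
  rw [ContinuousAt, tendsto_iff_norm_sub_tendsto_zero]
  set T := max t₀ 0 with hT
  have hmax : Tendsto (fun t : ℝ => max t 0 - T) (𝓝 t₀) (𝓝 0) := by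
    have : Continuous fun t : ℝ => max t 0 - T := by fun_prop
    simpa [hT] using this.tendsto t₀
  have hz : Tendsto (fun t => M * Real.exp (ω * T) * ‖S |max t 0 - T| x - x‖) (𝓝 t₀) (𝓝 0) := by
    have h1 := (habs.comp hmax)
    have h2 := ((h1.sub_const x).norm).const_mul (M * Real.exp (ω * T))
    simpa using h2
  refine squeeze_zero (fun _ => norm_nonneg _) (fun t => ?_) hz
  have hT0 : 0 ≤ T := le_max_right _ _
  have ht0 : (0 : ℝ) ≤ max t 0 := le_max_right _ _
  rcases le_total T (max t 0) with h | h
  · exact hmono _ _ hT0 h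
  · rw [norm_sub_rev, abs_sub_comm]
    refine (hmono _ _ ht0 h).trans ?_
    gcongr

theorem hasDerivAt_integral [CompleteSpace X] (hS : IsC0Semigroup S) (x : X) (t : ℝ) :
    HasDerivAt (fun u => ∫ s in (0 : ℝ)..u, S (max s 0) x) (S (max t 0) x) t :=
  intervalIntegral.integral_hasDerivAt_right ((hS.continuous_orbit x).intervalIntegrable _ _)
    (hS.continuous_orbit x).aestronglyMeasurable.stronglyMeasurableAtFilter
    (hS.continuous_orbit x).continuousAt

end Banach

section Generator

variable {X : Type*} [NormedAddCommGroup X] [NormedSpace ℝ X] {S : ℝ → X →L[ℝ] X}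
  {A : X → X → Prop}

theorem generator_apply (hS : IsC0Semigroup S) (hA : IsGenerator S A) {x y : X} (hxy : A x y)
    {t : ℝ} (ht : 0 ≤ t) : A (S t x) (S t y) := by
  rw [hA] at hxy ⊢
  have h1 := ((S t).continuous.tendsto y).comp hxy
  refine h1.congr' ?_
  filter_upwards [self_mem_nhdsWithin] with r hr
  simp only [Function.comp, map_smul, map_sub]
  rw [hS.comm_apply ht (le_of_lt hr)]

theorem hasDerivWithinAt_orbit (hS : IsC0Semigroup S) (hA : IsGenerator S A) {x y : X}
    (hxy : A x y) {t : ℝ} (ht : 0 ≤ t) :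
    HasDerivWithinAt (fun s => S (max s 0) x) (S t y) (Ici t) t := by
  rw [← hasDerivWithinAt_Ioi_iff_Ici, hasDerivWithinAt_iff_tendsto_slope' (by simp)]
  have h1 := (hA _ _).mp (hS.generator_apply hA hxy ht)
  have h2 : Tendsto (fun s : ℝ => s - t) (𝓝[>] t) (𝓝[>] 0) := by
    refine tendsto_nhdsWithin_iff.mpr ⟨?_, ?_⟩
    · have : Tendsto (fun s : ℝ => s - t) (𝓝 t) (𝓝 (t - t)) :=
        (continuous_id.sub continuous_const).tendsto t
      rw [sub_self] at this
      exact this.mono_left nhdsWithin_le_nhds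
    · filter_upwards [self_mem_nhdsWithin] with s hs
      exact sub_pos.mpr (mem_Ioi.mp hs)
  refine (h1.comp h2).congr' ?_
  filter_upwards [self_mem_nhdsWithin] with s hs
  have hs' : t < s := hs
  simp only [Function.comp, slope, vsub_eq_sub]
  rw [max_eq_left ht, max_eq_left (ht.trans hs'.le), ← hS.add_apply (sub_pos.mpr hs').le ht]
  simp

/-- Time integrals of orbits lie in the domain whatever `x` is: `S r` shifts the interval of
integration, so the difference quotient only sees its two ends. -/
theorem generator_integral [CompleteSpace X] (hS : IsC0Semigroup S) (hA : IsGenerator S A) (x : X)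
    {a b : ℝ} (ha : 0 ≤ a) (hab : a ≤ b) :
    A (∫ s in a..b, S (max s 0) x) (S b x - S a x) := by
  rw [hA]
  set F : ℝ → X := fun u => ∫ s in (0 : ℝ)..u, S (max s 0) x with hF
  have hint : ∀ c d : ℝ, IntervalIntegrable (fun s => S (max s 0) x) volume c d := fun c d =>
    (hS.continuous_orbit x).intervalIntegrable c d
  have hFsub : ∀ c d : ℝ, ∫ s in c..d, S (max s 0) x = F d - F c := fun c d =>
    (intervalIntegral.integral_interval_sub_left (hint _ _) (hint _ _)).symm
  have hslope : ∀ c : ℝ, 0 ≤ c → Tendsto (fun r : ℝ => r⁻¹ • (F (c + r) - F c)) (𝓝[>] 0)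
      (𝓝 (S c x)) := by
    intro c hc
    have h1 := (hS.hasDerivAt_integral x c).tendsto_slope_zero_right
    rwa [max_eq_left hc] at h1
  refine ((hslope b (ha.trans hab)).sub (hslope a ha)).congr' ?_
  filter_upwards [self_mem_nhdsWithin] with r hr
  have hr' : 0 < r := hr
  have e : S r (∫ s in a..b, S (max s 0) x) = F (b + r) - F (a + r) := by
    rw [← ContinuousLinearMap.intervalIntegral_comp_comm _ (hint _ _), ← hFsub,
      ← intervalIntegral.integral_comp_add_right]
    refine intervalIntegral.integral_congr fun s hs => ?_
    rw [uIcc_of_le hab] at hs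
    have hs0 : 0 ≤ s := ha.trans hs.1
    rw [max_eq_left hs0, max_eq_left (by linarith), ← hS.add_apply hr'.le hs0, add_comm]
  rw [e, hFsub]
  module

/-- An eigenvector for `lam` has orbit `exp (lam t) x`, which violates the growth bound of the
semigroup when `lam` is large. This serves as uniqueness for the resolvent equation. -/
theorem eq_zero_of_eigenvector [CompleteSpace X] (hS : IsC0Semigroup S) (hA : IsGenerator S A) :
    ∃ ω : ℝ, 0 ≤ ω ∧ ∀ (lam : ℝ) (x : X), ω < lam → A x (lam • x) → x = 0 := by
  obtain ⟨M, ω, hM, hω, hb⟩ := hS.exists_growth_bound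
  refine ⟨ω, hω, fun lam x hlam hx => ?_⟩
  have hconst : ∀ t, 0 ≤ t → Real.exp (-lam * t) • S t x = x := by
    intro T hT
    have hc : ContinuousOn (fun t => Real.exp (-lam * t) • S (max t 0) x) (Icc 0 T) := by
      exact ((by fun_prop : Continuous fun t : ℝ => Real.exp (-lam * t)).smul
        (hS.continuous_orbit x)).continuousOn
    have hd : ∀ t ∈ Ico 0 T,
        HasDerivWithinAt (fun t => Real.exp (-lam * t) • S (max t 0) x) 0 (Ici t) t := by
      intro t ht
      have h1 := hS.hasDerivWithinAt_orbit hA hx ht.1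
      have h2 : HasDerivWithinAt (fun t : ℝ => Real.exp (-lam * t))
          (Real.exp (-lam * t) * (-lam)) (Ici t) t := by
        have : HasDerivAt (fun t : ℝ => -lam * t) (-lam) t := by
          simpa using (hasDerivAt_id t).const_mul (-lam)
        exact this.exp.hasDerivWithinAt
      have h3 := h2.smul h1
      refine h3.congr_deriv ?_
      simp only [max_eq_left ht.1, map_smul]
      module
    have := constant_of_has_deriv_right_zero hc hd T ⟨hT, le_rfl⟩
    simpa [max_eq_left hT, hS.zero_apply] using this
  have hle : ∀ t, 0 ≤ t → ‖x‖ ≤ M * Real.exp (-((lam - ω) * t)) * ‖x‖ := by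
    intro t ht
    calc ‖x‖ = Real.exp (-lam * t) * ‖S t x‖ := by
          conv_lhs => rw [← hconst t ht]
          rw [norm_smul, Real.norm_of_nonneg (Real.exp_pos _).le]
      _ ≤ Real.exp (-lam * t) * (M * Real.exp (ω * t) * ‖x‖) := by
          gcongr
          exact (S t).le_of_opNorm_le (hb t ht) x
      _ = M * Real.exp (-((lam - ω) * t)) * ‖x‖ := by
          rw [show -((lam - ω) * t) = -lam * t + ω * t by ring, Real.exp_add]; ring
  have hlim : Tendsto (fun t : ℝ => M * Real.exp (-((lam - ω) * t)) * ‖x‖) atTop (𝓝 0) := by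
    have h1 : Tendsto (fun t : ℝ => (lam - ω) * t) atTop atTop :=
      tendsto_id.const_mul_atTop (sub_pos.mpr hlam)
    have h2 := (Real.tendsto_exp_neg_atTop_nhds_zero.comp h1).const_mul M
    simpa using h2.mul_const ‖x‖
  have : ‖x‖ ≤ 0 := ge_of_tendsto hlim (by
    filter_upwards [eventually_ge_atTop 0] with t ht using hle t ht)
  exact norm_le_zero_iff.mp this

/-- The domain of the generator is dense. -/
theorem exists_mem_domain_near [CompleteSpace X] (hS : IsC0Semigroup S) (hA : IsGenerator S A)
    (x : X) {δ : ℝ} (hδ : 0 < δ) : ∃ x' y, A x' y ∧ ‖x' - x‖ < δ := by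
  have h1 := (hS.hasDerivAt_integral x 0).tendsto_slope_zero_right
  simp only [zero_add, intervalIntegral.integral_same, sub_zero, max_self, hS.zero_apply] at h1
  have h2 := (Metric.tendsto_nhds.mp h1) δ hδ
  obtain ⟨r, hr, hr'⟩ := (h2.and self_mem_nhdsWithin).exists
  have hr0 : 0 < r := hr'
  refine ⟨r⁻¹ • ∫ s in (0 : ℝ)..r, S (max s 0) x, r⁻¹ • (S r x - S 0 x), ?_, ?_⟩
  · have h3 := (hA _ _).mp (hS.generator_integral hA x le_rfl hr0.le)
    rw [hA]
    refine (h3.const_smul r⁻¹).congr fun t => ?_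
    rw [map_smul]
    module
  · rwa [← dist_eq_norm]

end Generator

/-! ### Semigroups with dissipative generator -/

section Dissipative

variable {X : Type*} [NormedAddCommGroup X] [InnerProductSpace ℝ X] [CompleteSpace X]
  {S : ℝ → X →L[ℝ] X} {A : X → X → Prop}

/-- On the domain, `‖S s x‖²` has right derivative `2⟪S s x, S s y⟫ ≤ 0`; the general case follows
by density of the domain. -/
theorem norm_apply_le (hS : IsC0Semigroup S) (hA : IsGenerator S A)
    (hdiss : ∀ x y, A x y → inner ℝ x y ≤ 0) {t : ℝ} (ht : 0 ≤ t) (x : X) : ‖S t x‖ ≤ ‖x‖ := by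
  have hdom : ∀ x y, A x y → ‖S t x‖ ≤ ‖x‖ := by
    intro x y hxy
    have hc : ContinuousOn (fun s => ‖S (max s 0) x‖ ^ 2) (Icc 0 t) := by
      exact ((hS.continuous_orbit x).norm.pow 2).continuousOn
    have hd : ∀ s ∈ Ico 0 t, HasDerivWithinAt (fun s => ‖S (max s 0) x‖ ^ 2)
        (2 * inner ℝ (S s x) (S s y)) (Ici s) s := by
      intro s hs
      have := (hS.hasDerivWithinAt_orbit hA hxy hs.1).norm_sq
      simpa [max_eq_left hs.1] using this
    have := image_le_of_deriv_right_le_deriv_boundary hc hd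
      (B := fun _ => ‖x‖ ^ 2) (B' := fun _ => 0) (by simp [hS.zero_apply]) continuousOn_const
      (fun s _ => hasDerivWithinAt_const _ _ _)
      (fun s hs => by linarith [hdiss _ _ (hS.generator_apply hA hxy hs.1)]) ⟨ht, le_rfl⟩
    simp only [max_eq_left ht] at this
    exact (sq_le_sq₀ (norm_nonneg _) (norm_nonneg _)).mp this
  have hcl : IsClosed {x : X | ‖S t x‖ ≤ ‖x‖} :=
    isClosed_le (S t).continuous.norm continuous_norm
  refine hcl.closure_subset (Metric.mem_closure_iff.mpr fun δ hδ => ?_)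
  obtain ⟨x', y, hxy, hn⟩ := hS.exists_mem_domain_near hA x hδ
  exact ⟨x', hdom x' y hxy, by rwa [dist_comm, dist_eq_norm]⟩

theorem norm_sub_apply_le (hS : IsC0Semigroup S) (hA : IsGenerator S A)
    (hdiss : ∀ x y, A x y → inner ℝ x y ≤ 0) {x y : X} (hxy : A x y) {s t : ℝ} (hs : 0 ≤ s)
    (hst : s ≤ t) : ‖S t x - S s x‖ ≤ ‖y‖ * (t - s) := by
  have := norm_image_sub_le_of_norm_deriv_right_le_segment
    (f := fun s => S (max s 0) x) (f' := fun s => S s y) (a := s) (b := t) (C := ‖y‖)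
    (hS.continuous_orbit x).continuousOn
    (fun r hr => hS.hasDerivWithinAt_orbit hA hxy (hs.trans hr.1))
    (fun r hr => hS.norm_apply_le hA hdiss (hs.trans hr.1) y) t ⟨hst, le_rfl⟩
  simpa [max_eq_left hs, max_eq_left (hs.trans hst)] using this

/-- A discrete form of the energy identity on a mesh of size `τ`. -/
theorem sum_inner_integral_le (hS : IsC0Semigroup S) (hA : IsGenerator S A)
    (hdiss : ∀ x y, A x y → inner ℝ x y ≤ 0) {x y : X} (hxy : A x y) {τ : ℝ} (hτ : 0 < τ)
    (N : ℕ) :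
    ∑ i ∈ Finset.range N, inner ℝ (∫ s in (i * τ)..((i + 1) * τ), S (max s 0) x)
        (S (i * τ) x - S ((i + 1) * τ) x)
      ≤ τ * (‖x‖ ^ 2 / 2 + N * τ ^ 2 * ‖y‖ ^ 2) := by
  have hone : ∀ i : ℕ, inner ℝ (∫ s in (i * τ)..((i + 1) * τ), S (max s 0) x)
        (S (i * τ) x - S ((i + 1) * τ) x)
      ≤ τ / 2 * (‖S (i * τ) x‖ ^ 2 - ‖S ((i + 1) * τ) x‖ ^ 2) + τ * (τ ^ 2 * ‖y‖ ^ 2) := by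
    intro i
    set a := (i : ℝ) * τ with ha
    set b := ((i : ℝ) + 1) * τ with hb
    have hab : b - a = τ := by rw [ha, hb]; ring
    have ha0 : 0 ≤ a := by positivity
    have hle : a ≤ b := by linarith
    -- Trapezoidal rule: with the mean `m` of the endpoint values, `⟪m, S a x - S b x⟫` is exactly
    -- half the drop of `‖·‖²`, so the main terms telescope. The integral differs from `τ m` by at
    -- most `‖y‖τ²` and the increment is at most `‖y‖τ`, which gives the error `τ³‖y‖²`.
    set m := (1 / 2 : ℝ) • (S a x + S b x) with hm
    have he : ‖(∫ s in a..b, S (max s 0) x) - τ • m‖ ≤ (‖y‖ * τ) * τ := by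
      have e : (∫ s in a..b, S (max s 0) x) - τ • m = ∫ s in a..b, (S (max s 0) x - m) := by
        rw [intervalIntegral.integral_sub ((hS.continuous_orbit x).intervalIntegrable _ _)
          (by simp), intervalIntegral.integral_const, hab]
      rw [e]
      have := intervalIntegral.norm_integral_le_of_norm_le_const (a := a) (b := b)
        (f := fun s => S (max s 0) x - m) (C := ‖y‖ * τ) ?_
      · rwa [hab, abs_of_pos hτ] at this
      · intro s hs
        rw [uIoc_of_le hle] at hs
        have hs0 : 0 ≤ s := ha0.trans hs.1.le
        rw [max_eq_left hs0]
        have e2 : S s x - m = (1 / 2 : ℝ) • (S s x - S a x) - (1 / 2 : ℝ) • (S b x - S s x) := by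
          rw [hm]; module
        rw [e2]
        have h1 := hS.norm_sub_apply_le hA hdiss hxy ha0 hs.1.le
        have h2 := hS.norm_sub_apply_le hA hdiss hxy hs0 hs.2
        calc _ ≤ ‖(1 / 2 : ℝ) • (S s x - S a x)‖ + ‖(1 / 2 : ℝ) • (S b x - S s x)‖ :=
              norm_sub_le _ _
          _ ≤ 1 / 2 * (‖y‖ * (s - a)) + 1 / 2 * (‖y‖ * (b - s)) := by
              rw [norm_smul, norm_smul]
              norm_num
              linarith
          _ = 1 / 2 * (‖y‖ * τ) := by rw [← hab]; ring
          _ ≤ ‖y‖ * τ := by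
              have : 0 ≤ ‖y‖ * τ := by positivity
              linarith
    have hd : ‖S a x - S b x‖ ≤ ‖y‖ * τ := by
      rw [norm_sub_rev, ← hab]
      exact hS.norm_sub_apply_le hA hdiss hxy ha0 hle
    have hmid : inner ℝ m (S a x - S b x) = 1 / 2 * (‖S a x‖ ^ 2 - ‖S b x‖ ^ 2) := by
      rw [hm, inner_smul_left, inner_add_left, inner_sub_right, inner_sub_right,
        real_inner_self_eq_norm_sq, real_inner_self_eq_norm_sq, real_inner_comm (S a x) (S b x)]
      simp
    have e3 : (∫ s in a..b, S (max s 0) x)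
        = τ • m + ((∫ s in a..b, S (max s 0) x) - τ • m) := by abel
    rw [e3, inner_add_left, inner_smul_left, hmid]
    have h4 : inner ℝ ((∫ s in a..b, S (max s 0) x) - τ • m) (S a x - S b x)
        ≤ (‖y‖ * τ) * τ * (‖y‖ * τ) :=
      (real_inner_le_norm _ _).trans (by gcongr)
    simp only [conj_trivial]
    nlinarith [h4]
  refine (Finset.sum_le_sum fun i _ => hone i).trans ?_
  rw [Finset.sum_add_distrib, ← Finset.mul_sum]
  have htel : ∑ i ∈ Finset.range N, (‖S ((i : ℝ) * τ) x‖ ^ 2 - ‖S (((i : ℝ) + 1) * τ) x‖ ^ 2)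
      = ‖S ((0 : ℕ) * τ) x‖ ^ 2 - ‖S ((N : ℝ) * τ) x‖ ^ 2 := by
    have := Finset.sum_range_sub' (fun i : ℕ => ‖S ((i : ℝ) * τ) x‖ ^ 2) N
    push_cast at this ⊢
    exact this
  rw [htel]
  simp only [Finset.sum_const, Finset.card_range, nsmul_eq_mul, Nat.cast_zero, zero_mul,
    hS.zero_apply]
  have : 0 ≤ τ / 2 * ‖S ((N : ℝ) * τ) x‖ ^ 2 := by positivity
  nlinarith

end Dissipative

end IsC0Semigroup

end KineticFP

namespace KineticFP

/-! ### The square root of a positive definite matrix -/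

section MatrixSqrt

open scoped Matrix.Norms.L2Operator

variable {n : ℕ}

/-- The square root of the symmetric part of a matrix. -/
def symSqrt (A : Matrix (Fin n) (Fin n) ℝ) : Matrix (Fin n) (Fin n) ℝ :=
  cfc Real.sqrt ((1 / 2 : ℝ) • (A + A.transpose))

theorem isSelfAdjoint_symPart (A : Matrix (Fin n) (Fin n) ℝ) :
    IsSelfAdjoint ((1 / 2 : ℝ) • (A + A.transpose)) := by
  rw [isSelfAdjoint_iff, Matrix.star_eq_conjTranspose]
  ext i j
  simp only [one_div, Matrix.conjTranspose_apply, Matrix.smul_apply, Matrix.add_apply,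
    Matrix.transpose_apply, smul_eq_mul, star_trivial, add_comm]

/-- Passing to the symmetric part makes the argument of the functional calculus self-adjoint for
every matrix, so continuity is global. This yields measurability of `x ↦ G(x)^{1/2}` without
restricting to positive definite matrices. -/
theorem continuous_symSqrt : Continuous (symSqrt (n := n)) := by
  unfold symSqrt
  refine Continuous.cfc_of_mem_nhdsSet (s := univ) (p := IsSelfAdjoint) Real.sqrt univ_mem ?_
    isSelfAdjoint_symPart (Real.continuous_sqrt.continuousOn)
  have : Continuous fun A : Matrix (Fin n) (Fin n) ℝ => A.transpose := by
    exact Continuous.matrix_transpose continuous_id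
  fun_prop

theorem symSqrt_transpose (A : Matrix (Fin n) (Fin n) ℝ) :
    (symSqrt A).transpose = symSqrt A := by
  have h : IsSelfAdjoint (symSqrt A) := IsSelfAdjoint.cfc
  rw [isSelfAdjoint_iff, Matrix.star_eq_conjTranspose] at h
  rwa [Matrix.conjTranspose_eq_transpose_of_trivial] at h

theorem symSqrt_mul_self {A : Matrix (Fin n) (Fin n) ℝ} (hA : A.PosDef) :
    symSqrt A * symSqrt A = A := by
  have hs : (1 / 2 : ℝ) • (A + A.transpose) = A := by
    have : A.transpose = A := by
      have := hA.isHermitian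
      rwa [Matrix.IsHermitian, Matrix.conjTranspose_eq_transpose_of_trivial] at this
    rw [this]; module
  have hsa : IsSelfAdjoint A := hA.isHermitian
  unfold symSqrt
  rw [hs, ← cfc_mul Real.sqrt Real.sqrt A]
  conv_rhs => rw [← cfc_id' ℝ A]
  refine cfc_congr fun x hx => ?_
  refine Real.mul_self_sqrt ?_
  have := hA.posSemidef
  exact (Matrix.posSemidef_iff_isHermitian_and_spectrum_nonneg.mp this).2 hx

end MatrixSqrt

/-! ### The operator fields `R = G^{1/2}` and `Q = G^{-1/2}` -/

section SqrtField

variable {n : ℕ}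

/-- `R` and `Q` are measurable fields of symmetric operators with `R² = G` and `Q = R⁻¹`, which
are locally square integrable. -/
structure IsSqrtField (G : E n → Matrix (Fin n) (Fin n) ℝ) (R Q : E n → E n →L[ℝ] E n) :
    Prop where
  measR : AEStronglyMeasurable R volume
  measQ : AEStronglyMeasurable Q volume
  symmR : ∀ᵐ x, ∀ u w, inner ℝ (R x u) w = inner ℝ u (R x w)
  symmQ : ∀ᵐ x, ∀ u w, inner ℝ (Q x u) w = inner ℝ u (Q x w)
  RR : ∀ᵐ x, ∀ u, R x (R x u) = matVec (G x) u
  QQ : ∀ᵐ x, ∀ u, Q x (Q x u) = matVec (G x)⁻¹ u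
  RQ : ∀ᵐ x, ∀ u, R x (Q x u) = u
  QR : ∀ᵐ x, ∀ u, Q x (R x u) = u
  locR : LocallyIntegrable (fun x => ‖R x‖ ^ 2) volume
  locQ : LocallyIntegrable (fun x => ‖Q x‖ ^ 2) volume

theorem opNorm_sq_le_sum (B : E n →L[ℝ] E n) :
    ‖B‖ ^ 2 ≤ n * ∑ i, ‖B (EuclideanSpace.single i 1)‖ ^ 2 := by
  have h1 : ‖B‖ ≤ ∑ i, ‖B (EuclideanSpace.single i 1)‖ := by
    refine B.opNorm_le_bound (by positivity) fun u => ?_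
    have hu : u = ∑ i, u i • (EuclideanSpace.single i (1 : ℝ) : E n) := by
      have := (EuclideanSpace.basisFun (Fin n) ℝ).sum_repr u
      simpa using this.symm
    calc ‖B u‖ = ‖∑ i, u i • B (EuclideanSpace.single i 1)‖ := by
          conv_lhs => rw [hu]
          simp
      _ ≤ ∑ i, ‖u i • B (EuclideanSpace.single i 1)‖ := norm_sum_le _ _
      _ ≤ ∑ i, ‖u‖ * ‖B (EuclideanSpace.single i 1)‖ := by
          refine Finset.sum_le_sum fun i _ => ?_
          rw [norm_smul]
          gcongr
          exact PiLp.norm_apply_le u i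
      _ = (∑ i, ‖B (EuclideanSpace.single i 1)‖) * ‖u‖ := by
          rw [← Finset.mul_sum, mul_comm]
  calc ‖B‖ ^ 2 ≤ (∑ i, ‖B (EuclideanSpace.single i 1)‖) ^ 2 := by gcongr
    _ ≤ n * ∑ i, ‖B (EuclideanSpace.single i 1)‖ ^ 2 := by
        simpa using sq_sum_le_card_mul_sum_sq (s := (Finset.univ : Finset (Fin n)))
          (f := fun i => ‖B (EuclideanSpace.single i 1)‖)

theorem inner_matVec_comm {A : Matrix (Fin n) (Fin n) ℝ} (hA : A.transpose = A) (u w : E n) :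
    inner ℝ (matVec A u) w = inner ℝ u (matVec A w) := by
  simp only [matVec, Matrix.toLpLin_apply, EuclideanSpace.inner_eq_star_dotProduct]
  simp only [star_trivial]
  rw [Matrix.dotProduct_mulVec, ← Matrix.mulVec_transpose, hA, dotProduct_comm]

theorem matVec_mul (A B : Matrix (Fin n) (Fin n) ℝ) (u : E n) :
    matVec (A * B) u = matVec A (matVec B u) := by
  simp [matVec]

theorem matVec_one (u : E n) : matVec (1 : Matrix (Fin n) (Fin n) ℝ) u = u := by
  simp [matVec]

theorem inner_single_matVec_single (A : Matrix (Fin n) (Fin n) ℝ) (i : Fin n) :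
    inner ℝ (EuclideanSpace.single i 1) (matVec A (EuclideanSpace.single i 1)) = A i i := by
  simp [matVec, EuclideanSpace.inner_single_left]

theorem aestronglyMeasurable_matrix {F : E n → Matrix (Fin n) (Fin n) ℝ}
    (hF : ∀ i j, AEStronglyMeasurable (fun x => F x i j) volume) :
    AEStronglyMeasurable F volume := by
  have e : F = fun x => ∑ i, ∑ j, F x i j • Matrix.single i j (1 : ℝ) := by
    ext x i j
    conv_lhs => rw [Matrix.matrix_eq_sum_single (F x)]
    simp
  rw [e]
  exact Finset.aestronglyMeasurable_fun_sum _ fun i _ =>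
    Finset.aestronglyMeasurable_fun_sum _ fun j _ => (hF i j).smul_const _

/-- By symmetry `‖B eᵢ‖² = ⟪eᵢ, B² eᵢ⟫ = D i i`, so `‖B‖²` is controlled by the trace of `D = B²`.
This converts local integrability of `G` and `G⁻¹` into local square integrability of `R` and `Q`.
-/
theorem locallyIntegrable_opNorm_sq {D : E n → Matrix (Fin n) (Fin n) ℝ}
    (hD : ∀ i j, LocallyIntegrable (fun x => D x i j) volume) {B : E n → E n →L[ℝ] E n}
    (hB : AEStronglyMeasurable B volume)
    (hsymm : ∀ᵐ x, ∀ u w, inner ℝ (B x u) w = inner ℝ u (B x w))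
    (hsq : ∀ᵐ x, ∀ u, B x (B x u) = matVec (D x) u) :
    LocallyIntegrable (fun x => ‖B x‖ ^ 2) volume := by
  have hb : LocallyIntegrable (fun x => (n : ℝ) * ∑ i, D x i i) volume :=
    (locallyIntegrable_finsetSum _ fun i _ => hD i i).smul (n : ℝ)
  refine hb.mono (hB.norm.pow 2) ?_
  filter_upwards [hsymm, hsq] with x h1 h2
  rw [Real.norm_of_nonneg (by positivity)]
  refine (opNorm_sq_le_sum _).trans (le_of_eq_of_le ?_ (Real.le_norm_self _))
  refine congrArg _ (Finset.sum_congr rfl fun i _ => ?_)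
  rw [← real_inner_self_eq_norm_sq, h1, h2, inner_single_matVec_single]

theorem exists_isSqrtField (G : E n → Matrix (Fin n) (Fin n) ℝ) (hGpos : ∀ᵐ x, (G x).PosDef)
    (hG : ∀ i j, LocallyIntegrable (fun x => G x i j) volume)
    (hGinv : ∀ i j, LocallyIntegrable (fun x => (G x)⁻¹ i j) volume) :
    ∃ R Q : E n → E n →L[ℝ] E n, IsSqrtField G R Q := by
  set T : Matrix (Fin n) (Fin n) ℝ →ₗ[ℝ] (E n →L[ℝ] E n) :=
    { toFun := fun A => (Matrix.toEuclideanLin A).toContinuousLinearMap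
      map_add' := fun A B => by ext; simp
      map_smul' := fun c A => by ext; simp } with hT
  have hTapp : ∀ A u, T A u = matVec A u := fun A u => by simp [hT, matVec]
  have hTc : Continuous T := LinearMap.continuous_of_finiteDimensional T
  have hGm : AEStronglyMeasurable G volume :=
    aestronglyMeasurable_matrix fun i j => (hG i j).aestronglyMeasurable
  have hGim : AEStronglyMeasurable (fun x => (G x)⁻¹) volume :=
    aestronglyMeasurable_matrix fun i j => (hGinv i j).aestronglyMeasurable
  have hRm : AEStronglyMeasurable (fun x => symSqrt (G x)) volume :=
    continuous_symSqrt.comp_aestronglyMeasurable hGm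
  -- Written as `G⁻¹ G^{1/2}`, the field `Q` is a continuous expression in two measurable fields; no
  -- measurability of matrix inversion is required.
  have hQm : AEStronglyMeasurable (fun x => (G x)⁻¹ * symSqrt (G x)) volume :=
    (continuous_fst.matrix_mul continuous_snd).comp_aestronglyMeasurable (hGim.prodMk hRm)
  have hfacts : ∀ A : Matrix (Fin n) (Fin n) ℝ, A.PosDef →
      A⁻¹ * symSqrt A = (symSqrt A)⁻¹ ∧ symSqrt A * (symSqrt A)⁻¹ = 1 ∧
      (symSqrt A)⁻¹ * symSqrt A = 1 ∧ (symSqrt A)⁻¹ * (symSqrt A)⁻¹ = A⁻¹ ∧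
      ((symSqrt A)⁻¹).transpose = (symSqrt A)⁻¹ := by
    intro A hA
    have hdet : IsUnit A.det := isUnit_iff_ne_zero.mpr hA.det_pos.ne'
    have hsq := symSqrt_mul_self hA
    have hd2 : IsUnit (symSqrt A).det := by
      rw [← hsq, Matrix.det_mul] at hdet
      exact isUnit_of_mul_isUnit_left hdet
    have h4 : (symSqrt A)⁻¹ * (symSqrt A)⁻¹ = A⁻¹ := by
      rw [← Matrix.mul_inv_rev, hsq]
    refine ⟨?_, Matrix.mul_nonsing_inv _ hd2, Matrix.nonsing_inv_mul _ hd2, h4, ?_⟩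
    · rw [← h4, mul_assoc, Matrix.nonsing_inv_mul _ hd2, mul_one]
    · rw [Matrix.transpose_nonsing_inv, symSqrt_transpose]
  set R : E n → E n →L[ℝ] E n := fun x => T (symSqrt (G x)) with hR
  set Q : E n → E n →L[ℝ] E n := fun x => T ((G x)⁻¹ * symSqrt (G x)) with hQ
  have mR : AEStronglyMeasurable R volume := hTc.comp_aestronglyMeasurable hRm
  have mQ : AEStronglyMeasurable Q volume := hTc.comp_aestronglyMeasurable hQm
  have sR : ∀ᵐ x, ∀ u w, inner ℝ (R x u) w = inner ℝ u (R x w) :=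
    Eventually.of_forall fun x u w => by
      rw [hR]; simp only [hTapp]; exact inner_matVec_comm (symSqrt_transpose _) u w
  have sQ : ∀ᵐ x, ∀ u w, inner ℝ (Q x u) w = inner ℝ u (Q x w) := by
    filter_upwards [hGpos] with x hx u w
    simp only [hQ, hTapp]
    rw [(hfacts _ hx).1]
    exact inner_matVec_comm (hfacts _ hx).2.2.2.2 u w
  have rr : ∀ᵐ x, ∀ u, R x (R x u) = matVec (G x) u := by
    filter_upwards [hGpos] with x hx u
    simp only [hR, hTapp]
    rw [← matVec_mul, symSqrt_mul_self hx]
  have qq : ∀ᵐ x, ∀ u, Q x (Q x u) = matVec (G x)⁻¹ u := by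
    filter_upwards [hGpos] with x hx u
    simp only [hQ, hTapp]
    rw [← matVec_mul, (hfacts _ hx).1, (hfacts _ hx).2.2.2.1]
  refine ⟨R, Q, mR, mQ, sR, sQ, rr, qq, ?_, ?_, ?_, ?_⟩
  · filter_upwards [hGpos] with x hx u
    simp only [hR, hQ, hTapp]
    rw [← matVec_mul, (hfacts _ hx).1, (hfacts _ hx).2.1, matVec_one]
  · filter_upwards [hGpos] with x hx u
    simp only [hR, hQ, hTapp]
    rw [← matVec_mul, (hfacts _ hx).1, (hfacts _ hx).2.2.1, matVec_one]
  · exact locallyIntegrable_opNorm_sq hG mR sR rr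
  · exact locallyIntegrable_opNorm_sq hGinv mQ sQ qq

end SqrtField

/-! ### The Maxwellian and Gaussian integration by parts -/

section Maxwellian

variable {n : ℕ}

theorem integrable_exp_neg_mul_sq_norm {b : ℝ} (hb : 0 < b) :
    Integrable (fun v : E n => Real.exp (-b * ‖v‖ ^ 2)) volume := by
  refine Integrable.of_integral_ne_zero ?_
  rw [GaussianFourier.integral_rexp_neg_mul_sq_norm hb]
  positivity

theorem maxwellian_pos (v : E n) : 0 < maxwellian v := by
  unfold maxwellian; positivity

theorem continuous_maxwellian : Continuous (maxwellian (n := n)) := by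
  unfold maxwellian; fun_prop

theorem integral_maxwellian : ∫ v : E n, maxwellian v = 1 := by
  unfold maxwellian
  rw [integral_div]
  have h := GaussianFourier.integral_rexp_neg_mul_sq_norm (V := E n) (b := 1 / 2) (by norm_num)
  have e : ∀ v : E n, -‖v‖ ^ 2 / 2 = -(1 / 2) * ‖v‖ ^ 2 := fun v => by ring
  simp_rw [e, h]
  rw [finrank_euclideanSpace_fin, show Real.pi / (1 / 2) = 2 * Real.pi by ring, div_self]
  positivity

theorem integrable_maxwellian : Integrable (maxwellian (n := n)) volume :=
  Integrable.of_integral_ne_zero (by rw [integral_maxwellian]; exact one_ne_zero)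

/-- `m‖v‖ ≤ m² + ‖v‖²/4`, so a Gaussian of half the exponent remains. Test functions of exponential
growth in `v` are therefore admissible. -/
theorem integrable_exp_norm_mul_maxwellian (m : ℝ) :
    Integrable (fun v : E n => Real.exp (m * ‖v‖) * maxwellian v) volume := by
  refine ((integrable_exp_neg_mul_sq_norm (n := n) (b := 1 / 4) (by norm_num)).const_mul
    (Real.exp (m ^ 2) / (2 * Real.pi) ^ ((n : ℝ) / 2))).mono'
    ((by fun_prop : Continuous fun v : E n => Real.exp (m * ‖v‖)).mul
      continuous_maxwellian).aestronglyMeasurable (Eventually.of_forall fun v => ?_)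
  have := maxwellian_pos v
  rw [Real.norm_of_nonneg (by positivity)]
  unfold maxwellian
  rw [mul_div_assoc', ← Real.exp_add, div_mul_eq_mul_div, ← Real.exp_add]
  refine div_le_div_of_nonneg_right (Real.exp_le_exp.mpr ?_) (by positivity)
  nlinarith [sq_nonneg (‖v‖ / 2 - m)]

theorem hasFDerivAt_maxwellian (v w : E n) :
    DifferentiableAt ℝ (maxwellian (n := n)) v ∧
      fderiv ℝ maxwellian v w = -(inner ℝ v w * maxwellian v) := by
  have h1 : HasFDerivAt (fun v : E n => ‖v‖ ^ 2) (2 • innerSL ℝ v) v :=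
    (hasStrictFDerivAt_norm_sq v).hasFDerivAt
  have h2 := ((h1.neg.mul_const (1 / 2)).exp).mul_const (((2 * Real.pi) ^ ((n : ℝ) / 2))⁻¹)
  have e : (fun v : E n => Real.exp (-‖v‖ ^ 2 * (1 / 2)) * ((2 * Real.pi) ^ ((n : ℝ) / 2))⁻¹)
      = maxwellian := by
    ext v; unfold maxwellian; rw [div_eq_mul_one_div (-‖v‖ ^ 2)]; rfl
  have h3 := h2
  simp only [Pi.neg_apply] at h3
  rw [e] at h3
  refine ⟨h3.differentiableAt, ?_⟩
  rw [h3.fderiv]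
  simp only [smul_apply, neg_apply, smul_eq_mul, innerSL_apply_apply,
    maxwellian]
  rw [div_eq_mul_one_div (-‖v‖ ^ 2), div_eq_mul_inv]
  simp
  ring

/-- Gaussian integration by parts. -/
theorem integral_fderiv_mul_maxwellian {Φ : E n → ℝ} (hΦ : ContDiff ℝ 1 Φ) (C m : ℝ)
    (hb : ∀ v, |Φ v| ≤ C * Real.exp (m * ‖v‖)) (hb' : ∀ v, ‖fderiv ℝ Φ v‖ ≤ C * Real.exp (m * ‖v‖))
    (w : E n) :
    ∫ v, maxwellian v * fderiv ℝ Φ v w = ∫ v, maxwellian v * (inner ℝ v w * Φ v) := by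
  have hdom : ∀ m' : ℝ, Integrable (fun v : E n => Real.exp (m' * ‖v‖) * maxwellian v) volume :=
    integrable_exp_norm_mul_maxwellian
  have hΦ' : Continuous fun v => fderiv ℝ Φ v w :=
    (hΦ.continuous_fderiv one_ne_zero).clm_apply continuous_const
  have hC : 0 ≤ C := by
    have := (abs_nonneg _).trans (hb 0)
    simpa using this
  have hle : ∀ v : E n, ‖v‖ ≤ Real.exp ‖v‖ := fun v =>
    (by linarith [Real.add_one_le_exp ‖v‖])
  rw [integral_mul_fderiv_eq_neg_fderiv_mul_of_integrable]
  · rw [← integral_neg]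
    congr 1 with v
    rw [(hasFDerivAt_maxwellian v w).2]
    ring
  · have e : ∀ v, fderiv ℝ maxwellian v w * Φ v = -(inner ℝ v w * maxwellian v) * Φ v := fun v => by
      rw [(hasFDerivAt_maxwellian v w).2]
    simp_rw [e]
    refine ((hdom (m + 1)).const_mul (C * ‖w‖)).mono' ?_ (Eventually.of_forall fun v => ?_)
    · have := continuous_maxwellian (n := n)
      have := hΦ.continuous
      exact Continuous.aestronglyMeasurable (by fun_prop)
    · have hM := maxwellian_pos v
      rw [norm_mul, norm_neg, norm_mul, Real.norm_of_nonneg hM.le]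
      calc ‖inner ℝ v w‖ * maxwellian v * ‖Φ v‖
          ≤ (Real.exp ‖v‖ * ‖w‖) * maxwellian v * (C * Real.exp (m * ‖v‖)) := by
            gcongr
            · exact (norm_inner_le_norm _ _).trans (by gcongr; exact hle v)
            · exact hb v
        _ = C * ‖w‖ * (Real.exp ((m + 1) * ‖v‖) * maxwellian v) := by
            rw [add_mul, one_mul, Real.exp_add]; ring
  · refine ((hdom m).const_mul (C * ‖w‖)).mono'
      (continuous_maxwellian.mul hΦ').aestronglyMeasurable (Eventually.of_forall fun v => ?_)
    have hM := maxwellian_pos v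
    rw [norm_mul, Real.norm_of_nonneg hM.le]
    calc maxwellian v * ‖fderiv ℝ Φ v w‖ ≤ maxwellian v * (C * Real.exp (m * ‖v‖) * ‖w‖) := by
          gcongr
          exact ((fderiv ℝ Φ v).le_opNorm w).trans (by gcongr; exact hb' v)
      _ = _ := by ring
  · refine ((hdom m).const_mul C).mono'
      (continuous_maxwellian.mul hΦ.continuous).aestronglyMeasurable
      (Eventually.of_forall fun v => ?_)
    have hM := maxwellian_pos v
    rw [norm_mul, Real.norm_of_nonneg hM.le]
    calc maxwellian v * ‖Φ v‖ ≤ maxwellian v * (C * Real.exp (m * ‖v‖)) := by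
          gcongr; exact hb v
      _ = _ := by ring
  · exact fun v _ => (hasFDerivAt_maxwellian v 0).1
  · exact fun v _ => (hΦ.differentiable one_ne_zero) v

end Maxwellian

end KineticFP

namespace KineticFP

/-! ### Mollifiers and the chain rule for `exp (-V)` -/

section Mollification

open scoped Convolution

variable {n : ℕ}

/-- A sequence of bump functions concentrating at the origin. -/
def bump (n m : ℕ) : ContDiffBump (0 : E n) where
  rIn := 1 / ((m : ℝ) + 1)
  rOut := 2 / ((m : ℝ) + 1)
  rIn_pos := by positivity
  rIn_lt_rOut := by gcongr; norm_num

/-- The mollifier associated with `bump`. -/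
def moll (n m : ℕ) : E n → ℝ := (bump n m).normed volume

/-- The mollification of a function. -/
def mollify (m : ℕ) (F : E n → ℝ) : E n → ℝ :=
  moll n m ⋆[ContinuousLinearMap.lsmul ℝ ℝ, volume] F

theorem mollify_apply (m : ℕ) (F : E n → ℝ) (x : E n) :
    mollify m F x = ∫ t, moll n m t * F (x - t) := rfl

theorem mollify_apply_swap (m : ℕ) (F : E n → ℝ) (x : E n) :
    mollify m F x = ∫ y, moll n m (x - y) * F y := by
  rw [mollify_apply, ← integral_sub_left_eq_self _ volume x]
  simp

theorem tendsto_bump_rOut : Tendsto (fun m => (bump n m).rOut) atTop (𝓝 0) := by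
  have := (tendsto_one_div_add_atTop_nhds_zero_nat (𝕜 := ℝ)).const_mul 2
  simp only [mul_zero] at this
  refine this.congr fun m => ?_
  simp [bump, div_eq_mul_inv]

theorem bump_rOut_le (m : ℕ) : (bump n m).rOut ≤ 2 := by
  simp only [bump]
  rw [div_le_iff₀ (by positivity)]
  linarith [Nat.cast_nonneg (α := ℝ) m]

theorem contDiff_moll (m : ℕ) {k : ℕ∞} : ContDiff ℝ k (moll n m) := (bump n m).contDiff_normed

theorem hasCompactSupport_moll (m : ℕ) : HasCompactSupport (moll n m) :=
  (bump n m).hasCompactSupport_normed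

theorem continuous_moll (m : ℕ) : Continuous (moll n m) := (bump n m).continuous_normed

theorem moll_nonneg (m : ℕ) (x : E n) : 0 ≤ moll n m x := (bump n m).nonneg_normed x

theorem integral_moll (m : ℕ) : ∫ x, moll n m x = 1 := (bump n m).integral_normed

theorem integrable_moll (m : ℕ) : Integrable (moll n m) volume :=
  (continuous_moll m).integrable_of_hasCompactSupport (hasCompactSupport_moll m)

theorem moll_eq_zero {m : ℕ} {x : E n} (hx : 2 ≤ ‖x‖) : moll n m x = 0 := by
  have := (bump n m).support_normed_eq (μ := volume)
  by_contra h
  have h1 : x ∈ Function.support (moll n m) := h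
  rw [moll, this, mem_ball_zero_iff] at h1
  linarith [bump_rOut_le (n := n) m]

theorem integrable_moll_mul {F : E n → ℝ} (hF : LocallyIntegrable F volume) (m : ℕ) (x : E n) :
    Integrable (fun t => moll n m t * F (x - t)) volume :=
  (hasCompactSupport_moll m).convolutionExists_left (ContinuousLinearMap.lsmul ℝ ℝ)
    (continuous_moll m) hF x

theorem ae_tendsto_mollify {F : E n → ℝ} (hF : LocallyIntegrable F volume) :
    ∀ᵐ x, Tendsto (fun m => mollify m F x) atTop (𝓝 (F x)) := by
  refine ContDiffBump.ae_convolution_tendsto_right_of_locallyIntegrable (K := 2)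
    tendsto_bump_rOut (Eventually.of_forall fun m => ?_) hF
  simp [bump, div_eq_mul_inv]

theorem contDiff_mollify {F : E n → ℝ} (hF : LocallyIntegrable F volume) (m : ℕ) {k : ℕ∞} :
    ContDiff ℝ k (mollify m F) :=
  (hasCompactSupport_moll m).contDiff_convolution_left _ (contDiff_moll m) hF

/-- Averaging preserves lower bounds, so every mollified `exp (-V)` has the same upper bound; this
is the domination needed in the chain rule. -/
theorem le_mollify {F : E n → ℝ} (hF : LocallyIntegrable F volume) {c : ℝ}
    (hc : ∀ᵐ x, c ≤ F x) (m : ℕ) (x : E n) : c ≤ mollify m F x := by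
  have h1 : ∀ᵐ t, c ≤ F (x - t) :=
    (quasiMeasurePreserving_sub_left volume x).ae hc
  calc c = ∫ t, moll n m t * c := by rw [integral_mul_const, integral_moll, one_mul]
    _ ≤ mollify m F x := by
        rw [mollify_apply]
        refine integral_mono_ae ((integrable_moll m).mul_const c) (integrable_moll_mul hF m x) ?_
        filter_upwards [h1] with t ht
        exact mul_le_mul_of_nonneg_left ht (moll_nonneg m t)

/-- Differentiation falls on the kernel, and `y ↦ moll (x - y)` is an admissible test function for
the weak gradient. -/
theorem fderiv_mollify {u : E n → ℝ} {g : E n → E n} (h : IsWeakGrad u g) (m : ℕ) (x w : E n) :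
    fderiv ℝ (mollify m u) x w = mollify m (fun y => inner ℝ (g y) w) x := by
  have hu := h.1
  have h1 := (hasCompactSupport_moll m).hasFDerivAt_convolution_left
    (ContinuousLinearMap.lsmul ℝ ℝ) (contDiff_moll (n := n) m (k := 1)) hu x
  have h2 : fderiv ℝ (mollify m u) x = _ := h1.fderiv
  have hex : Integrable (fun t => ((ContinuousLinearMap.lsmul ℝ ℝ :
      ℝ →L[ℝ] ℝ →L[ℝ] ℝ).precompL (E n)) (fderiv ℝ (moll n m) t) (u (x - t))) volume :=
    ((hasCompactSupport_moll m).fderiv ℝ).convolutionExists_left _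
      ((contDiff_moll (n := n) m (k := 1)).continuous_fderiv (by simp)) hu x
  rw [h2, convolution_def, ContinuousLinearMap.integral_apply hex]
  simp only [ContinuousLinearMap.precompL_apply, ContinuousLinearMap.lsmul_apply, smul_eq_mul]
  rw [← integral_sub_left_eq_self _ volume x, mollify_apply_swap]
  simp only [sub_sub_cancel]
  have hφ : ContDiff ℝ (⊤ : ℕ∞) fun y => moll n m (x - y) :=
    (contDiff_moll m).comp (contDiff_const.sub contDiff_id)
  have hφc : HasCompactSupport fun y => moll n m (x - y) :=
    (hasCompactSupport_moll m).comp_homeomorph (Homeomorph.subLeft x)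
  have hφd : ∀ y, fderiv ℝ (fun y => moll n m (x - y)) y w = -(fderiv ℝ (moll n m) (x - y) w) := by
    intro y
    have h3 : HasFDerivAt (moll n m) (fderiv ℝ (moll n m) (x - y)) (x - y) :=
      ((contDiff_moll (n := n) m (k := 1)).differentiable (by simp) _).hasFDerivAt
    have h4 := h3.comp y ((hasFDerivAt_id y).const_sub x)
    have h5 : fderiv ℝ (fun y => moll n m (x - y)) y = _ := h4.fderiv
    rw [h5]
    simp
  have h6 := h.2.2 _ hφ hφc w
  simp only [hφd, mul_neg, integral_neg, neg_inj] at h6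
  calc ∫ y, fderiv ℝ (moll n m) (x - y) w * u y = ∫ y, u y * fderiv ℝ (moll n m) (x - y) w := by
        congr 1 with y; ring
    _ = _ := by rw [h6]; congr 1 with y; ring

theorem integrable_mollify {F : E n → ℝ} (hF : Integrable F volume) (m : ℕ) :
    Integrable (mollify m F) volume :=
  (integrable_moll m).integrable_convolution _ hF

theorem integral_norm_mollify_le {F : E n → ℝ} (hF : Integrable F volume) (m : ℕ) :
    ∫ x, ‖mollify m F x‖ ≤ ∫ x, ‖F x‖ := by
  have h1 : ∫ x, mollify m (fun y => ‖F y‖) x = ∫ x, ‖F x‖ := by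
    have := integral_convolution (ContinuousLinearMap.lsmul ℝ ℝ) (integrable_moll (n := n) m) hF.norm
    rw [integral_moll] at this
    refine this.trans ?_
    simp
  rw [← h1]
  refine integral_mono (integrable_mollify hF m).norm (integrable_mollify hF.norm m) fun x => ?_
  rw [mollify_apply, mollify_apply]
  refine (norm_integral_le_integral_norm _).trans (le_of_eq ?_)
  congr 1 with t
  rw [norm_mul, Real.norm_of_nonneg (moll_nonneg m t)]

theorem mollify_sub {F₁ F₂ : E n → ℝ} (h₁ : LocallyIntegrable F₁ volume)
    (h₂ : LocallyIntegrable F₂ volume) (m : ℕ) (x : E n) :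
    mollify m (fun y => F₁ y - F₂ y) x = mollify m F₁ x - mollify m F₂ x := by
  simp only [mollify_apply, mul_sub]
  exact integral_sub (integrable_moll_mul h₁ m x) (integrable_moll_mul h₂ m x)

theorem tendsto_integral_norm_mollify_sub_of_continuous {c : E n → ℝ} (hc : Continuous c)
    (hcs : HasCompactSupport c) :
    Tendsto (fun m => ∫ x, ‖mollify m c x - c x‖) atTop (𝓝 0) := by
  obtain ⟨r, hr⟩ := hcs.isCompact.isBounded.subset_closedBall (0 : E n)
  set K := Metric.closedBall (0 : E n) (r + 2) with hK
  have hKm : MeasurableSet K := measurableSet_closedBall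
  obtain ⟨B, hB⟩ := hcs.exists_bound_of_continuous hc
  have hmb : ∀ m x, ‖mollify m c x‖ ≤ B := by
    intro m x
    rw [mollify_apply]
    calc ‖∫ t, moll n m t * c (x - t)‖ ≤ ∫ t, moll n m t * B := by
          refine norm_integral_le_of_norm_le ((integrable_moll m).mul_const B)
            (Eventually.of_forall fun t => ?_)
          rw [norm_mul, Real.norm_of_nonneg (moll_nonneg m t)]
          exact mul_le_mul_of_nonneg_left (hB _) (moll_nonneg m t)
      _ = B := by rw [integral_mul_const, integral_moll, one_mul]
  have hc0 : ∀ x, r < ‖x‖ → c x = 0 := by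
    intro x hx
    by_contra h
    have h1 := hr (subset_tsupport c h)
    rw [mem_closedBall_zero_iff] at h1
    linarith
  have hout : ∀ m x, x ∉ K → mollify m c x - c x = 0 := by
    intro m x hx
    rw [hK, mem_closedBall_zero_iff, not_le] at hx
    rw [hc0 x (by linarith), sub_zero, mollify_apply]
    refine integral_eq_zero_of_ae (Eventually.of_forall fun t => ?_)
    by_cases ht : 2 ≤ ‖t‖
    · simp [moll_eq_zero ht]
    · have : r < ‖x - t‖ := by
        have := norm_sub_norm_le x t
        linarith
      simp [hc0 _ this]
  have hcl : LocallyIntegrable c volume := hc.locallyIntegrable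
  have hfin : volume K < ∞ := (isCompact_closedBall _ _).measure_lt_top
  have h0 : Tendsto (fun m => ∫ x, ‖mollify m c x - c x‖) atTop (𝓝 (∫ x : E n, (0 : ℝ))) := by
    refine tendsto_integral_of_dominated_convergence (K.indicator fun _ => 2 * B) (fun m => ?_) ?_
      (fun m => Eventually.of_forall fun x => ?_) ?_
    · exact (((contDiff_mollify hcl m (k := 0)).continuous.sub hc).norm).aestronglyMeasurable
    · exact (integrable_indicator_iff hKm).mpr (integrableOn_const hfin.ne)
    · by_cases hx : x ∈ K
      · rw [indicator_of_mem hx, norm_norm]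
        calc _ ≤ ‖mollify m c x‖ + ‖c x‖ := norm_sub_le _ _
          _ ≤ 2 * B := by linarith [hmb m x, hB x]
      · rw [indicator_of_notMem hx, hout m x hx]; simp
    · refine Eventually.of_forall fun x => ?_
      have h1 : Tendsto (fun m => mollify m c x) atTop (𝓝 (c x)) :=
        ContDiffBump.convolution_tendsto_right_of_continuous tendsto_bump_rOut hc x
      have h2 := (h1.sub_const (c x)).norm
      simpa using h2
  simpa using h0

theorem tendsto_integral_norm_mollify_sub {F : E n → ℝ} (hF : Integrable F volume) :
    Tendsto (fun m => ∫ x, ‖mollify m F x - F x‖) atTop (𝓝 0) := by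
  rw [Metric.tendsto_atTop]
  intro δ hδ
  obtain ⟨c, hcs, hc3, hcc, hci⟩ := hF.exists_hasCompactSupport_integral_sub_le
    (ε := δ / 4) (by positivity)
  obtain ⟨N, hN⟩ := (Metric.tendsto_atTop.mp
    (tendsto_integral_norm_mollify_sub_of_continuous hcc hcs)) (δ / 4) (by positivity)
  refine ⟨N, fun m hm => ?_⟩
  have h1 := hN m hm
  have hnn : ∀ f : E n → ℝ, 0 ≤ ∫ x, ‖f x‖ := fun f => integral_nonneg fun x => norm_nonneg _
  rw [dist_zero_right, Real.norm_of_nonneg (hnn _)] at h1 ⊢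
  have hFc : Integrable (fun x => F x - c x) volume := hF.sub hci
  have h2 := integral_norm_mollify_le hFc m
  have i1 := (integrable_mollify hFc m).norm
  have i2 := ((integrable_mollify hci m).sub hci).norm
  have hle : ∫ x, ‖mollify m F x - F x‖ ≤ ∫ x, (‖mollify m (fun y => F y - c y) x‖
      + ‖(mollify m c - c) x‖ + ‖F x - c x‖) := by
    refine integral_mono ((integrable_mollify hF m).sub hF).norm
      ((i1.add i2).add hFc.norm) fun x => ?_
    have e : mollify m F x - F x = mollify m (fun y => F y - c y) x + (mollify m c - c) x
        - (F x - c x) := by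
      rw [mollify_sub hF.locallyIntegrable hci.locallyIntegrable]
      simp only [Pi.sub_apply]; ring
    simp only
    rw [e]
    exact (norm_sub_le _ _).trans (by gcongr; exact norm_add_le _ _)
  have hs1 : ∫ x, (‖mollify m (fun y => F y - c y) x‖ + ‖(mollify m c - c) x‖ + ‖F x - c x‖)
      = (∫ x, (‖mollify m (fun y => F y - c y) x‖ + ‖(mollify m c - c) x‖)) + ∫ x, ‖F x - c x‖ :=
    integral_add (i1.add i2) hFc.norm
  rw [hs1, integral_add i1 i2] at hle
  simp only [Pi.sub_apply] at hle
  linarith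

/-- The chain rule for the weak gradient of `exp (-V)`. -/
theorem integral_exp_neg_mul_fderiv {V : E n → ℝ} {gradV : E n → E n} (hV : IsWeakGrad V gradV)
    {c : ℝ} (hc : ∀ᵐ x, c ≤ V x) {ψ : E n → ℝ} (hψ : ContDiff ℝ 1 ψ) (hψc : HasCompactSupport ψ)
    (w : E n) :
    ∫ x, Real.exp (-V x) * fderiv ℝ ψ x w
      = ∫ x, Real.exp (-V x) * (inner ℝ (gradV x) w * ψ x) := by
  obtain ⟨r, hr⟩ := hψc.isCompact.isBounded.subset_closedBall (0 : E n)
  -- The mollifiers vanish outside the ball of radius `2`, so on the support of `ψ` the mollified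
  -- gradient sees only `g` restricted to `B`. The cutoff `gB` is globally integrable, as
  -- convergence in `L¹` requires.
  set B := Metric.closedBall (0 : E n) (r + 2) with hB
  have hBc : IsCompact B := isCompact_closedBall _ _
  have hBm : MeasurableSet B := measurableSet_closedBall
  set g : E n → ℝ := fun x => inner ℝ (gradV x) w with hg
  have hgl : LocallyIntegrable g volume := fun x => by
    obtain ⟨s, hs, hi⟩ := hV.2.1 x
    exact ⟨s, hs, hi.inner_const w⟩
  set gB : E n → ℝ := B.indicator g with hgB
  have hgBi : Integrable gB volume :=
    (integrable_indicator_iff hBm).mpr (hgl.integrableOn_isCompact hBc)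
  have hψ0 : ∀ x, ψ x ≠ 0 → ‖x‖ ≤ r := fun x hx => by
    simpa using hr (subset_tsupport ψ hx)
  have hloc : ∀ m x, ‖x‖ ≤ r → mollify m g x = mollify m gB x := by
    intro m x hx
    rw [mollify_apply, mollify_apply]
    congr 1 with t
    by_cases ht : 2 ≤ ‖t‖
    · simp [moll_eq_zero ht]
    · have : x - t ∈ B := by
        rw [hB, mem_closedBall_zero_iff]
        have := norm_sub_le x t
        linarith
      rw [hgB, indicator_of_mem this]
  obtain ⟨Cψ, hCψ⟩ := hψc.exists_bound_of_continuous hψ.continuous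
  have hdc : Continuous fun x => fderiv ℝ ψ x w :=
    (hψ.continuous_fderiv one_ne_zero).clm_apply continuous_const
  have hdcs : HasCompactSupport fun x => fderiv ℝ ψ x w := hψc.fderiv_apply ℝ w
  have hVm : ∀ m, Continuous (mollify m V) := fun m => (contDiff_mollify hV.1 m (k := 0)).continuous
  have hbd : ∀ m x, Real.exp (-mollify m V x) ≤ Real.exp (-c) := fun m x =>
    Real.exp_le_exp.mpr (neg_le_neg (le_mollify hV.1 hc m x))
  have hibp : ∀ m, ∫ x, Real.exp (-mollify m V x) * fderiv ℝ ψ x w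
      = ∫ x, Real.exp (-mollify m V x) * (mollify m gB x * ψ x) := by
    intro m
    have hVd : ContDiff ℝ 1 (fun x => Real.exp (-mollify m V x)) :=
      (contDiff_mollify hV.1 m (k := 1)).neg.exp
    have hfd : ∀ x, fderiv ℝ (fun x => Real.exp (-mollify m V x)) x w
        = -(Real.exp (-mollify m V x) * mollify m g x) := by
      intro x
      have h1 : HasFDerivAt (mollify m V) (fderiv ℝ (mollify m V) x) x :=
        ((contDiff_mollify hV.1 m (k := 1)).differentiable (by simp) x).hasFDerivAt
      have h2 : fderiv ℝ (fun x => Real.exp (-mollify m V x)) x = _ := h1.neg.exp.fderiv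
      rw [h2, ← fderiv_mollify hV]
      simp
    rw [integral_mul_fderiv_eq_neg_fderiv_mul_of_integrable, ← integral_neg]
    · congr 1 with x
      rw [hfd]
      by_cases hx : ψ x = 0
      · simp [hx]
      · rw [hloc m x (hψ0 x hx)]; ring
    · exact (((hVd.continuous_fderiv one_ne_zero).clm_apply continuous_const).mul
        hψ.continuous).integrable_of_hasCompactSupport hψc.mul_left
    · exact (hVd.continuous.mul hdc).integrable_of_hasCompactSupport hdcs.mul_left
    · exact (hVd.continuous.mul hψ.continuous).integrable_of_hasCompactSupport hψc.mul_left
    · exact fun x _ => hVd.differentiable one_ne_zero x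
    · exact fun x _ => hψ.differentiable one_ne_zero x
  have hae := ae_tendsto_mollify hV.1
  have haexp : ∀ᵐ x, Tendsto (fun m => Real.exp (-mollify m V x)) atTop (𝓝 (Real.exp (-V x))) := by
    filter_upwards [hae] with x hx
    exact (Real.continuous_exp.tendsto _).comp hx.neg
  have hem : ∀ m, AEStronglyMeasurable (fun x => Real.exp (-mollify m V x)) volume := fun m =>
    (Real.continuous_exp.comp (hVm m).neg).aestronglyMeasurable
  have hL : Tendsto (fun m => ∫ x, Real.exp (-mollify m V x) * fderiv ℝ ψ x w) atTop
      (𝓝 (∫ x, Real.exp (-V x) * fderiv ℝ ψ x w)) := by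
    refine tendsto_integral_of_dominated_convergence
      (fun x => Real.exp (-c) * ‖fderiv ℝ ψ x w‖) (fun m => (hem m).mul hdc.aestronglyMeasurable)
      ((hdc.integrable_of_hasCompactSupport hdcs).norm.const_mul _)
      (fun m => Eventually.of_forall fun x => ?_) ?_
    · rw [norm_mul, Real.norm_of_nonneg (Real.exp_pos _).le]
      exact mul_le_mul_of_nonneg_right (hbd m x) (norm_nonneg _)
    · filter_upwards [haexp] with x hx using hx.mul_const _
  have hR1 : Tendsto (fun m => ∫ x, Real.exp (-mollify m V x) * (gB x * ψ x)) atTop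
      (𝓝 (∫ x, Real.exp (-V x) * (gB x * ψ x))) := by
    have hi : Integrable (fun x => gB x * ψ x) volume :=
      hgBi.mul_bdd hψ.continuous.aestronglyMeasurable (Eventually.of_forall hCψ)
    refine tendsto_integral_of_dominated_convergence
      (fun x => Real.exp (-c) * ‖gB x * ψ x‖) (fun m => (hem m).mul hi.aestronglyMeasurable)
      (hi.norm.const_mul _)
      (fun m => Eventually.of_forall fun x => ?_) ?_
    · rw [norm_mul, Real.norm_of_nonneg (Real.exp_pos _).le]
      exact mul_le_mul_of_nonneg_right (hbd m x) (norm_nonneg _)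
    · filter_upwards [haexp] with x hx using hx.mul_const _
  have hint : ∀ (m : ℕ) (F : E n → ℝ), Integrable F volume →
      Integrable (fun x => Real.exp (-mollify m V x) * (F x * ψ x)) volume := fun m F hF =>
    (hF.mul_bdd hψ.continuous.aestronglyMeasurable (Eventually.of_forall hCψ)).bdd_mul
      (c := Real.exp (-c)) (hem m)
      (Eventually.of_forall fun x => by
        rw [Real.norm_of_nonneg (Real.exp_pos _).le]; exact hbd m x)
  -- Both factors depend on `m`: `mollify m gB` is first replaced by `gB` at an `L¹` cost, the
  -- exponential being bounded by `exp (-c)`. What remains is the dominated limit `hR1`.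
  have hR2 : Tendsto (fun m => (∫ x, Real.exp (-mollify m V x) * (mollify m gB x * ψ x))
      - ∫ x, Real.exp (-mollify m V x) * (gB x * ψ x)) atTop (𝓝 0) := by
    have h0 := (tendsto_integral_norm_mollify_sub hgBi).const_mul (Real.exp (-c) * Cψ)
    rw [mul_zero] at h0
    refine squeeze_zero_norm (fun m => ?_) h0
    rw [← integral_sub (hint m _ (integrable_mollify hgBi m)) (hint m _ hgBi),
      ← integral_const_mul]
    refine norm_integral_le_of_norm_le
      (((integrable_mollify hgBi m).sub hgBi).norm.const_mul _) (Eventually.of_forall fun x => ?_)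
    rw [← mul_sub, ← sub_mul, norm_mul, norm_mul, Real.norm_of_nonneg (Real.exp_pos _).le,
      mul_assoc]
    gcongr ?_ * ?_
    · exact hbd m x
    · rw [mul_comm]
      gcongr
      exact hCψ x
  have hR3 := hR2.add hR1
  simp only [sub_add_cancel, zero_add] at hR3
  have := tendsto_nhds_unique hL (hR3.congr fun m => (hibp m).symm)
  rw [this]
  congr 1 with x
  by_cases hx : ψ x = 0
  · simp [hx]
  · have : x ∈ B := by
      rw [hB, mem_closedBall_zero_iff]
      linarith [hψ0 x hx]
    rw [hgB, indicator_of_mem this]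

end Mollification

end KineticFP

/-! ### The equilibrium measure as a product of position and velocity measures -/

namespace KineticFP

variable {n : ℕ}

/-- The standing assumptions on the potential and the friction matrix. -/
structure Admissible (V : E n → ℝ) (gradV : E n → E n)
    (G : E n → Matrix (Fin n) (Fin n) ℝ) : Prop where
  weakGrad : IsWeakGrad V gradV
  below : ∃ c : ℝ, ∀ᵐ x, c ≤ V x
  exp : Integrable (fun x => Real.exp (-V x)) volume
  posDef : ∀ᵐ x, (G x).PosDef
  locG : ∀ i j, LocallyIntegrable (fun x => G x i j) volume
  locGinv : ∀ i j, LocallyIntegrable (fun x => (G x)⁻¹ i j) volume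
  gradSq : LocallyIntegrable (fun x => ‖gradV x‖ ^ 2) volume

/-- The spatial weight `exp (-V) / Z`. -/
def xWeight (V : E n → ℝ) (x : E n) : ℝ := Real.exp (-V x) / partitionConst V

/-- The spatial marginal of `eqMeasure`. -/
def xMeasure (V : E n → ℝ) : Measure (E n) :=
  volume.withDensity fun x => ENNReal.ofReal (xWeight V x)

/-- The standard Gaussian measure in velocity. -/
def vMeasure (n : ℕ) : Measure (E n) :=
  volume.withDensity fun v => ENNReal.ofReal (maxwellian v)

theorem equilibrium_eq (V : E n → ℝ) (p : E n × E n) :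
    equilibrium V p = xWeight V p.1 * maxwellian p.2 := by
  unfold equilibrium xWeight; ring

instance : IsProbabilityMeasure (vMeasure n) := by
  constructor
  rw [vMeasure, withDensity_apply _ MeasurableSet.univ, Measure.restrict_univ,
    ← ofReal_integral_eq_lintegral_ofReal integrable_maxwellian
      (Eventually.of_forall fun v => (maxwellian_pos v).le), integral_maxwellian, ENNReal.ofReal_one]

instance (V : E n → ℝ) : SFinite (xMeasure V) := by unfold xMeasure; infer_instance

theorem integral_vMeasure {F : Type*} [NormedAddCommGroup F] [NormedSpace ℝ F] (u : E n → F) :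
    ∫ v, u v ∂(vMeasure n) = ∫ v, maxwellian v • u v := by
  rw [vMeasure, integral_withDensity_eq_integral_toReal_smul
    (continuous_maxwellian.measurable.ennreal_ofReal)
    (Eventually.of_forall fun v => ENNReal.ofReal_lt_top)]
  simp_rw [ENNReal.toReal_ofReal (maxwellian_pos _).le]

theorem integrable_vMeasure_iff {F : Type*} [NormedAddCommGroup F] [NormedSpace ℝ F] {u : E n → F} :
    Integrable u (vMeasure n) ↔ Integrable (fun v => maxwellian v • u v) volume := by
  rw [vMeasure, integrable_withDensity_iff_integrable_smul₀'
    (continuous_maxwellian.measurable.ennreal_ofReal.aemeasurable)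
    (Eventually.of_forall fun v => ENNReal.ofReal_lt_top)]
  simp_rw [ENNReal.toReal_ofReal (maxwellian_pos _).le]

theorem integrable_exp_vMeasure (m : ℝ) :
    Integrable (fun v : E n => Real.exp (m * (1 + ‖v‖))) (vMeasure n) := by
  rw [integrable_vMeasure_iff]
  refine ((integrable_exp_norm_mul_maxwellian m).const_mul (Real.exp m)).congr
    (Eventually.of_forall fun v => ?_)
  simp only [smul_eq_mul]
  rw [mul_add, mul_one, Real.exp_add]
  ring

namespace Admissible

variable {V : E n → ℝ} {gradV : E n → E n} {G : E n → Matrix (Fin n) (Fin n) ℝ}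

theorem partitionConst_pos (h : Admissible V gradV G) : 0 < partitionConst V := by
  refine mul_pos (by positivity) (integral_exp_pos h.exp)

theorem xWeight_pos (h : Admissible V gradV G) (x : E n) : 0 < xWeight V x :=
  div_pos (Real.exp_pos _) h.partitionConst_pos

theorem equilibrium_pos (h : Admissible V gradV G) (p : E n × E n) : 0 < equilibrium V p := by
  rw [equilibrium_eq]; exact mul_pos (h.xWeight_pos _) (maxwellian_pos _)

theorem integrable_xWeight (h : Admissible V gradV G) : Integrable (xWeight V) volume :=
  h.exp.div_const _

theorem aemeasurable_xWeight (h : Admissible V gradV G) : AEMeasurable (xWeight V) volume :=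
  h.integrable_xWeight.aestronglyMeasurable.aemeasurable

theorem exists_xWeight_le (h : Admissible V gradV G) :
    ∃ W : ℝ, 0 < W ∧ ∀ᵐ x, xWeight V x ≤ W := by
  obtain ⟨c, hc⟩ := h.below
  refine ⟨Real.exp (-c) / partitionConst V, div_pos (Real.exp_pos _) h.partitionConst_pos, ?_⟩
  filter_upwards [hc] with x hx
  have := h.partitionConst_pos
  unfold xWeight
  gcongr

theorem isFiniteMeasure_xMeasure (h : Admissible V gradV G) : IsFiniteMeasure (xMeasure V) :=
  isFiniteMeasure_withDensity_ofReal h.integrable_xWeight.2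

theorem eqMeasure_eq_prod (h : Admissible V gradV G) :
    eqMeasure V = (xMeasure V).prod (vMeasure n) := by
  rw [xMeasure, vMeasure, prod_withDensity₀ h.aemeasurable_xWeight.ennreal_ofReal
    continuous_maxwellian.measurable.ennreal_ofReal.aemeasurable]
  unfold eqMeasure
  rw [Measure.volume_eq_prod]
  congr 1 with p
  rw [equilibrium_eq, ENNReal.ofReal_mul (h.xWeight_pos _).le]

theorem isFiniteMeasure_eqMeasure (h : Admissible V gradV G) : IsFiniteMeasure (eqMeasure V) := by
  have := h.isFiniteMeasure_xMeasure
  rw [h.eqMeasure_eq_prod]; infer_instance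

theorem measurePreserving_fst (h : Admissible V gradV G) :
    MeasurePreserving (Prod.fst : E n × E n → E n) (eqMeasure V) (xMeasure V) := by
  rw [h.eqMeasure_eq_prod]; exact MeasureTheory.measurePreserving_fst

/-- The lower bound on `V` bounds the density of the spatial measure, so functions in `L²(dx)` lie
in `L²` of that measure. -/
theorem exists_xMeasure_le (h : Admissible V gradV G) :
    ∃ W : ℝ≥0, xMeasure V ≤ (W : ℝ≥0∞) • volume := by
  obtain ⟨W, hW, hle⟩ := h.exists_xWeight_le
  refine ⟨W.toNNReal, ?_⟩
  rw [← withDensity_const]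
  refine withDensity_mono ?_
  filter_upwards [hle] with x hx
  exact ENNReal.ofReal_le_ofReal hx

theorem xMeasure_ac (_h : Admissible V gradV G) : xMeasure V ≪ volume :=
  withDensity_absolutelyContinuous _ _

theorem eqMeasure_ac (_h : Admissible V gradV G) : eqMeasure V ≪ volume :=
  withDensity_absolutelyContinuous _ _

theorem aemeasurable_equilibrium (h : Admissible V gradV G) :
    AEMeasurable (equilibrium V) volume := by
  have e : equilibrium V = fun p => xWeight V p.1 * maxwellian p.2 := by
    ext p; exact equilibrium_eq V p
  rw [e]
  refine AEMeasurable.mul ?_ ?_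
  · exact h.aemeasurable_xWeight.comp_quasiMeasurePreserving Measure.quasiMeasurePreserving_fst
  · exact (continuous_maxwellian.comp continuous_snd).measurable.aemeasurable

/-- The equilibrium is everywhere positive, so null sets of `μ` are Lebesgue null; representatives
can be moved freely between the two measures. -/
theorem ac_eqMeasure (h : Admissible V gradV G) : volume ≪ eqMeasure V :=
  withDensity_absolutelyContinuous' h.aemeasurable_equilibrium.ennreal_ofReal
    (Eventually.of_forall fun x => by
      simpa using h.equilibrium_pos x)

theorem integral_eqMeasure (h : Admissible V gradV G) {F : Type*} [NormedAddCommGroup F]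
    [NormedSpace ℝ F] (u : E n × E n → F) :
    ∫ p, u p ∂(eqMeasure V) = ∫ p, equilibrium V p • u p := by
  rw [eqMeasure, integral_withDensity_eq_integral_toReal_smul₀
    h.aemeasurable_equilibrium.ennreal_ofReal
    (Eventually.of_forall fun v => ENNReal.ofReal_lt_top)]
  simp_rw [ENNReal.toReal_ofReal (h.equilibrium_pos _).le]

theorem integrable_eqMeasure_iff (h : Admissible V gradV G) {F : Type*} [NormedAddCommGroup F]
    [NormedSpace ℝ F] {u : E n × E n → F} :
    Integrable u (eqMeasure V) ↔ Integrable (fun p => equilibrium V p • u p) volume := by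
  rw [eqMeasure, integrable_withDensity_iff_integrable_smul₀'
    h.aemeasurable_equilibrium.ennreal_ofReal
    (Eventually.of_forall fun v => ENNReal.ofReal_lt_top)]
  simp_rw [ENNReal.toReal_ofReal (h.equilibrium_pos _).le]

theorem integral_xMeasure (h : Admissible V gradV G) {F : Type*} [NormedAddCommGroup F]
    [NormedSpace ℝ F] (u : E n → F) :
    ∫ x, u x ∂(xMeasure V) = ∫ x, xWeight V x • u x := by
  rw [xMeasure, integral_withDensity_eq_integral_toReal_smul₀
    h.aemeasurable_xWeight.ennreal_ofReal
    (Eventually.of_forall fun v => ENNReal.ofReal_lt_top)]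
  simp_rw [ENNReal.toReal_ofReal (h.xWeight_pos _).le]

end Admissible

/-! ### Test functions of exponential growth in velocity -/

/-- An envelope supported in a ball in `x` and of exponential growth in `v`. -/
def envelope (N : ℕ) (p : E n × E n) : ℝ :=
  (Metric.closedBall (0 : E n) N).indicator (fun _ => (1 : ℝ)) p.1 * Real.exp (N * (1 + ‖p.2‖))

theorem envelope_nonneg (N : ℕ) (p : E n × E n) : 0 ≤ envelope N p :=
  mul_nonneg (indicator_nonneg (fun _ _ => zero_le_one) _) (Real.exp_pos _).le

theorem envelope_mono {N M : ℕ} (h : N ≤ M) (p : E n × E n) : envelope N p ≤ envelope M p := by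
  have hNM : (N : ℝ) ≤ M := by exact_mod_cast h
  unfold envelope
  gcongr
  exact indicator_nonneg (fun _ _ => zero_le_one) _

/-- The index governs both the radius in `x` and the exponential rate in `v`. Constants, factors `1
+ ‖v‖` and products of envelopes can therefore all be absorbed by raising it, which makes the test
class stable under the operations used. -/
theorem envelope_mul_exp (N M : ℕ) (p : E n × E n) :
    envelope N p * Real.exp (M * (1 + ‖p.2‖)) ≤ envelope (N + M) p := by
  unfold envelope
  rw [mul_assoc, ← Real.exp_add, ← add_mul, ← Nat.cast_add]
  have h2 : (N : ℝ) ≤ (N + M : ℕ) := by exact_mod_cast Nat.le_add_right N M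
  gcongr

theorem mul_envelope_le (N M : ℕ) (p : E n × E n) :
    envelope M p * envelope N p ≤ envelope (N + M) p := by
  refine le_trans ?_ (envelope_mul_exp N M p)
  rw [mul_comm]
  refine mul_le_mul_of_nonneg_left ?_ (envelope_nonneg _ _)
  unfold envelope
  refine mul_le_of_le_one_left (Real.exp_pos _).le ?_
  exact indicator_le_self' (fun _ _ => zero_le_one) _

theorem natCast_mul_envelope_le (N M : ℕ) (p : E n × E n) :
    M * envelope N p ≤ envelope (N + M) p := by
  refine le_trans ?_ (envelope_mul_exp N M p)
  rw [mul_comm]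
  refine mul_le_mul_of_nonneg_left ?_ (envelope_nonneg _ _)
  have h1 : (M : ℝ) ≤ M * (1 + ‖p.2‖) := le_mul_of_one_le_right (by positivity) (by simp)
  linarith [Real.add_one_le_exp (M * (1 + ‖p.2‖))]

theorem one_add_norm_mul_envelope_le (N : ℕ) (p : E n × E n) :
    (1 + ‖p.2‖) * envelope N p ≤ envelope (N + 1) p := by
  refine le_trans ?_ (envelope_mul_exp N 1 p)
  rw [mul_comm]
  refine mul_le_mul_of_nonneg_left ?_ (envelope_nonneg _ _)
  rw [Nat.cast_one, one_mul]
  linarith [Real.add_one_le_exp (1 + ‖p.2‖)]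

theorem measurable_envelope (N : ℕ) : Measurable (envelope (n := n) N) := by
  unfold envelope
  refine Measurable.mul ?_ ?_
  · exact (measurable_const.indicator measurableSet_closedBall).comp measurable_fst
  · exact (by fun_prop : Continuous fun p : E n × E n => Real.exp (N * (1 + ‖p.2‖))).measurable

namespace Admissible

variable {V : E n → ℝ} {gradV : E n → E n} {G : E n → Matrix (Fin n) (Fin n) ℝ}

theorem integrable_mul_envelope (h : Admissible V gradV G) {a : E n → ℝ}
    (ha : LocallyIntegrable a volume) (N : ℕ) :
    Integrable (fun p : E n × E n => a p.1 * envelope N p) (eqMeasure V) := by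
  obtain ⟨W, hW⟩ := h.exists_xMeasure_le
  have h1 : Integrable ((Metric.closedBall (0 : E n) N).indicator a) (xMeasure V) := by
    refine Integrable.mono_measure (Integrable.smul_measure ?_ ENNReal.coe_ne_top) hW
    exact (integrable_indicator_iff measurableSet_closedBall).mpr
      (ha.integrableOn_isCompact (isCompact_closedBall _ _))
  rw [h.eqMeasure_eq_prod]
  refine (h1.mul_prod (integrable_exp_vMeasure N)).congr (Eventually.of_forall fun p => ?_)
  simp only [envelope]
  by_cases hp : p.1 ∈ Metric.closedBall (0 : E n) N
  · rw [indicator_of_mem hp, indicator_of_mem hp, one_mul]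
  · rw [indicator_of_notMem hp, indicator_of_notMem hp]; ring

theorem integrable_of_le_envelope (h : Admissible V gradV G) {F : Type*} [NormedAddCommGroup F]
    {u : E n × E n → F} (hu : AEStronglyMeasurable u volume) {a : E n → ℝ}
    (ha : LocallyIntegrable a volume) (N : ℕ)
    (hle : ∀ p, ‖u p‖ ≤ a p.1 * envelope N p) : Integrable u (eqMeasure V) :=
  (h.integrable_mul_envelope ha N).mono' (hu.mono_ac h.eqMeasure_ac) (Eventually.of_forall hle)

/-- A product of a locally square integrable function of `x` and an envelope is square integrable
for `μ`, since the Gaussian absorbs the growth in `v`. All rough coefficients enter the argument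
through this criterion. -/
theorem memLp_two_of_le_envelope (h : Admissible V gradV G) {F : Type*} [NormedAddCommGroup F]
    {u : E n × E n → F} (hu : AEStronglyMeasurable u volume) {b : E n → ℝ}
    (hb : LocallyIntegrable (fun x => b x ^ 2) volume) (N : ℕ)
    (hle : ∀ p, ‖u p‖ ≤ b p.1 * envelope N p) : MemLp u 2 (eqMeasure V) := by
  rw [memLp_two_iff_integrable_sq_norm (hu.mono_ac h.eqMeasure_ac)]
  refine h.integrable_of_le_envelope (hu.norm.pow 2) hb (N + N) fun p => ?_
  rw [Real.norm_of_nonneg (by positivity)]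
  calc ‖u p‖ ^ 2 ≤ (b p.1 * envelope N p) ^ 2 := by gcongr; exact hle p
    _ = b p.1 ^ 2 * (envelope N p * envelope N p) := by ring
    _ ≤ _ := by gcongr; exact mul_envelope_le N N p

end Admissible

/-- The class of test functions: `C¹`, compactly supported in `x`, of exponential growth in `v`. -/
structure IsTest (Φ : E n × E n → ℝ) : Prop where
  contDiff : ContDiff ℝ 1 Φ
  bound : ∃ N, ∀ p, ‖Φ p‖ ≤ envelope N p ∧ ‖fderiv ℝ Φ p‖ ≤ envelope N p

namespace IsTest

variable {Φ Ψ : E n × E n → ℝ}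

theorem differentiable (h : IsTest Φ) : Differentiable ℝ Φ := h.contDiff.differentiable one_ne_zero

theorem continuous_fderiv (h : IsTest Φ) : Continuous (fderiv ℝ Φ) :=
  h.contDiff.continuous_fderiv one_ne_zero

theorem add (hΦ : IsTest Φ) (hΨ : IsTest Ψ) : IsTest (Φ + Ψ) := by
  obtain ⟨N, hN⟩ := hΦ.bound
  obtain ⟨M, hM⟩ := hΨ.bound
  refine ⟨hΦ.contDiff.add hΨ.contDiff, (N + M) + 2, fun p => ?_⟩
  have h1 := envelope_mono (n := n) (Nat.le_add_right N M) p
  have h2 := envelope_mono (n := n) (Nat.le_add_left M N) p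
  have h3 := natCast_mul_envelope_le (n := n) (N + M) 2 p
  push_cast at h3
  rw [fderiv_add (hΦ.differentiable p) (hΨ.differentiable p)]
  constructor
  · refine (norm_add_le _ _).trans ?_
    linarith [(hN p).1, (hM p).1]
  · refine (norm_add_le _ _).trans ?_
    linarith [(hN p).2, (hM p).2]

theorem const_smul (hΦ : IsTest Φ) (c : ℝ) : IsTest (c • Φ) := by
  obtain ⟨N, hN⟩ := hΦ.bound
  obtain ⟨M, hM⟩ := exists_nat_ge ‖c‖
  refine ⟨contDiff_const.smul hΦ.contDiff, N + M, fun p => ?_⟩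
  have h3 := natCast_mul_envelope_le (n := n) N M p
  rw [fderiv_const_smul (hΦ.differentiable p)]
  constructor
  · rw [Pi.smul_apply, norm_smul]
    refine le_trans ?_ h3
    gcongr
    exact (hN p).1
  · rw [norm_smul]
    refine le_trans ?_ h3
    gcongr
    exact (hN p).2

theorem mul (hΦ : IsTest Φ) (hΨ : IsTest Ψ) : IsTest (Φ * Ψ) := by
  obtain ⟨N, hN⟩ := hΦ.bound
  obtain ⟨M, hM⟩ := hΨ.bound
  refine ⟨hΦ.contDiff.mul hΨ.contDiff, (M + N) + 2, fun p => ?_⟩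
  have h1 := mul_envelope_le (n := n) M N p
  have h3 := natCast_mul_envelope_le (n := n) (M + N) 2 p
  have h4 := envelope_mono (n := n) (Nat.le_add_right (M + N) 2) p
  push_cast at h3
  have e0 := envelope_nonneg N p
  have e1 := envelope_nonneg M p
  rw [fderiv_mul (hΦ.differentiable p) (hΨ.differentiable p)]
  constructor
  · rw [Pi.mul_apply, norm_mul]
    refine le_trans ?_ (h1.trans h4)
    gcongr
    exacts [(hN p).1, (hM p).1]
  · refine (norm_add_le _ _).trans ?_
    rw [norm_smul, norm_smul]
    have h5 : ‖Φ p‖ * ‖fderiv ℝ Ψ p‖ ≤ envelope N p * envelope M p := by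
      gcongr
      exacts [(hN p).1, (hM p).2]
    have h6 : ‖Ψ p‖ * ‖fderiv ℝ Φ p‖ ≤ envelope M p * envelope N p := by
      gcongr
      exacts [(hM p).1, (hN p).2]
    linarith

theorem inner_snd_mul (hΦ : IsTest Φ) (w : E n) : IsTest fun p => inner ℝ w p.2 * Φ p := by
  obtain ⟨N, hN⟩ := hΦ.bound
  obtain ⟨M, hM⟩ := exists_nat_ge ‖w‖
  refine ⟨(contDiff_const.inner ℝ contDiff_snd).mul hΦ.contDiff, N + 1 + M, fun p => ?_⟩
  have h2 := one_add_norm_mul_envelope_le (n := n) N p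
  have h3 := natCast_mul_envelope_le (n := n) (N + 1) M p
  have e0 := envelope_nonneg N p
  have hi : ‖inner ℝ w p.2‖ ≤ ‖w‖ * ‖p.2‖ := norm_inner_le_norm _ _
  have hw : ‖w‖ * ((1 + ‖p.2‖) * envelope N p) ≤ M * envelope (N + 1) p := by gcongr
  constructor
  · rw [norm_mul]
    calc _ ≤ (‖w‖ * ‖p.2‖) * envelope N p := by
          gcongr
          exact (hN p).1
      _ ≤ ‖w‖ * ((1 + ‖p.2‖) * envelope N p) := by
          rw [mul_assoc]; gcongr; linarith
      _ ≤ _ := hw.trans h3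
  · have hd : HasFDerivAt (fun p : E n × E n => inner ℝ w p.2)
        ((innerSL ℝ w).comp (ContinuousLinearMap.snd ℝ (E n) (E n))) p :=
      ((innerSL ℝ w).comp (ContinuousLinearMap.snd ℝ (E n) (E n))).hasFDerivAt
    have hd2 := hd.mul (hΦ.differentiable p).hasFDerivAt
    have hd3 : fderiv ℝ (fun p => inner ℝ w p.2 * Φ p) p = _ := hd2.fderiv
    rw [hd3]
    have hn : ‖(innerSL ℝ w).comp (ContinuousLinearMap.snd ℝ (E n) (E n))‖ ≤ ‖w‖ := by
      refine (ContinuousLinearMap.opNorm_comp_le _ _).trans ?_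
      rw [innerSL_apply_norm]
      exact mul_le_of_le_one_right (norm_nonneg _) (ContinuousLinearMap.norm_snd_le _ _ _)
    refine (norm_add_le _ _).trans ?_
    rw [norm_smul, norm_smul]
    calc _ ≤ (‖w‖ * ‖p.2‖) * envelope N p + envelope N p * ‖w‖ := by
          gcongr
          exacts [(hN p).2, (hN p).1]
      _ = ‖w‖ * ((1 + ‖p.2‖) * envelope N p) := by ring
      _ ≤ _ := hw.trans h3

theorem of_bounds (hΦ : ContDiff ℝ 1 Φ) {r C : ℝ} (h0 : ∀ p, r < ‖p.1‖ → Φ p = 0)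
    (h1 : ∀ p, ‖Φ p‖ ≤ C) (h2 : ∀ p, ‖fderiv ℝ Φ p‖ ≤ C) : IsTest Φ := by
  obtain ⟨N, hN⟩ := exists_nat_ge (max r C)
  have hr : r ≤ N := (le_max_left _ _).trans hN
  have hC : C ≤ N := (le_max_right _ _).trans hN
  refine ⟨hΦ, N, fun p => ?_⟩
  by_cases hp : ‖p.1‖ ≤ N
  · have he : C ≤ envelope N p := by
      unfold envelope
      rw [indicator_of_mem (by simpa using hp), one_mul]
      have h1 : (N : ℝ) ≤ N * (1 + ‖p.2‖) := le_mul_of_one_le_right (by positivity) (by simp)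
      linarith [Real.add_one_le_exp ((N : ℝ) * (1 + ‖p.2‖))]
    exact ⟨(h1 p).trans he, (h2 p).trans he⟩
  · push Not at hp
    have hev : Φ =ᶠ[𝓝 p] fun _ => 0 := by
      have ho : IsOpen {q : E n × E n | (N : ℝ) < ‖q.1‖} :=
        isOpen_lt continuous_const continuous_fst.norm
      filter_upwards [ho.mem_nhds hp] with q hq
      exact h0 q (hr.trans_lt hq)
    rw [hev.fderiv_eq, h0 p (hr.trans_lt hp)]
    simp [envelope_nonneg]

theorem of_hasCompactSupport (hΦ : ContDiff ℝ 1 Φ) (hc : HasCompactSupport Φ) : IsTest Φ := by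
  obtain ⟨r, hr⟩ := hc.isCompact.isBounded.subset_closedBall (0 : E n × E n)
  obtain ⟨C₁, h₁⟩ := hc.exists_bound_of_continuous hΦ.continuous
  obtain ⟨C₂, h₂⟩ := (hc.fderiv ℝ).exists_bound_of_continuous (hΦ.continuous_fderiv one_ne_zero)
  refine of_bounds (r := r) (C := max C₁ C₂) hΦ (fun p hp => ?_)
    (fun p => (h₁ p).trans (le_max_left _ _)) (fun p => (h₂ p).trans (le_max_right _ _))
  by_contra h
  have h1 := hr (subset_tsupport Φ h)
  rw [mem_closedBall_zero_iff] at h1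
  linarith [norm_fst_le p]

theorem fderiv_comp_fst {φ : E n → ℝ} (hφ : Differentiable ℝ φ) (p : E n × E n) :
    fderiv ℝ (fun p : E n × E n => φ p.1) p
      = (fderiv ℝ φ p.1).comp (ContinuousLinearMap.fst ℝ (E n) (E n)) :=
  ((hφ p.1).hasFDerivAt.comp p hasFDerivAt_fst).fderiv

theorem comp_fst {φ : E n → ℝ} (hφ : ContDiff ℝ 1 φ) (hc : HasCompactSupport φ) :
    IsTest fun p : E n × E n => φ p.1 := by
  obtain ⟨r, hr⟩ := hc.isCompact.isBounded.subset_closedBall (0 : E n)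
  obtain ⟨C₁, h₁⟩ := hc.exists_bound_of_continuous hφ.continuous
  obtain ⟨C₂, h₂⟩ := (hc.fderiv ℝ).exists_bound_of_continuous (hφ.continuous_fderiv one_ne_zero)
  refine of_bounds (r := r) (C := max C₁ C₂) (hφ.comp contDiff_fst) (fun p hp => ?_)
    (fun p => (h₁ _).trans (le_max_left _ _)) (fun p => ?_)
  · by_contra h
    have h1 := hr (subset_tsupport φ h)
    rw [mem_closedBall_zero_iff] at h1
    linarith
  · rw [fderiv_comp_fst (hφ.differentiable one_ne_zero)]
    refine (ContinuousLinearMap.opNorm_comp_le _ _).trans ?_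
    refine (mul_le_of_le_one_right (norm_nonneg _) (ContinuousLinearMap.norm_fst_le _ _ _)).trans ?_
    exact (h₂ _).trans (le_max_right _ _)

end IsTest

/-! ### Integration by parts against the equilibrium measure -/

/-- The gradient in the velocity variable. -/
def vGrad (Φ : E n × E n → ℝ) (p : E n × E n) : E n :=
  (InnerProductSpace.toDual ℝ (E n)).symm
    ((fderiv ℝ Φ p).comp (ContinuousLinearMap.inr ℝ (E n) (E n)))

theorem inner_vGrad (Φ : E n × E n → ℝ) (p : E n × E n) (w : E n) :
    inner ℝ (vGrad Φ p) w = fderiv ℝ Φ p (0, w) := by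
  simp [vGrad, InnerProductSpace.toDual_symm_apply]

theorem norm_vGrad_le (Φ : E n × E n → ℝ) (p : E n × E n) : ‖vGrad Φ p‖ ≤ ‖fderiv ℝ Φ p‖ := by
  rw [vGrad, LinearIsometryEquiv.norm_map]
  refine (ContinuousLinearMap.opNorm_comp_le _ _).trans ?_
  exact mul_le_of_le_one_right (norm_nonneg _) (ContinuousLinearMap.norm_inr_le_one _ _ _)

theorem IsTest.continuous_vGrad {Φ : E n × E n → ℝ} (h : IsTest Φ) : Continuous (vGrad Φ) := by
  unfold vGrad
  exact (LinearIsometryEquiv.continuous _).comp (h.continuous_fderiv.clm_comp continuous_const)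

namespace Admissible

variable {V : E n → ℝ} {gradV : E n → E n} {G : E n → Matrix (Fin n) (Fin n) ℝ}
  {Φ : E n × E n → ℝ}

theorem integral_fderiv_snd (h : Admissible V gradV G) (hΦ : IsTest Φ) (w : E n) :
    ∫ p, fderiv ℝ Φ p (0, w) ∂(eqMeasure V) = ∫ p, inner ℝ p.2 w * Φ p ∂(eqMeasure V) := by
  obtain ⟨N, hN⟩ := hΦ.bound
  have hc := hΦ.contDiff.continuous
  have i1 : Integrable (fun p => fderiv ℝ Φ p (0, w)) (eqMeasure V) := by
    refine h.integrable_of_le_envelope (a := fun _ => ‖w‖)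
      (hΦ.continuous_fderiv.clm_apply continuous_const).aestronglyMeasurable
      (locallyIntegrable_const _) N fun p => ?_
    refine ((fderiv ℝ Φ p).le_opNorm _).trans ?_
    rw [mul_comm]
    have : ‖((0 : E n), w)‖ = ‖w‖ := by simp [Prod.norm_def]
    rw [this]
    gcongr
    exact (hN p).2
  have i2 : Integrable (fun p : E n × E n => inner ℝ p.2 w * Φ p) (eqMeasure V) := by
    obtain ⟨M, hM⟩ := (hΦ.inner_snd_mul w).bound
    refine h.integrable_of_le_envelope (a := fun _ => 1)
      (by fun_prop : Continuous fun p : E n × E n => inner ℝ p.2 w * Φ p).aestronglyMeasurable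
      (locallyIntegrable_const _) M fun p => ?_
    rw [one_mul, real_inner_comm]
    exact (hM p).1
  rw [h.eqMeasure_eq_prod] at i1 i2 ⊢
  have := h.isFiniteMeasure_xMeasure
  rw [integral_prod _ i1, integral_prod _ i2]
  congr 1 with x
  rw [integral_vMeasure, integral_vMeasure]
  simp only [smul_eq_mul]
  have hd : ∀ v, fderiv ℝ (fun v => Φ (x, v)) v
      = (fderiv ℝ Φ (x, v)).comp (ContinuousLinearMap.inr ℝ (E n) (E n)) := fun v =>
    ((hΦ.differentiable (x, v)).hasFDerivAt.comp v (hasFDerivAt_prodMk_right x v)).fderiv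
  have hb : ∀ v : E n, envelope N (x, v) ≤ Real.exp N * Real.exp (N * ‖v‖) := by
    intro v
    unfold envelope
    rw [← Real.exp_add, mul_add, mul_one]
    refine mul_le_of_le_one_left (Real.exp_pos _).le ?_
    exact indicator_le_self' (fun _ _ => zero_le_one) _
  have := integral_fderiv_mul_maxwellian (Φ := fun v => Φ (x, v))
    (hΦ.contDiff.comp (contDiff_const.prodMk contDiff_id)) (Real.exp N) N
    (fun v => ((hN (x, v)).1).trans (hb v)) (fun v => ?_) w
  · simpa [hd] using this
  · rw [hd]
    refine (ContinuousLinearMap.opNorm_comp_le _ _).trans ?_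
    refine (mul_le_of_le_one_right (norm_nonneg _)
      (ContinuousLinearMap.norm_inr_le_one _ _ _)).trans ?_
    exact ((hN (x, v)).2).trans (hb v)

theorem locallyIntegrable_one_add_gradV_sq (h : Admissible V gradV G) :
    LocallyIntegrable (fun x => (1 + ‖gradV x‖) ^ 2) volume := by
  have h1 : LocallyIntegrable (fun x => 2 + 2 * ‖gradV x‖ ^ 2) volume :=
    (locallyIntegrable_const 2).add (h.gradSq.smul (2 : ℝ))
  refine h1.mono ((aestronglyMeasurable_const.add
    h.weakGrad.2.1.aestronglyMeasurable.norm).pow 2) (Eventually.of_forall fun x => ?_)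
  rw [Real.norm_of_nonneg (by positivity), Real.norm_of_nonneg (by positivity)]
  nlinarith [sq_nonneg (1 - ‖gradV x‖)]

theorem aestronglyMeasurable_gradV_fst (h : Admissible V gradV G) :
    AEStronglyMeasurable (fun p : E n × E n => gradV p.1) volume :=
  h.weakGrad.2.1.aestronglyMeasurable.comp_quasiMeasurePreserving
    Measure.quasiMeasurePreserving_fst

/-- The equilibrium is stationary for the transport field: integrating `v·∇ₓΦ` by parts in `x` and
`∇V·∇ᵥΦ` by parts in `v` both give the integral of `(∇V·v)Φ`. -/
theorem integral_transport (h : Admissible V gradV G) (hΦ : IsTest Φ) :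
    ∫ p, fderiv ℝ Φ p (p.2, -gradV p.1) ∂(eqMeasure V) = 0 := by
  obtain ⟨N, hN⟩ := hΦ.bound
  have hc := hΦ.contDiff.continuous
  have hg := h.aestronglyMeasurable_gradV_fst
  have happ : ∀ y : E n × E n → E n × E n, AEStronglyMeasurable y volume →
      AEStronglyMeasurable (fun p => fderiv ℝ Φ p (y p)) volume := fun y hy =>
    isBoundedBilinearMap_apply.continuous.comp_aestronglyMeasurable
      (hΦ.continuous_fderiv.aestronglyMeasurable.prodMk hy)
  have hVl : LocallyIntegrable (fun x => ‖gradV x‖) volume := fun x =>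
    (h.weakGrad.2.1 x).norm
  have i1 : Integrable (fun p : E n × E n => fderiv ℝ Φ p (p.2, 0)) (eqMeasure V) := by
    refine h.integrable_of_le_envelope (a := fun _ => 1)
      (happ _ (continuous_snd.prodMk continuous_const).aestronglyMeasurable)
      (locallyIntegrable_const _) (N + 1) fun p => ?_
    refine ((fderiv ℝ Φ p).le_opNorm _).trans ?_
    have : ‖(p.2, (0 : E n))‖ = ‖p.2‖ := by simp [Prod.norm_def]
    rw [this, one_mul]
    refine le_trans ?_ (one_add_norm_mul_envelope_le N p)
    rw [mul_comm]
    gcongr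
    · linarith
    · exact (hN p).2
  have i2 : Integrable (fun p : E n × E n => fderiv ℝ Φ p (0, gradV p.1)) (eqMeasure V) := by
    refine h.integrable_of_le_envelope (a := fun x => ‖gradV x‖)
      (happ _ (aestronglyMeasurable_const.prodMk hg)) hVl N fun p => ?_
    refine ((fderiv ℝ Φ p).le_opNorm _).trans ?_
    have : ‖((0 : E n), gradV p.1)‖ = ‖gradV p.1‖ := by simp [Prod.norm_def]
    rw [this, mul_comm]
    gcongr
    exact (hN p).2
  have i3 : Integrable (fun p : E n × E n => inner ℝ (gradV p.1) p.2 * Φ p) (eqMeasure V) := by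
    refine h.integrable_of_le_envelope (a := fun x => ‖gradV x‖)
      ((hg.inner continuous_snd.aestronglyMeasurable).mul hc.aestronglyMeasurable) hVl (N + 1)
      fun p => ?_
    rw [norm_mul]
    refine le_trans ?_ (mul_le_mul_of_nonneg_left (one_add_norm_mul_envelope_le N p)
      (norm_nonneg _))
    rw [← mul_assoc]
    gcongr
    · refine (norm_inner_le_norm _ _).trans ?_
      gcongr
      linarith
    · exact (hN p).1
  have := h.isFiniteMeasure_xMeasure
  -- The `x` integral is taken with `v` frozen, so `v` serves as the fixed direction in the chain
  -- rule for `exp (-V)`.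
  have e1 : ∫ p, fderiv ℝ Φ p (p.2, 0) ∂(eqMeasure V)
      = ∫ p, inner ℝ (gradV p.1) p.2 * Φ p ∂(eqMeasure V) := by
    rw [h.eqMeasure_eq_prod] at i1 i3 ⊢
    rw [integral_prod_symm _ i1, integral_prod_symm _ i3]
    congr 1 with v
    rw [h.integral_xMeasure, h.integral_xMeasure]
    simp only [smul_eq_mul, xWeight, div_mul_eq_mul_div]
    rw [integral_div, integral_div]
    congr 1
    obtain ⟨c, hc'⟩ := h.below
    have hd : ∀ x, fderiv ℝ (fun x => Φ (x, v)) x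
        = (fderiv ℝ Φ (x, v)).comp (ContinuousLinearMap.inl ℝ (E n) (E n)) := fun x =>
      ((hΦ.differentiable (x, v)).hasFDerivAt.comp x (hasFDerivAt_prodMk_left x v)).fderiv
    have hsupp : HasCompactSupport fun x => Φ (x, v) := by
      refine HasCompactSupport.intro (isCompact_closedBall (0 : E n) N) fun x hx => ?_
      have h1 := (hN (x, v)).1
      rw [envelope, indicator_of_notMem hx, zero_mul] at h1
      exact norm_le_zero_iff.mp h1
    have := integral_exp_neg_mul_fderiv h.weakGrad hc' (ψ := fun x => Φ (x, v))
      (hΦ.contDiff.comp (contDiff_id.prodMk contDiff_const)) hsupp v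
    simpa [hd] using this
  -- Here `x` is frozen and `∇V(x)` is the fixed direction in the Gaussian integration by parts.
  have e2 : ∫ p, fderiv ℝ Φ p (0, gradV p.1) ∂(eqMeasure V)
      = ∫ p, inner ℝ (gradV p.1) p.2 * Φ p ∂(eqMeasure V) := by
    rw [h.eqMeasure_eq_prod] at i2 i3 ⊢
    rw [integral_prod _ i2, integral_prod _ i3]
    congr 1 with x
    rw [integral_vMeasure, integral_vMeasure]
    simp only [smul_eq_mul]
    have hd : ∀ v, fderiv ℝ (fun v => Φ (x, v)) v
        = (fderiv ℝ Φ (x, v)).comp (ContinuousLinearMap.inr ℝ (E n) (E n)) := fun v =>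
      ((hΦ.differentiable (x, v)).hasFDerivAt.comp v (hasFDerivAt_prodMk_right x v)).fderiv
    have hb : ∀ v : E n, envelope N (x, v) ≤ Real.exp N * Real.exp (N * ‖v‖) := by
      intro v
      unfold envelope
      rw [← Real.exp_add, mul_add, mul_one]
      refine mul_le_of_le_one_left (Real.exp_pos _).le ?_
      exact indicator_le_self' (fun _ _ => zero_le_one) _
    have := integral_fderiv_mul_maxwellian (Φ := fun v => Φ (x, v))
      (hΦ.contDiff.comp (contDiff_const.prodMk contDiff_id)) (Real.exp N) N
      (fun v => ((hN (x, v)).1).trans (hb v)) (fun v => ?_) (gradV x)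
    · rw [show (fun v => maxwellian v * (inner ℝ (gradV x) v * Φ (x, v)))
        = fun v => maxwellian v * (inner ℝ v (gradV x) * Φ (x, v)) by
          ext v; rw [real_inner_comm]]
      simpa [hd] using this
    · rw [hd]
      refine (ContinuousLinearMap.opNorm_comp_le _ _).trans ?_
      refine (mul_le_of_le_one_right (norm_nonneg _)
        (ContinuousLinearMap.norm_inr_le_one _ _ _)).trans ?_
      exact ((hN (x, v)).2).trans (hb v)
  have e3 : ∀ p : E n × E n, fderiv ℝ Φ p (p.2, -gradV p.1)
      = fderiv ℝ Φ p (p.2, 0) - fderiv ℝ Φ p (0, gradV p.1) := fun p => by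
    rw [← map_sub]; simp
  simp_rw [e3]
  rw [integral_sub i1 i2, e1, e2, sub_self]

end Admissible

end KineticFP

/-! ### The resolvent equation on test functions -/

namespace KineticFP

variable {n : ℕ}

section L2

variable {α F : Type*} [MeasurableSpace α] {μ : Measure α} [NormedAddCommGroup F]
  [InnerProductSpace ℝ F]

theorem inner_toLp_right (u : Lp F 2 μ) {g : α → F} (hg : MemLp g 2 μ) :
    inner ℝ u (hg.toLp g) = ∫ a, inner ℝ (u a) (g a) ∂μ := by
  rw [L2.inner_def]
  refine integral_congr_ae ?_
  filter_upwards [hg.coeFn_toLp] with a ha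
  rw [ha]

theorem inner_toLp_toLp {f g : α → F} (hf : MemLp f 2 μ) (hg : MemLp g 2 μ) :
    inner ℝ (hf.toLp f) (hg.toLp g) = ∫ a, inner ℝ (f a) (g a) ∂μ := by
  rw [inner_toLp_right]
  refine integral_congr_ae ?_
  filter_upwards [hf.coeFn_toLp] with a ha
  rw [ha]

theorem integrable_inner_of_memLp {f g : α → F} (hf : MemLp f 2 μ) (hg : MemLp g 2 μ) :
    Integrable (fun a => inner ℝ (f a) (g a)) μ := by
  refine (L2.integrable_inner (𝕜 := ℝ) (hf.toLp f) (hg.toLp g)).congr ?_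
  filter_upwards [hf.coeFn_toLp, hg.coeFn_toLp] with a h1 h2
  rw [h1, h2]

end L2

/-- Existence for the resolvent equation of a degenerate dissipative operator given in weak form
by its action on a space of test functions. -/
theorem exists_resolvent_of_antisymm {X Y T : Type*} [NormedAddCommGroup X]
    [InnerProductSpace ℝ X] [CompleteSpace X] [NormedAddCommGroup Y] [InnerProductSpace ℝ Y]
    [CompleteSpace Y] [AddCommGroup T] [Module ℝ T] (a b : T →ₗ[ℝ] X) (d : T →ₗ[ℝ] Y)
    (hab : ∀ φ, inner ℝ (a φ) (b φ) = 0) {ε lam : ℝ} (hε : 0 < ε) (hlam : 0 < lam) (g : X) :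
    ∃ (u : X) (k : Y), lam * ‖u‖ ^ 2 + (ε ^ 2)⁻¹ * ‖k‖ ^ 2 ≤ lam⁻¹ * ‖g‖ ^ 2 ∧
      (∀ φ, lam * inner ℝ u (a φ) - ε⁻¹ * inner ℝ u (b φ) + (ε ^ 2)⁻¹ * inner ℝ k (d φ)
        = inner ℝ g (a φ)) ∧
      (u, k) ∈ closure (range fun φ => (a φ, d φ)) := by
  set s := Real.sqrt lam with hs
  have hs0 : 0 < s := Real.sqrt_pos.mpr hlam
  have hss : s * s = lam := Real.mul_self_sqrt hlam.le
  let e := (WithLp.linearEquiv 2 ℝ (X × Y)).symm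
  -- The scalings make `‖ι φ‖²` the energy `lam ‖a φ‖² + ε⁻² ‖d φ‖²`. The transport term in `Λ` does
  -- not contribute to `⟪ι φ, Λ φ⟫` by antisymmetry, so the coercivity demanded by Lions' theorem is
  -- an equality.
  let ι : T →ₗ[ℝ] WithLp 2 (X × Y) := (e : _ →ₗ[ℝ] _) ∘ₗ ((s • a).prod (ε⁻¹ • d))
  let Λ : T →ₗ[ℝ] WithLp 2 (X × Y) :=
    (e : _ →ₗ[ℝ] _) ∘ₗ ((s • a - (ε⁻¹ * s⁻¹) • b).prod (ε⁻¹ • d))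
  have hι1 : ∀ φ, (ι φ).fst = s • a φ := fun φ => rfl
  have hι2 : ∀ φ, (ι φ).snd = ε⁻¹ • d φ := fun φ => rfl
  have hΛ1 : ∀ φ, (Λ φ).fst = s • a φ - (ε⁻¹ * s⁻¹) • b φ := fun φ => rfl
  have hΛ2 : ∀ φ, (Λ φ).snd = ε⁻¹ • d φ := fun φ => rfl
  have hco : ∀ φ, inner ℝ (ι φ) (Λ φ) = ‖ι φ‖ ^ 2 := by
    intro φ
    rw [← real_inner_self_eq_norm_sq, WithLp.prod_inner_apply, WithLp.prod_inner_apply]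
    change inner ℝ (ι φ).fst (Λ φ).fst + inner ℝ (ι φ).snd (Λ φ).snd
      = inner ℝ (ι φ).fst (ι φ).fst + inner ℝ (ι φ).snd (ι φ).snd
    rw [hι1, hι2, hΛ1, hΛ2, inner_sub_right]
    simp only [inner_smul_left, inner_smul_right, hab]
    simp
  obtain ⟨z, hz, hzeq, hzn⟩ := exists_weak_solution_of_coercive ι Λ hco
    (WithLp.toLp 2 (s⁻¹ • g, 0))
  refine ⟨s⁻¹ • z.fst, ε • z.snd, ?_, fun Φ => ?_, ?_⟩
  · have h1 : ‖z‖ ^ 2 ≤ ‖(WithLp.toLp 2 (s⁻¹ • g, (0 : Y)))‖ ^ 2 := by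
      gcongr
    rw [WithLp.prod_norm_sq_eq_of_L2, WithLp.prod_norm_sq_eq_of_L2] at h1
    change ‖z.fst‖ ^ 2 + ‖z.snd‖ ^ 2 ≤ ‖s⁻¹ • g‖ ^ 2 + ‖(0 : Y)‖ ^ 2 at h1
    simp only [norm_zero, norm_smul, norm_inv, Real.norm_of_nonneg hs0.le,
      Real.norm_of_nonneg hε.le, mul_pow] at h1 ⊢
    have h2 : (s⁻¹) ^ 2 = lam⁻¹ := by rw [inv_pow, sq, hss]
    rw [h2] at h1 ⊢
    rw [← mul_assoc, ← mul_assoc, mul_inv_cancel₀ hlam.ne', inv_mul_cancel₀ (by positivity)]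
    linarith
  · have h1 := hzeq Φ
    rw [WithLp.prod_inner_apply, WithLp.prod_inner_apply] at h1
    change inner ℝ z.fst (Λ Φ).fst + inner ℝ z.snd (Λ Φ).snd
      = inner ℝ (s⁻¹ • g) (ι Φ).fst + inner ℝ 0 (ι Φ).snd at h1
    rw [hι1, hΛ1, hΛ2, inner_sub_right, inner_zero_left] at h1
    simp only [inner_smul_left, inner_smul_right, conj_trivial] at h1 ⊢
    rw [← hss]
    field_simp at h1 ⊢
    linarith
  · have hc : Continuous fun z : WithLp 2 (X × Y) => (s⁻¹ • z.fst, ε • z.snd) := by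
      have c1 : Continuous fun z : WithLp 2 (X × Y) => z.fst :=
        continuous_fst.comp (WithLp.prod_continuous_ofLp 2 _ _)
      have c2 : Continuous fun z : WithLp 2 (X × Y) => z.snd :=
        continuous_snd.comp (WithLp.prod_continuous_ofLp 2 _ _)
      exact (c1.const_smul _).prodMk (c2.const_smul _)
    refine map_mem_closure (f := fun z : WithLp 2 (X × Y) => (s⁻¹ • z.fst, ε • z.snd)) hc hz ?_
    rintro _ ⟨φ, rfl⟩
    refine ⟨φ, ?_⟩
    simp only
    rw [hι1, hι2, smul_smul, smul_smul, inv_mul_cancel₀ hs0.ne', mul_inv_cancel₀ hε.ne', one_smul,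
      one_smul]

theorem vGrad_add {Φ Ψ : E n × E n → ℝ} (hΦ : IsTest Φ) (hΨ : IsTest Ψ) (p : E n × E n) :
    vGrad (Φ + Ψ) p = vGrad Φ p + vGrad Ψ p := by
  unfold vGrad
  rw [fderiv_add (hΦ.differentiable p) (hΨ.differentiable p), ← map_add]
  rfl

theorem vGrad_smul {Φ : E n × E n → ℝ} (hΦ : IsTest Φ) (c : ℝ) (p : E n × E n) :
    vGrad (c • Φ) p = c • vGrad Φ p := by
  unfold vGrad
  rw [fderiv_const_smul (hΦ.differentiable p), ContinuousLinearMap.smul_comp, map_smul]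

/-- The space of test functions. -/
def testSpace (n : ℕ) : Submodule ℝ (E n × E n → ℝ) where
  carrier := {Φ | IsTest Φ}
  add_mem' := fun h₁ h₂ => h₁.add h₂
  zero_mem' := IsTest.of_bounds (r := 0) (C := 0) contDiff_const (fun _ _ => rfl) (by simp) (by simp)
  smul_mem' := fun c _ h => h.const_smul c

namespace Admissible

variable {V : E n → ℝ} {gradV : E n → E n} {G : E n → Matrix (Fin n) (Fin n) ℝ}
  {Φ : E n × E n → ℝ}

theorem memLp_test (h : Admissible V gradV G) (hΦ : IsTest Φ) : MemLp Φ 2 (eqMeasure V) := by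
  obtain ⟨N, hN⟩ := hΦ.bound
  refine h.memLp_two_of_le_envelope (b := fun _ => 1) hΦ.contDiff.continuous.aestronglyMeasurable
    (locallyIntegrable_const _) N fun p => ?_
  rw [one_mul]
  exact (hN p).1

theorem memLp_fderiv_apply (h : Admissible V gradV G) (hΦ : IsTest Φ) {y : E n × E n → E n × E n}
    (hy : AEStronglyMeasurable y volume) {b : E n → ℝ}
    (hb : LocallyIntegrable (fun x => b x ^ 2) volume)
    (hle : ∀ p, ‖y p‖ ≤ b p.1 * (1 + ‖p.2‖)) (hb0 : ∀ x, 0 ≤ b x) :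
    MemLp (fun p => fderiv ℝ Φ p (y p)) 2 (eqMeasure V) := by
  obtain ⟨N, hN⟩ := hΦ.bound
  refine h.memLp_two_of_le_envelope (b := b)
    (isBoundedBilinearMap_apply.continuous.comp_aestronglyMeasurable
      (hΦ.continuous_fderiv.aestronglyMeasurable.prodMk hy)) hb (N + 1) fun p => ?_
  refine ((fderiv ℝ Φ p).le_opNorm _).trans ?_
  calc _ ≤ envelope N p * (b p.1 * (1 + ‖p.2‖)) := by
        gcongr
        · exact envelope_nonneg _ _
        · exact (hN p).2
        · exact hle p
    _ = b p.1 * ((1 + ‖p.2‖) * envelope N p) := by ring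
    _ ≤ _ := mul_le_mul_of_nonneg_left (one_add_norm_mul_envelope_le N p) (hb0 _)

theorem memLp_transport (h : Admissible V gradV G) (hΦ : IsTest Φ) :
    MemLp (fun p => fderiv ℝ Φ p (p.2, -gradV p.1)) 2 (eqMeasure V) := by
  refine h.memLp_fderiv_apply hΦ
    (continuous_snd.aestronglyMeasurable.prodMk h.aestronglyMeasurable_gradV_fst.neg)
    h.locallyIntegrable_one_add_gradV_sq (fun p => ?_) fun x => by positivity
  rw [Prod.norm_def, norm_neg]
  have h1 : 0 ≤ ‖gradV p.1‖ * ‖p.2‖ := by positivity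
  refine max_le ?_ ?_ <;> nlinarith [norm_nonneg (gradV p.1), norm_nonneg p.2]

theorem memLp_fderiv_snd (h : Admissible V gradV G) (hΦ : IsTest Φ) (w : E n) :
    MemLp (fun p => fderiv ℝ Φ p (0, w)) 2 (eqMeasure V) := by
  refine h.memLp_fderiv_apply hΦ (b := fun _ => ‖w‖) aestronglyMeasurable_const
    (locallyIntegrable_const _) (fun p => ?_) fun x => norm_nonneg _
  have : ‖((0 : E n), w)‖ = ‖w‖ := by simp [Prod.norm_def]
  rw [this]
  exact le_mul_of_one_le_right (norm_nonneg _) (by simp)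

theorem memLp_gaussAdj (h : Admissible V gradV G) (hΦ : IsTest Φ) (w : E n) :
    MemLp (fun p => inner ℝ w p.2 * Φ p - fderiv ℝ Φ p (0, w)) 2 (eqMeasure V) :=
  (h.memLp_test (hΦ.inner_snd_mul w)).sub (h.memLp_fderiv_snd hΦ w)

theorem memLp_clm_apply (h : Admissible V gradV G) {B : E n → E n →L[ℝ] E n}
    (hB : AEStronglyMeasurable B volume) (hBl : LocallyIntegrable (fun x => ‖B x‖ ^ 2) volume)
    {y : E n × E n → E n} (hy : Continuous y) (N : ℕ) (hN : ∀ p, ‖y p‖ ≤ envelope N p) :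
    MemLp (fun p => B p.1 (y p)) 2 (eqMeasure V) := by
  refine h.memLp_two_of_le_envelope (b := fun x => ‖B x‖)
    (isBoundedBilinearMap_apply.continuous.comp_aestronglyMeasurable
      ((hB.comp_quasiMeasurePreserving Measure.quasiMeasurePreserving_fst).prodMk
        hy.aestronglyMeasurable)) hBl N fun p => ?_
  refine ((B p.1).le_opNorm _).trans ?_
  gcongr
  exact hN p

theorem memLp_clm_vGrad (h : Admissible V gradV G) {B : E n → E n →L[ℝ] E n}
    (hB : AEStronglyMeasurable B volume) (hBl : LocallyIntegrable (fun x => ‖B x‖ ^ 2) volume)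
    (hΦ : IsTest Φ) : MemLp (fun p => B p.1 (vGrad Φ p)) 2 (eqMeasure V) := by
  obtain ⟨N, hN⟩ := hΦ.bound
  exact h.memLp_clm_apply hB hBl hΦ.continuous_vGrad N fun p =>
    (norm_vGrad_le Φ p).trans (hN p).2

theorem memLp_clm_const (h : Admissible V gradV G) {B : E n → E n →L[ℝ] E n}
    (hB : AEStronglyMeasurable B volume) (hBl : LocallyIntegrable (fun x => ‖B x‖ ^ 2) volume)
    (hΦ : IsTest Φ) (w : E n) : MemLp (fun p => B p.1 (Φ p • w)) 2 (eqMeasure V) := by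
  obtain ⟨N, hN⟩ := hΦ.bound
  obtain ⟨M, hM⟩ := exists_nat_ge ‖w‖
  refine h.memLp_clm_apply hB hBl (hΦ.contDiff.continuous.smul continuous_const) (N + M) fun p => ?_
  refine le_trans ?_ (natCast_mul_envelope_le N M p)
  rw [norm_smul, mul_comm]
  gcongr
  exact (hN p).1

/-- Test functions as elements of `L²(μ)`. -/
def testToLp (h : Admissible V gradV G) : testSpace n →ₗ[ℝ] L2eq V where
  toFun Φ := (h.memLp_test Φ.2).toLp _
  map_add' Φ Ψ := MemLp.toLp_add (h.memLp_test Φ.2) (h.memLp_test Ψ.2)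
  map_smul' c Φ := MemLp.toLp_const_smul c (h.memLp_test Φ.2)

/-- The transport operator `v·∇ₓ - ∇V·∇ᵥ` on test functions. -/
def transportToLp (h : Admissible V gradV G) : testSpace n →ₗ[ℝ] L2eq V where
  toFun Φ := (h.memLp_transport Φ.2).toLp _
  map_add' Φ Ψ := by
    rw [← MemLp.toLp_add]
    refine MemLp.toLp_congr _ _ (Eventually.of_forall fun p => ?_)
    change fderiv ℝ ((Φ : E n × E n → ℝ) + (Ψ : E n × E n → ℝ)) p _ = _
    rw [fderiv_add (Φ.2.differentiable p) (Ψ.2.differentiable p)]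
    rfl
  map_smul' c Φ := by
    rw [RingHom.id_apply, ← MemLp.toLp_const_smul]
    refine MemLp.toLp_congr _ _ (Eventually.of_forall fun p => ?_)
    change fderiv ℝ (c • (Φ : E n × E n → ℝ)) p _ = _
    rw [fderiv_const_smul (Φ.2.differentiable p)]
    rfl

/-- The operator `R ∇ᵥ` on test functions. -/
def dissipationToLp (h : Admissible V gradV G) {R Q : E n → E n →L[ℝ] E n}
    (hR : IsSqrtField G R Q) : testSpace n →ₗ[ℝ] Lp (E n) 2 (eqMeasure V) where
  toFun Φ := (h.memLp_clm_vGrad hR.measR hR.locR Φ.2).toLp _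
  map_add' Φ Ψ := by
    rw [← MemLp.toLp_add]
    refine MemLp.toLp_congr _ _ (Eventually.of_forall fun p => ?_)
    change R p.1 (vGrad ((Φ : E n × E n → ℝ) + (Ψ : E n × E n → ℝ)) p) = _
    rw [vGrad_add Φ.2 Ψ.2, map_add]
    rfl
  map_smul' c Φ := by
    rw [RingHom.id_apply, ← MemLp.toLp_const_smul]
    refine MemLp.toLp_congr _ _ (Eventually.of_forall fun p => ?_)
    change R p.1 (vGrad (c • (Φ : E n × E n → ℝ)) p) = _
    rw [vGrad_smul Φ.2, map_smul]
    rfl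

/-- Antisymmetry of transport is its stationarity applied to `Φ²`, which again belongs to the test
class. -/
theorem inner_test_transport (h : Admissible V gradV G) (Φ : testSpace n) :
    inner ℝ (h.testToLp Φ) (h.transportToLp Φ) = 0 := by
  change inner ℝ ((h.memLp_test Φ.2).toLp _) ((h.memLp_transport Φ.2).toLp _) = 0
  rw [inner_toLp_toLp]
  have h1 := h.integral_transport (Φ.2.mul Φ.2)
  have e : ∀ p : E n × E n, fderiv ℝ ((Φ : E n × E n → ℝ) * (Φ : E n × E n → ℝ)) p (p.2, -gradV p.1)
      = 2 * inner ℝ ((Φ : E n × E n → ℝ) p) (fderiv ℝ (Φ : E n × E n → ℝ) p (p.2, -gradV p.1)) := by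
    intro p
    rw [fderiv_mul (Φ.2.differentiable p) (Φ.2.differentiable p)]
    simp
    ring
  simp_rw [e] at h1
  rw [integral_const_mul] at h1
  linarith

/-- `(h, k)` satisfies `k = R ∇ᵥ h` in the weak sense. -/
def HasDissipation (h : Admissible V gradV G) {R Q : E n → E n →L[ℝ] E n}
    (hR : IsSqrtField G R Q) (u : L2eq V) (k : Lp (E n) 2 (eqMeasure V)) : Prop :=
  ∀ (Φ : E n × E n → ℝ) (hΦ : IsTest Φ) (w : E n),
    inner ℝ u ((h.memLp_gaussAdj hΦ w).toLp _)
      = inner ℝ k ((h.memLp_clm_const hR.measQ hR.locQ hΦ w).toLp _)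

/-- Gaussian integration by parts for the product `ΨΦ`, in which `Q` and `R` cancel. The weak form
involves only inner products with fixed vectors, so it is closed and passes from test functions to
their limits. -/
theorem hasDissipation_test (h : Admissible V gradV G) {R Q : E n → E n →L[ℝ] E n}
    (hR : IsSqrtField G R Q) (Ψ : testSpace n) :
    h.HasDissipation hR (h.testToLp Ψ) (h.dissipationToLp hR Ψ) := by
  intro Φ hΦ w
  change inner ℝ ((h.memLp_test Ψ.2).toLp _) _
    = inner ℝ ((h.memLp_clm_vGrad hR.measR hR.locR Ψ.2).toLp _) _
  rw [inner_toLp_toLp, inner_toLp_toLp]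
  have h1 := h.integral_fderiv_snd (Ψ.2.mul hΦ) w
  have e1 : ∀ p, fderiv ℝ ((Ψ : E n × E n → ℝ) * Φ) p (0, w)
      = (Ψ : E n × E n → ℝ) p * fderiv ℝ Φ p (0, w)
        + Φ p * fderiv ℝ (Ψ : E n × E n → ℝ) p (0, w) := fun p => by
    rw [fderiv_mul (Ψ.2.differentiable p) (hΦ.differentiable p)]; simp
  have i1 : Integrable (fun p => (Ψ : E n × E n → ℝ) p * fderiv ℝ Φ p (0, w)) (eqMeasure V) :=
    (h.memLp_test Ψ.2).integrable_mul (h.memLp_fderiv_snd hΦ w)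
  have i2 : Integrable (fun p => Φ p * fderiv ℝ (Ψ : E n × E n → ℝ) p (0, w)) (eqMeasure V) :=
    (h.memLp_test hΦ).integrable_mul (h.memLp_fderiv_snd Ψ.2 w)
  have i3 : Integrable (fun p : E n × E n => inner ℝ p.2 w * ((Ψ : E n × E n → ℝ) * Φ) p)
      (eqMeasure V) := by
    refine ((h.memLp_test Ψ.2).integrable_mul (h.memLp_test (hΦ.inner_snd_mul w))).congr
      (Eventually.of_forall fun p => ?_)
    simp only [Pi.mul_apply]
    rw [real_inner_comm]; ring
  simp_rw [e1] at h1
  rw [integral_add i1 i2] at h1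
  have e2 : ∀ᵐ p ∂(eqMeasure V), inner ℝ (R p.1 (vGrad (Ψ : E n × E n → ℝ) p)) (Q p.1 (Φ p • w))
      = Φ p * fderiv ℝ (Ψ : E n × E n → ℝ) p (0, w) := by
    refine h.eqMeasure_ac.ae_le ?_
    filter_upwards [Measure.quasiMeasurePreserving_fst.ae hR.symmQ,
      Measure.quasiMeasurePreserving_fst.ae hR.QR] with p h1 h2
    rw [← h1, h2, inner_smul_right, inner_vGrad]
  rw [integral_congr_ae e2]
  have e3 : ∀ p : E n × E n, inner ℝ ((Ψ : E n × E n → ℝ) p)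
      (inner ℝ w p.2 * Φ p - fderiv ℝ Φ p (0, w))
      = inner ℝ p.2 w * ((Ψ : E n × E n → ℝ) * Φ) p - (Ψ : E n × E n → ℝ) p * fderiv ℝ Φ p (0, w) := by
    intro p
    simp only [Pi.mul_apply, real_inner_comm]
    rw [RCLike.inner_apply, conj_trivial]
    ring
  simp_rw [e3]
  rw [integral_sub i3 i1]
  linarith

/-- Existence for the resolvent equation `(lam + L_ε) u = g`, with the energy bound. -/
theorem exists_resolvent (h : Admissible V gradV G) {R Q : E n → E n →L[ℝ] E n}
    (hR : IsSqrtField G R Q) {ε lam : ℝ} (hε : 0 < ε) (hlam : 0 < lam) (g : L2eq V) :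
    ∃ (u : L2eq V) (k : Lp (E n) 2 (eqMeasure V)),
      lam * ‖u‖ ^ 2 + (ε ^ 2)⁻¹ * ‖k‖ ^ 2 ≤ lam⁻¹ * ‖g‖ ^ 2 ∧
      (∀ Φ : testSpace n, lam * inner ℝ u (h.testToLp Φ) - ε⁻¹ * inner ℝ u (h.transportToLp Φ)
        + (ε ^ 2)⁻¹ * inner ℝ k (h.dissipationToLp hR Φ) = inner ℝ g (h.testToLp Φ)) ∧
      h.HasDissipation hR u k := by
  obtain ⟨u, k, hen, hform, hmem⟩ := exists_resolvent_of_antisymm h.testToLp h.transportToLp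
    (h.dissipationToLp hR) h.inner_test_transport hε hlam g
  refine ⟨u, k, hen, hform, fun Φ hΦ w => ?_⟩
  have hcl : IsClosed {z : L2eq V × Lp (E n) 2 (eqMeasure V) |
      inner ℝ z.1 ((h.memLp_gaussAdj hΦ w).toLp _)
        = inner ℝ z.2 ((h.memLp_clm_const hR.measQ hR.locQ hΦ w).toLp _)} :=
    isClosed_eq (continuous_fst.inner continuous_const) (continuous_snd.inner continuous_const)
  refine hcl.closure_subset_iff.mpr ?_ hmem
  rintro _ ⟨Ψ, rfl⟩
  exact h.hasDissipation_test hR Ψ Φ hΦ w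

end Admissible

end KineticFP

/-! ### The domain of `L_ε`, its energy inequality and dissipativity -/

namespace KineticFP

variable {n : ℕ}

theorem matVec_smul (A : Matrix (Fin n) (Fin n) ℝ) (c : ℝ) (w : E n) :
    matVec A (c • w) = c • matVec A w := by
  simp [matVec]

namespace Admissible

variable {V : E n → ℝ} {gradV : E n → E n} {G : E n → Matrix (Fin n) (Fin n) ℝ}

theorem integrable_coe (h : Admissible V gradV G) {F : Type*} [NormedAddCommGroup F]
    (u : Lp F 2 (eqMeasure V)) : Integrable u (eqMeasure V) := by
  have := h.isFiniteMeasure_eqMeasure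
  exact (Lp.memLp u).integrable one_le_two

/-- On a compact set an envelope is at least one, so Cauchy–Schwarz in `L²(μ)` applies to `‖B‖`
times the envelope and `k`. -/
theorem locallyIntegrable_equilibrium_smul_clm (h : Admissible V gradV G)
    {B : E n → E n →L[ℝ] E n} (hB : AEStronglyMeasurable B volume)
    (hBl : LocallyIntegrable (fun x => ‖B x‖ ^ 2) volume) (k : Lp (E n) 2 (eqMeasure V)) :
    LocallyIntegrable (fun p => equilibrium V p • B p.1 (k p)) volume := by
  have hkm : AEStronglyMeasurable (fun p => B p.1 (k p)) volume :=
    isBoundedBilinearMap_apply.continuous.comp_aestronglyMeasurable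
      ((hB.comp_quasiMeasurePreserving Measure.quasiMeasurePreserving_fst).prodMk
        ((Lp.memLp k).1.mono_ac h.ac_eqMeasure))
  have hm : AEStronglyMeasurable (fun p => equilibrium V p • B p.1 (k p)) volume :=
    h.aemeasurable_equilibrium.aestronglyMeasurable.smul hkm
  rw [locallyIntegrable_iff]
  intro K hK
  obtain ⟨r, hr⟩ := hK.isBounded.subset_closedBall (0 : E n × E n)
  obtain ⟨N, hN⟩ := exists_nat_ge r
  have hBN : MemLp (fun p : E n × E n => ‖B p.1‖ * envelope N p) 2 (eqMeasure V) := by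
    refine h.memLp_two_of_le_envelope (b := fun x => ‖B x‖)
      ((hB.comp_quasiMeasurePreserving Measure.quasiMeasurePreserving_fst).norm.mul
        (measurable_envelope N).aestronglyMeasurable) hBl N fun p => ?_
    rw [Real.norm_of_nonneg (mul_nonneg (norm_nonneg _) (envelope_nonneg _ _))]
  have h1 : Integrable (fun p => (‖B p.1‖ * envelope N p) * ‖k p‖) (eqMeasure V) :=
    hBN.integrable_mul (Lp.memLp k).norm
  rw [h.integrable_eqMeasure_iff] at h1
  refine Integrable.mono' h1.integrableOn hm.restrict ?_
  refine (ae_restrict_iff' hK.measurableSet).mpr (Eventually.of_forall fun p hp => ?_)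
  have hp1 := hr hp
  rw [mem_closedBall_zero_iff] at hp1
  have henv : 1 ≤ envelope N p := by
    unfold envelope
    rw [indicator_of_mem (by simpa using (norm_fst_le p).trans (hp1.trans hN)), one_mul]
    exact Real.one_le_exp (by positivity)
  rw [norm_smul, Real.norm_of_nonneg (h.equilibrium_pos p).le, smul_eq_mul]
  refine mul_le_mul_of_nonneg_left ?_ (h.equilibrium_pos p).le
  calc ‖B p.1 (k p)‖ ≤ ‖B p.1‖ * ‖k p‖ := (B p.1).le_opNorm _
    _ ≤ (‖B p.1‖ * envelope N p) * ‖k p‖ := by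
        gcongr
        exact le_mul_of_one_le_right (norm_nonneg _) henv

/-- A pair `(u, g)` satisfying the weak form of `L_ε u = g`, with finite dissipation, lies in the
graph of `L_ε`. -/
theorem isKFPOperator_of_weak_form (h : Admissible V gradV G) {R Q : E n → E n →L[ℝ] E n}
    (hR : IsSqrtField G R Q) {ε : ℝ} {u g : L2eq V} {k : Lp (E n) 2 (eqMeasure V)}
    (hform : ∀ Φ : testSpace n, -(ε⁻¹ * inner ℝ u (h.transportToLp Φ))
        + (ε ^ 2)⁻¹ * inner ℝ k (h.dissipationToLp hR Φ) = inner ℝ g (h.testToLp Φ))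
    (hk : h.HasDissipation hR u k) : IsKFPOperator ε V gradV G u g := by
  set f : E n × E n → ℝ := fun p => equilibrium V p * u p with hf
  -- From `∇ᵥf + v f = M_eq ∇ᵥh` and `k = R∇ᵥh` one reads off `∇ᵥf = M_eq Q k - v f`.
  set Df : E n × E n → E n := fun p => equilibrium V p • Q p.1 (k p) - f p • p.2 with hDf
  have hsum : ∀ p, Df p + f p • p.2 = equilibrium V p • Q p.1 (k p) := fun p => by
    rw [hDf]; simp
  have hfi : Integrable f volume := h.integrable_eqMeasure_iff.mp (h.integrable_coe u)
  have hQl := h.locallyIntegrable_equilibrium_smul_clm hR.measQ hR.locQ k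
  have hfv : LocallyIntegrable (fun p => f p • p.2) volume :=
    hfi.locallyIntegrable.smul_continuous continuous_snd
  refine ⟨f, Df, fun p => rfl, ⟨hfi.locallyIntegrable, hQl.sub hfv, fun φ hφ hφc w => ?_⟩, ?_,
    fun φ hφ hφc => ?_⟩
  · have hφt : IsTest φ := IsTest.of_hasCompactSupport (hφ.of_le (by simp)) hφc
    have h1 := hk φ hφt w
    rw [inner_toLp_right, inner_toLp_right] at h1
    have i1 : Integrable (fun p => u p * (inner ℝ w p.2 * φ p)) (eqMeasure V) :=
      (Lp.memLp u).integrable_mul (h.memLp_test (hφt.inner_snd_mul w))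
    have i2 : Integrable (fun p => u p * fderiv ℝ φ p (0, w)) (eqMeasure V) :=
      (Lp.memLp u).integrable_mul (h.memLp_fderiv_snd hφt w)
    have i3 : Integrable (fun p => inner ℝ (k p) (Q p.1 (φ p • w))) (eqMeasure V) :=
      integrable_inner_of_memLp (Lp.memLp k) (h.memLp_clm_const hR.measQ hR.locQ hφt w)
    have e1 : ∫ p, inner ℝ (u p) (inner ℝ w p.2 * φ p - fderiv ℝ φ p (0, w)) ∂(eqMeasure V)
        = ∫ p, u p * (inner ℝ w p.2 * φ p) ∂(eqMeasure V)
          - ∫ p, u p * fderiv ℝ φ p (0, w) ∂(eqMeasure V) := by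
      rw [← integral_sub i1 i2]
      congr 1 with p
      simp
      ring
    rw [e1] at h1
    have e2 : ∫ p, f p * fderiv ℝ φ p (0, w) = ∫ p, u p * fderiv ℝ φ p (0, w) ∂(eqMeasure V) := by
      rw [h.integral_eqMeasure]
      congr 1 with p
      simp [hf, mul_assoc]
    have e3 : ∫ p, inner ℝ (Df p) w * φ p
        = ∫ p, (inner ℝ (k p) (Q p.1 (φ p • w)) - u p * (inner ℝ w p.2 * φ p)) ∂(eqMeasure V) := by
      rw [h.integral_eqMeasure]
      refine integral_congr_ae ?_
      filter_upwards [Measure.quasiMeasurePreserving_fst.ae hR.symmQ] with p hp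
      rw [← hp]
      simp only [hDf, hf, inner_sub_left, inner_smul_left, inner_smul_right, conj_trivial,
        smul_eq_mul, real_inner_comm]
      ring
    rw [e2, e3, integral_sub i3 i1]
    linarith
  · have i1 : Integrable (fun p => ‖k p‖ ^ 2) (eqMeasure V) :=
      (memLp_two_iff_integrable_sq_norm (Lp.memLp k).1).mp (Lp.memLp k)
    rw [h.integrable_eqMeasure_iff] at i1
    refine i1.congr ?_
    filter_upwards [Measure.quasiMeasurePreserving_fst.ae hR.symmQ,
      Measure.quasiMeasurePreserving_fst.ae hR.RQ, Measure.quasiMeasurePreserving_fst.ae hR.QR,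
      Measure.quasiMeasurePreserving_fst.ae hR.RR] with p h1 h2 h3 h4
    rw [hsum, matVec_smul, ← h4, h2, inner_smul_left, inner_smul_right, h1, h3,
      real_inner_self_eq_norm_sq]
    have := (h.equilibrium_pos p).ne'
    simp only [smul_eq_mul, conj_trivial]
    field_simp
  · have hφt : IsTest φ := IsTest.of_hasCompactSupport hφ hφc
    have h1 := hform ⟨φ, hφt⟩
    have e1 : inner ℝ u (h.transportToLp ⟨φ, hφt⟩)
        = ∫ p, fderiv ℝ φ p (p.2, -gradV p.1) * f p := by
      change inner ℝ u ((h.memLp_transport hφt).toLp _) = _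
      rw [inner_toLp_right, h.integral_eqMeasure]
      congr 1 with p
      simp only [hf, smul_eq_mul, RCLike.inner_apply, conj_trivial]
      ring
    have e2 : inner ℝ k (h.dissipationToLp hR ⟨φ, hφt⟩)
        = ∫ p, fderiv ℝ φ p (0, matVec (G p.1) (Df p + f p • p.2)) := by
      change inner ℝ k ((h.memLp_clm_vGrad hR.measR hR.locR hφt).toLp _) = _
      rw [inner_toLp_right, h.integral_eqMeasure]
      refine integral_congr_ae ?_
      filter_upwards [Measure.quasiMeasurePreserving_fst.ae hR.symmR,
        Measure.quasiMeasurePreserving_fst.ae hR.RQ,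
        Measure.quasiMeasurePreserving_fst.ae hR.RR] with p h1 h2 h4
      rw [hsum, matVec_smul, ← h4, h2, ← inner_vGrad, inner_smul_right, real_inner_comm, h1,
        smul_eq_mul]
    have e3 : inner ℝ g (h.testToLp ⟨φ, hφt⟩) = ∫ p, (equilibrium V p * g p) * φ p := by
      change inner ℝ g ((h.memLp_test hφt).toLp _) = _
      rw [inner_toLp_right, h.integral_eqMeasure]
      congr 1 with p
      simp only [smul_eq_mul, RCLike.inner_apply, conj_trivial]
      ring
    rw [e1, e2, e3] at h1
    rw [← h1, kfpPairing]
    ring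

variable {S : ℝ → L2eq V →L[ℝ] L2eq V} {ε : ℝ}

/-- Elements of the graph of a generator `-L_ε` satisfy the weak form of `L_ε u = g` and an
energy inequality. -/
theorem exists_dissipation (h : Admissible V gradV G) {R Q : E n → E n →L[ℝ] E n}
    (hR : IsSqrtField G R Q) (hε : 0 < ε) (hS : IsC0Semigroup S)
    (hA : IsGenerator S fun u g => IsKFPOperator ε V gradV G u (-g)) {u g : L2eq V}
    (hu : IsKFPOperator ε V gradV G u g) {δ : ℝ} (hδ : 0 < δ) :
    ∃ k : Lp (E n) 2 (eqMeasure V), ‖k‖ ^ 2 ≤ ε ^ 2 * (2 * inner ℝ u g + δ) ∧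
      (∀ Φ : testSpace n, -(ε⁻¹ * inner ℝ u (h.transportToLp Φ))
        + (ε ^ 2)⁻¹ * inner ℝ k (h.dissipationToLp hR Φ) = inner ℝ g (h.testToLp Φ)) ∧
      h.HasDissipation hR u k := by
  obtain ⟨ω, hω, hker⟩ := hS.eq_zero_of_eigenvector hA
  -- Beyond the growth rate `ω` the resolvent solution is unique, and the last summand makes `‖g‖² /
  -- lam ≤ δ`.
  set lam := ω + 1 + ‖g‖ ^ 2 / δ with hlam
  have hlam0 : 0 < lam := by positivity
  obtain ⟨u', k, hen, hform, hk⟩ := h.exists_resolvent hR hε hlam0 (lam • u + g)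
  have hform' : ∀ Φ : testSpace n, -(ε⁻¹ * inner ℝ u' (h.transportToLp Φ))
      + (ε ^ 2)⁻¹ * inner ℝ k (h.dissipationToLp hR Φ)
        = inner ℝ (lam • u + g - lam • u') (h.testToLp Φ) := by
    intro Φ
    rw [inner_sub_left, ← hform Φ, inner_smul_left]
    simp
    ring
  have hu' := h.isKFPOperator_of_weak_form hR hform' hk
  have huu : u' = u := by
    rw [← sub_eq_zero]
    have hgt : ω < lam := by
      have : 0 ≤ ‖g‖ ^ 2 / δ := by positivity
      linarith
    refine hker lam _ hgt ((hA _ _).mpr ?_)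
    -- The graph relation hides a choice of weak gradient; its linearity is obtained by subtracting
    -- the limits that define the generator.
    have t1 := (hA u' (-(lam • u + g - lam • u'))).mp (by simpa using hu')
    have t2 := (hA u (-g)).mp (by simpa using hu)
    have e : lam • (u' - u) = -(lam • u + g - lam • u') - -g := by module
    rw [e]
    refine (t1.sub t2).congr fun t => ?_
    rw [map_sub]
    module
  subst huu
  refine ⟨k, ?_, fun Φ => ?_, hk⟩
  · have e : lam⁻¹ * ‖lam • u' + g‖ ^ 2
        = lam * ‖u'‖ ^ 2 + 2 * inner ℝ u' g + lam⁻¹ * ‖g‖ ^ 2 := by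
      rw [norm_add_sq_real, norm_smul, inner_smul_left, Real.norm_of_nonneg hlam0.le]
      simp
      field_simp
    rw [e] at hen
    have h1 : lam⁻¹ * ‖g‖ ^ 2 ≤ δ := by
      rw [inv_mul_le_iff₀ hlam0, hlam, add_mul, div_mul_cancel₀ _ hδ.ne']
      have : 0 ≤ (ω + 1) * δ := by positivity
      linarith
    have h2 : (ε ^ 2)⁻¹ * ‖k‖ ^ 2 ≤ 2 * inner ℝ u' g + δ := by linarith
    rwa [inv_mul_le_iff₀ (by positivity)] at h2
  · have := hform' Φ
    rwa [add_sub_cancel_left] at this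

/-- The squared dissipation norm is nonnegative, so its upper bound `ε²(2⟪u, L_ε u⟫ + δ)` is too;
then `δ → 0`. -/
theorem generator_dissipative (h : Admissible V gradV G) (hε : 0 < ε) (hS : IsC0Semigroup S)
    (hA : IsGenerator S fun u g => IsKFPOperator ε V gradV G u (-g)) (u g : L2eq V)
    (hu : IsKFPOperator ε V gradV G u (-g)) : inner ℝ u g ≤ 0 := by
  obtain ⟨R, Q, hR⟩ := exists_isSqrtField G h.posDef h.locG h.locGinv
  refine le_of_forall_pos_le_add fun δ hδ => ?_
  obtain ⟨k, hk, -⟩ := h.exists_dissipation hR hε hS hA hu hδ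
  have h1 : 0 ≤ ε ^ 2 * (2 * inner ℝ u (-g) + δ) := (sq_nonneg _).trans hk
  have h2 : 0 ≤ 2 * inner ℝ u (-g) + δ := nonneg_of_mul_nonneg_right h1 (by positivity)
  rw [inner_neg_right] at h2
  linarith

end Admissible

end KineticFP

/-! ### Energy bounds and moment identities on a time mesh -/

namespace KineticFP

namespace IsC0Semigroup

variable {X M : Type*} [NormedAddCommGroup X] [InnerProductSpace ℝ X] [CompleteSpace X]
  [NormedAddCommGroup M] [InnerProductSpace ℝ M] {S : ℝ → X →L[ℝ] X} {A : X → X → Prop}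

/-- The moment identities summed over the first `j` cells of a mesh. -/
theorem sum_mesh_identities (hS : IsC0Semigroup S) (hA : IsGenerator S A)
    (hdiss : ∀ x y, A x y → inner ℝ x y ≤ 0) {ε τ : ℝ} (hε : 0 < ε) (hτ : 0 < τ) (x : X)
    (K : ℕ → M) (j : ℕ) (a c d : X) (b e f : M)
    (h1 : ∀ i : ℕ, inner ℝ (S ((i + 1) * τ) x - S (i * τ) x) a = ε⁻¹ * inner ℝ (K i) b)
    (h2 : ∀ i : ℕ, inner ℝ (∫ s in (i * τ)..((i + 1) * τ), S (max s 0) x) d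
      + inner ℝ (K i) e - ε⁻¹ * inner ℝ (K i) f
        = ε * inner ℝ (S ((i + 1) * τ) x - S (i * τ) x) c) :
    inner ℝ (S (j * τ) x - x) a = ε⁻¹ * inner ℝ (∑ i ∈ Finset.range j, K i) b ∧
    |(∫ s in (0 : ℝ)..(j * τ), inner ℝ (S (max s 0) x) d)
        - ε⁻¹ * inner ℝ (∑ i ∈ Finset.range j, K i) f|
      ≤ ε * (2 * ‖x‖ * ‖c‖)
        + ((∑ i ∈ Finset.range j, ‖K i‖ ^ 2) / (ε * τ) + j * (ε * τ)) / 2 * ‖e‖ := by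
  have htel : ∑ i ∈ Finset.range j, (S ((i + 1) * τ) x - S (i * τ) x) = S (j * τ) x - x := by
    have := Finset.sum_range_sub (fun i : ℕ => S (i * τ) x) j
    simpa [hS.zero_apply] using this
  have hint : ∫ s in (0 : ℝ)..(j * τ), S (max s 0) x
      = ∑ i ∈ Finset.range j, ∫ s in (i * τ)..((i + 1) * τ), S (max s 0) x := by
    have := intervalIntegral.sum_integral_adjacent_intervals (n := j) (a := fun i : ℕ => (i : ℝ) * τ)
      (f := fun s => S (max s 0) x) (μ := volume)
      fun k _ => (hS.continuous_orbit x).intervalIntegrable _ _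
    simpa using this.symm
  have hinn : ∫ s in (0 : ℝ)..(j * τ), inner ℝ (S (max s 0) x) d
      = inner ℝ (∫ s in (0 : ℝ)..(j * τ), S (max s 0) x) d := by
    rw [real_inner_comm]
    have := (innerSL ℝ d).intervalIntegral_comp_comm
      ((hS.continuous_orbit x).intervalIntegrable (μ := volume) 0 (j * τ))
    simp only [innerSL_apply_apply] at this
    rw [← this]
    simp only [real_inner_comm]
  constructor
  · rw [← htel, sum_inner, sum_inner, Finset.mul_sum]
    exact Finset.sum_congr rfl fun i _ => h1 i
  · have hkey : (∫ s in (0 : ℝ)..(j * τ), inner ℝ (S (max s 0) x) d)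
        - ε⁻¹ * inner ℝ (∑ i ∈ Finset.range j, K i) f
        = ε * inner ℝ (S (j * τ) x - x) c - ∑ i ∈ Finset.range j, inner ℝ (K i) e := by
      rw [hinn, hint, ← htel, sum_inner, sum_inner, sum_inner, Finset.mul_sum, Finset.mul_sum,
        ← Finset.sum_sub_distrib, ← Finset.sum_sub_distrib]
      exact Finset.sum_congr rfl fun i _ => by linarith [h2 i]
    rw [hkey]
    refine (abs_sub _ _).trans (add_le_add ?_ ?_)
    · rw [abs_mul, abs_of_pos hε]
      refine mul_le_mul_of_nonneg_left ((abs_real_inner_le_norm _ _).trans ?_) hε.le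
      gcongr
      refine (norm_sub_le _ _).trans ?_
      have := hS.norm_apply_le hA hdiss (t := j * τ) (by positivity) x
      linarith
    · refine (Finset.abs_sum_le_sum_abs _ _).trans ?_
      -- Young's inequality with weight `ε τ`. In the application `∑ ‖K i‖²` is of order `ε² τ` and
      -- the mesh has `T/τ` cells, so both halves sum to order `ε`.
      have : ∀ i ∈ Finset.range j, |inner ℝ (K i) e|
          ≤ (‖K i‖ ^ 2 / (ε * τ) + ε * τ) / 2 * ‖e‖ := by
        intro i _
        refine (abs_real_inner_le_norm _ _).trans ?_
        gcongr
        have h3 : 0 < ε * τ := by positivity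
        rw [le_div_iff₀ two_pos, div_add' _ _ _ h3.ne', le_div_iff₀ h3]
        nlinarith [sq_nonneg (‖K i‖ - ε * τ)]
      refine (Finset.sum_le_sum this).trans (le_of_eq ?_)
      rw [← Finset.sum_mul, ← Finset.sum_div, Finset.sum_add_distrib, ← Finset.sum_div]
      simp

/-- The dissipation integrated over the cells of a fine mesh, for an orbit of a dissipative
semigroup: energy bound and approximate moment identities. -/
theorem exists_mesh_flux (hS : IsC0Semigroup S) (hA : IsGenerator S A)
    (hdiss : ∀ x y, A x y → inner ℝ x y ≤ 0) {ε : ℝ} (hε : 0 < ε) {ι : Type*}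
    (a c d : ι → X) (b e f : ι → M)
    (hD : ∀ u g, A u (-g) → ∀ δ > 0, ∃ k : M, ‖k‖ ^ 2 ≤ ε ^ 2 * (2 * inner ℝ u g + δ) ∧
      ∀ i, -inner ℝ g (a i) = ε⁻¹ * inner ℝ k (b i) ∧
        inner ℝ u (d i) + inner ℝ k (e i) - ε⁻¹ * inner ℝ k (f i) = -(ε * inner ℝ g (c i)))
    (x₀ : X) (T : ℕ) {η : ℝ} (hη : 0 < η) (hη1 : η ≤ 1) :
    ∃ (m : ℕ) (τ : ℝ) (K : ℕ → M), 0 < τ ∧ τ ≤ η ∧ m * τ = T ∧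
      ∑ i ∈ Finset.range m, ‖K i‖ ^ 2 ≤ ε ^ 2 * τ * ((‖x₀‖ + 1) ^ 2 + 2) ∧
      ∀ (i : ι) (t : ℝ) (j : ℕ), j * τ ≤ t → t ≤ (j + 1) * τ → j ≤ m →
        |inner ℝ (S t x₀ - x₀) (a i) - ε⁻¹ * inner ℝ (∑ l ∈ Finset.range j, K l) (b i)|
          ≤ 3 * η * ‖a i‖ ∧
        |(∫ s in (0 : ℝ)..t, inner ℝ (S (max s 0) x₀) (d i))
            - ε⁻¹ * inner ℝ (∑ l ∈ Finset.range j, K l) (f i)|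
          ≤ η * (T + ‖x₀‖ + 2) * ‖d i‖ + ε * (2 * (‖x₀‖ + 1) * ‖c i‖
            + ((‖x₀‖ + 1) ^ 2 + 2 + T) * ‖e i‖) := by
  obtain ⟨x, y, hxy, hxx⟩ := hS.exists_mem_domain_near hA x₀ hη
  have hxn : ‖x‖ ≤ ‖x₀‖ + 1 := by
    have := norm_le_insert' x x₀
    linarith
  -- The mesh size is `1/(q + 1)`, so that integer horizons `T` are exactly covered by `T(q + 1)`
  -- cells. The three lower bounds on `q` give `τ‖y‖ ≤ η`, `τ ≤ η` and `2Tτ‖y‖² ≤ 1`.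
  obtain ⟨q, hq⟩ := exists_nat_ge (max (‖y‖ / η) (max η⁻¹ (2 * T * ‖y‖ ^ 2)))
  set p : ℝ := (q : ℝ) + 1 with hp
  have hp0 : 0 < p := by positivity
  have hpq := (le_max_left _ _).trans hq
  have hpq' := (le_max_left _ _).trans ((le_max_right _ _).trans hq)
  have hpq'' := (le_max_right _ _).trans ((le_max_right _ _).trans hq)
  set τ : ℝ := p⁻¹ with hτdef
  have hτ : 0 < τ := by positivity
  have hτη : τ ≤ η := by
    rw [hτdef]; exact inv_le_of_inv_le₀ hη (by linarith)
  have hτy : τ * ‖y‖ ≤ η := by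
    rw [hτdef, inv_mul_le_iff₀ hp0]
    rw [div_le_iff₀ hη] at hpq
    nlinarith
  have hmτ : ((T * (q + 1) : ℕ) : ℝ) * τ = T := by
    rw [hτdef, hp]; push_cast; field_simp
  have hτT : 2 * T * τ * ‖y‖ ^ 2 ≤ 1 := by
    have : 2 * T * τ * ‖y‖ ^ 2 = p⁻¹ * (2 * T * ‖y‖ ^ 2) := by rw [hτdef]; ring
    rw [this, inv_mul_le_iff₀ hp0]
    linarith
  set m := T * (q + 1) with hm
  -- The cell integral `u i` lies in the domain and `L_ε (u i)` is exactly `g i`, the decrease of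
  -- the orbit over the cell.
  set u : ℕ → X := fun i => ∫ s in (i * τ)..((i + 1) * τ), S (max s 0) x with hu
  set g : ℕ → X := fun i => S (i * τ) x - S ((i + 1) * τ) x with hg
  have hAu : ∀ i, A (u i) (-(g i)) := by
    intro i
    rw [hg, neg_sub]
    exact hS.generator_integral hA x (by positivity) (by gcongr; linarith)
  -- Over the `m = T/τ` cells these errors add up to at most `τ`.
  have hδ : 0 < τ ^ 2 / (T + 1) := by positivity
  choose K hK1 hK2 using fun i => hD (u i) (g i) (hAu i) _ hδ
  have hsum : ∑ i ∈ Finset.range m, ‖K i‖ ^ 2 ≤ ε ^ 2 * τ * ((‖x₀‖ + 1) ^ 2 + 2) := by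
    have s1 := hS.sum_inner_integral_le hA hdiss hxy hτ m
    calc ∑ i ∈ Finset.range m, ‖K i‖ ^ 2
        ≤ ∑ i ∈ Finset.range m, ε ^ 2 * (2 * inner ℝ (u i) (g i) + τ ^ 2 / (T + 1)) :=
          Finset.sum_le_sum fun i _ => hK1 i
      _ = ε ^ 2 * (2 * ∑ i ∈ Finset.range m, inner ℝ (u i) (g i) + m * (τ ^ 2 / (T + 1))) := by
          rw [← Finset.mul_sum, Finset.sum_add_distrib, Finset.mul_sum]; simp
      _ ≤ ε ^ 2 * (2 * (τ * (‖x‖ ^ 2 / 2 + m * τ ^ 2 * ‖y‖ ^ 2)) + τ) := by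
          gcongr
          · have : (m : ℝ) * (τ ^ 2 / (T + 1)) = τ * (T / (T + 1)) := by
              rw [← hmτ]; ring
            rw [this]
            refine mul_le_of_le_one_right hτ.le ?_
            rw [div_le_one (by positivity)]; linarith
      _ = ε ^ 2 * τ * (‖x‖ ^ 2 + 2 * T * τ * ‖y‖ ^ 2 + 1) := by rw [← hmτ]; ring
      _ ≤ ε ^ 2 * τ * ((‖x₀‖ + 1) ^ 2 + 1 + 1) := by gcongr
      _ = _ := by ring
  refine ⟨m, τ, K, hτ, hτη, hmτ, hsum, fun i t j hjt htj hjm => ?_⟩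
  have hj0 : 0 ≤ (j : ℝ) * τ := by positivity
  have ht0 : 0 ≤ t := hj0.trans hjt
  obtain ⟨r1, r2⟩ := hS.sum_mesh_identities hA hdiss hε hτ x K j (a i) (c i) (d i) (b i) (e i) (f i)
    (fun l => by
      rw [← (hK2 l i).1, hg, ← inner_neg_left, neg_sub])
    (fun l => by
      have := (hK2 l i).2
      rw [← neg_sub (S (l * τ) x) (S ((l + 1) * τ) x), inner_neg_left, mul_neg]
      exact this)
  have hjT : (j : ℝ) * τ ≤ T := by
    rw [← hmτ]; gcongr
  have hcontr : ∀ s, ‖S (max s 0) x₀ - S (max s 0) x‖ ≤ η := by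
    intro s
    rw [← map_sub]
    refine (hS.norm_apply_le hA hdiss (le_max_right _ _) _).trans ?_
    rw [norm_sub_rev]; exact hxx.le
  constructor
  · rw [← r1, ← inner_sub_left]
    refine (abs_real_inner_le_norm _ _).trans ?_
    gcongr
    -- Three errors, each at most `η`: the change of datum at time `t`, the passage from `t` to the
    -- mesh point `jτ`, and the change of datum at time zero.
    have e1 : S t x₀ - x₀ - (S (j * τ) x - x)
        = (S (max t 0) x₀ - S (max t 0) x) + (S t x - S (j * τ) x) + (x - x₀) := by
      rw [max_eq_left ht0]; abel
    rw [e1]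
    have e2 := hS.norm_sub_apply_le hA hdiss hxy hj0 hjt
    have e3 : ‖y‖ * (t - j * τ) ≤ τ * ‖y‖ := by
      rw [mul_comm]; gcongr; linarith
    refine (norm_add₃_le).trans ?_
    linarith [hcontr t]
  · have i1 : ∀ z, ∀ a' b' : ℝ, IntervalIntegrable (fun s => (inner ℝ (S (max s 0) z) (d i) : ℝ))
        volume a' b' := fun z a' b' =>
      ((hS.continuous_orbit z).inner continuous_const).intervalIntegrable _ _
    -- The error splits into the change of datum, the incomplete last cell, and the mesh identity
    -- for the orbit of `x`.
    have e1 : (∫ s in (0 : ℝ)..t, inner ℝ (S (max s 0) x₀) (d i))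
          - ε⁻¹ * inner ℝ (∑ l ∈ Finset.range j, K l) (f i)
        = (∫ s in (0 : ℝ)..(j * τ), inner ℝ (S (max s 0) x₀ - S (max s 0) x) (d i))
          + (∫ s in (j * τ)..t, inner ℝ (S (max s 0) x₀) (d i))
          + ((∫ s in (0 : ℝ)..(j * τ), inner ℝ (S (max s 0) x) (d i))
            - ε⁻¹ * inner ℝ (∑ l ∈ Finset.range j, K l) (f i)) := by
      simp_rw [inner_sub_left]
      rw [intervalIntegral.integral_sub (i1 _ _ _) (i1 _ _ _),
        ← intervalIntegral.integral_add_adjacent_intervals (i1 x₀ 0 (j * τ)) (i1 x₀ (j * τ) t)]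
      ring
    have e2 : |∫ s in (0 : ℝ)..(j * τ), inner ℝ (S (max s 0) x₀ - S (max s 0) x) (d i)|
        ≤ η * ‖d i‖ * T := by
      have := intervalIntegral.norm_integral_le_of_norm_le_const (a := 0) (b := j * τ)
        (f := fun s => (inner ℝ (S (max s 0) x₀ - S (max s 0) x) (d i) : ℝ)) (C := η * ‖d i‖)
        fun s _ => (norm_inner_le_norm _ _).trans (by gcongr; exact hcontr s)
      refine this.trans ?_
      rw [sub_zero, abs_of_nonneg hj0]
      gcongr
    have e3 : |∫ s in (j * τ)..t, inner ℝ (S (max s 0) x₀) (d i)| ≤ ‖x₀‖ * ‖d i‖ * η := by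
      have := intervalIntegral.norm_integral_le_of_norm_le_const (a := j * τ) (b := t)
        (f := fun s => (inner ℝ (S (max s 0) x₀) (d i) : ℝ)) (C := ‖x₀‖ * ‖d i‖)
        fun s _ => (norm_inner_le_norm _ _).trans (by
          gcongr; exact hS.norm_apply_le hA hdiss (le_max_right _ _) _)
      refine this.trans ?_
      rw [abs_of_nonneg (by linarith)]
      gcongr
      linarith
    have e4 : ((∑ l ∈ Finset.range j, ‖K l‖ ^ 2) / (ε * τ) + j * (ε * τ)) / 2
        ≤ ε * ((‖x₀‖ + 1) ^ 2 + 2 + T) := by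
      have h3 : ∑ l ∈ Finset.range j, ‖K l‖ ^ 2 ≤ ε ^ 2 * τ * ((‖x₀‖ + 1) ^ 2 + 2) :=
        (Finset.sum_le_sum_of_subset_of_nonneg (Finset.range_mono hjm)
          fun _ _ _ => by positivity).trans hsum
      have h4 : (∑ l ∈ Finset.range j, ‖K l‖ ^ 2) / (ε * τ) ≤ ε * ((‖x₀‖ + 1) ^ 2 + 2) := by
        rw [div_le_iff₀ (by positivity)]
        refine h3.trans (le_of_eq (by ring))
      have h5 : j * (ε * τ) ≤ ε * T := by
        calc j * (ε * τ) = ε * (j * τ) := by ring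
          _ ≤ _ := by gcongr
      have h6 : 0 ≤ ε * ((‖x₀‖ + 1) ^ 2 + 2) := by positivity
      have h7 : 0 ≤ ε * (T : ℝ) := by positivity
      linarith
    rw [e1]
    refine (abs_add_three _ _ _).trans ?_
    have e5 : ((∑ l ∈ Finset.range j, ‖K l‖ ^ 2) / (ε * τ) + j * (ε * τ)) / 2 * ‖e i‖
        ≤ ε * ((‖x₀‖ + 1) ^ 2 + 2 + T) * ‖e i‖ := by gcongr
    have e6 : ε * (2 * ‖x‖ * ‖c i‖) ≤ ε * (2 * (‖x₀‖ + 1) * ‖c i‖) := by gcongr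
    have e7 : 0 ≤ η * ‖d i‖ := by positivity
    linarith

end IsC0Semigroup

end KineticFP

/-! ### Velocity moments of the stationary equation -/

namespace KineticFP

variable {n : ℕ}

/-- Smooth compactly supported functions of the position variable. -/
abbrev XTest (n : ℕ) : Type :=
  {φ : E n → ℝ // ContDiff ℝ (⊤ : ℕ∞) φ ∧ HasCompactSupport φ}

namespace XTest

theorem contDiff_one (φ : XTest n) : ContDiff ℝ 1 φ.1 := φ.2.1.of_le (by simp)

theorem differentiable (φ : XTest n) : Differentiable ℝ φ.1 :=
  φ.contDiff_one.differentiable one_ne_zero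

theorem continuous (φ : XTest n) : Continuous φ.1 := φ.contDiff_one.continuous

theorem continuous_fderiv (φ : XTest n) : Continuous (fderiv ℝ φ.1) :=
  φ.contDiff_one.continuous_fderiv one_ne_zero

theorem continuous_gradient (φ : XTest n) : Continuous (gradient φ.1) :=
  (InnerProductSpace.toDual ℝ (E n)).symm.continuous.comp φ.continuous_fderiv

theorem norm_gradient (φ : XTest n) (x : E n) : ‖gradient φ.1 x‖ = ‖fderiv ℝ φ.1 x‖ :=
  LinearIsometryEquiv.norm_map _ _

theorem inner_gradient (φ : XTest n) (x w : E n) :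
    inner ℝ (gradient φ.1 x) w = fderiv ℝ φ.1 x w :=
  InnerProductSpace.toDual_symm_apply

/-- The directional derivative of a test function. -/
def deriv (φ : XTest n) (w : E n) : XTest n :=
  ⟨fun x => fderiv ℝ φ.1 x w, (φ.2.1.fderiv_right (by simp)).clm_apply contDiff_const,
    φ.2.2.fderiv_apply ℝ w⟩

theorem isTest (φ : XTest n) : IsTest fun p : E n × E n => φ.1 p.1 :=
  IsTest.comp_fst φ.contDiff_one φ.2.2

theorem exists_bound (φ : XTest n) : ∃ (C : ℝ) (K : Set (E n)), IsCompact K ∧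
    (∀ x, ‖φ.1 x‖ ≤ C ∧ ‖fderiv ℝ φ.1 x‖ ≤ C) ∧ ∀ x ∉ K, φ.1 x = 0 ∧ fderiv ℝ φ.1 x = 0 := by
  obtain ⟨C₁, h₁⟩ := φ.2.2.exists_bound_of_continuous φ.continuous
  obtain ⟨C₂, h₂⟩ := (φ.2.2.fderiv ℝ).exists_bound_of_continuous φ.continuous_fderiv
  refine ⟨max C₁ C₂, tsupport φ.1, φ.2.2.isCompact,
    fun x => ⟨(h₁ x).trans (le_max_left _ _), (h₂ x).trans (le_max_right _ _)⟩,
    fun x hx => ⟨image_eq_zero_of_notMem_tsupport hx, ?_⟩⟩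
  by_contra h0
  exact hx (support_fderiv_subset ℝ h0)

theorem fderiv_inner_snd_mul (φ : XTest n) (w : E n) (p y : E n × E n) :
    fderiv ℝ (fun p : E n × E n => inner ℝ w p.2 * φ.1 p.1) p y
      = inner ℝ w y.2 * φ.1 p.1 + inner ℝ w p.2 * fderiv ℝ φ.1 p.1 y.1 := by
  have hd : HasFDerivAt (fun p : E n × E n => inner ℝ w p.2)
      ((innerSL ℝ w).comp (ContinuousLinearMap.snd ℝ (E n) (E n))) p :=
    ((innerSL ℝ w).comp (ContinuousLinearMap.snd ℝ (E n) (E n))).hasFDerivAt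
  have h2 := hd.mul ((φ.differentiable p.1).hasFDerivAt.comp p hasFDerivAt_fst)
  have h3 : fderiv ℝ (fun p : E n × E n => inner ℝ w p.2 * φ.1 p.1) p = _ := h2.fderiv
  rw [h3]
  simp
  ring

end XTest

theorem memLp_two_of_le_of_eq_zero {F : Type*} [NormedAddCommGroup F] {u : E n → F}
    (hu : AEStronglyMeasurable u volume) {b : E n → ℝ}
    (hb : LocallyIntegrable (fun x => b x ^ 2) volume) {C : ℝ} {K : Set (E n)} (hK : IsCompact K)
    (hle : ∀ x, ‖u x‖ ≤ C * b x) (h0 : ∀ x ∉ K, u x = 0) : MemLp u 2 volume := by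
  rw [memLp_two_iff_integrable_sq_norm hu]
  have h1 : IntegrableOn (fun x => ‖u x‖ ^ 2) K volume := by
    refine Integrable.mono' ((hb.integrableOn_isCompact hK).const_mul (C ^ 2))
      (hu.norm.pow 2).restrict (Eventually.of_forall fun x => ?_)
    rw [Real.norm_of_nonneg (by positivity), ← mul_pow]
    gcongr
    exact hle x
  exact h1.integrable_of_forall_notMem_eq_zero fun x hx => by simp [h0 x hx]

theorem memLp_xTest (φ : XTest n) : MemLp φ.1 2 volume :=
  φ.continuous.memLp_of_hasCompactSupport φ.2.2

theorem memLp_clm_smul_xTest {B : E n → E n →L[ℝ] E n} (hB : AEStronglyMeasurable B volume)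
    (hBl : LocallyIntegrable (fun x => ‖B x‖ ^ 2) volume) (φ : XTest n) (w : E n) :
    MemLp (fun x => B x (φ.1 x • w)) 2 volume := by
  obtain ⟨C, K, hK, hC, h0⟩ := φ.exists_bound
  refine memLp_two_of_le_of_eq_zero (C := C * ‖w‖)
    (isBoundedBilinearMap_apply.continuous.comp_aestronglyMeasurable
      (hB.prodMk (φ.continuous.smul continuous_const).aestronglyMeasurable)) hBl hK
    (fun x => ?_) fun x hx => by simp [(h0 x hx).1]
  refine ((B x).le_opNorm _).trans ?_
  rw [norm_smul, mul_comm]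
  gcongr
  exact (hC x).1

theorem memLp_clm_gradient_xTest {B : E n → E n →L[ℝ] E n} (hB : AEStronglyMeasurable B volume)
    (hBl : LocallyIntegrable (fun x => ‖B x‖ ^ 2) volume) (φ : XTest n) :
    MemLp (fun x => B x (gradient φ.1 x)) 2 volume := by
  obtain ⟨C, K, hK, hC, h0⟩ := φ.exists_bound
  refine memLp_two_of_le_of_eq_zero (C := C)
    (isBoundedBilinearMap_apply.continuous.comp_aestronglyMeasurable
      (hB.prodMk φ.continuous_gradient.aestronglyMeasurable)) hBl hK
    (fun x => ?_) fun x hx => by simp [gradient, (h0 x hx).2]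
  refine ((B x).le_opNorm _).trans ?_
  rw [φ.norm_gradient, mul_comm]
  gcongr
  exact (hC x).2

/-- The formal adjoint of `∂_w + ∂_w V` applied to a test function, up to sign. -/
def adjGrad (gradV : E n → E n) (φ : XTest n) (w : E n) (x : E n) : ℝ :=
  fderiv ℝ φ.1 x w - inner ℝ (gradV x) w * φ.1 x

namespace Admissible

variable {V : E n → ℝ} {gradV : E n → E n} {G : E n → Matrix (Fin n) (Fin n) ℝ}

theorem memLp_adjGrad (h : Admissible V gradV G) (φ : XTest n) (w : E n) :
    MemLp (adjGrad gradV φ w) 2 volume := by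
  obtain ⟨C, K, hK, hC, h0⟩ := φ.exists_bound
  refine memLp_two_of_le_of_eq_zero (b := fun x => 1 + ‖gradV x‖) (C := C * ‖w‖)
    ((φ.continuous_fderiv.clm_apply continuous_const).aestronglyMeasurable.sub
      ((h.weakGrad.2.1.aestronglyMeasurable.inner aestronglyMeasurable_const).mul
        φ.continuous.aestronglyMeasurable)) h.locallyIntegrable_one_add_gradV_sq hK
    (fun x => ?_) fun x hx => by simp [adjGrad, (h0 x hx).2, (h0 x hx).1]
  refine (norm_sub_le _ _).trans ?_
  rw [norm_mul]
  have h1 : ‖fderiv ℝ φ.1 x w‖ ≤ C * ‖w‖ :=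
    ((fderiv ℝ φ.1 x).le_opNorm _).trans (by gcongr; exact (hC x).2)
  have h2 : ‖inner ℝ (gradV x) w‖ * ‖φ.1 x‖ ≤ (‖gradV x‖ * ‖w‖) * C := by
    gcongr
    · exact norm_inner_le_norm _ _
    · exact (hC x).1
  linarith

theorem memLp_xMeasure (h : Admissible V gradV G) {F : Type*} [NormedAddCommGroup F] {u : E n → F}
    (hu : MemLp u 2 volume) : MemLp u 2 (xMeasure V) := by
  obtain ⟨W, hW⟩ := h.exists_xMeasure_le
  exact hu.of_measure_le_smul ENNReal.coe_ne_top hW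

theorem memLp_comp_fst (h : Admissible V gradV G) {F : Type*} [NormedAddCommGroup F] {u : E n → F}
    (hu : MemLp u 2 volume) : MemLp (fun p : E n × E n => u p.1) 2 (eqMeasure V) :=
  (h.memLp_xMeasure hu).comp_measurePreserving h.measurePreserving_fst

/-- The map `ψ ↦ ψ(x)` from `L²(dx)` to `L²(μ)`. -/
def lift (h : Admissible V gradV G) : Lp ℝ 2 (volume : Measure (E n)) →L[ℝ] L2eq V :=
  LinearMap.mkContinuous
    { toFun := fun ψ => (h.memLp_comp_fst (Lp.memLp ψ)).toLp _
      map_add' := fun ψ₁ ψ₂ => by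
        rw [← MemLp.toLp_add]
        refine MemLp.toLp_congr _ _ ?_
        have := h.measurePreserving_fst.quasiMeasurePreserving.ae
          (h.xMeasure_ac.ae_le (Lp.coeFn_add ψ₁ ψ₂))
        filter_upwards [this] with p hp
        exact hp
      map_smul' := fun c ψ => by
        rw [RingHom.id_apply, ← MemLp.toLp_const_smul]
        refine MemLp.toLp_congr _ _ ?_
        have := h.measurePreserving_fst.quasiMeasurePreserving.ae
          (h.xMeasure_ac.ae_le (Lp.coeFn_smul c ψ))
        filter_upwards [this] with p hp
        exact hp }
    (Real.sqrt h.exists_xMeasure_le.choose) fun ψ => by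
      set W := h.exists_xMeasure_le.choose
      have hW : xMeasure V ≤ (W : ℝ≥0∞) • volume := h.exists_xMeasure_le.choose_spec
      change ‖(h.memLp_comp_fst (Lp.memLp ψ)).toLp _‖ ≤ _
      rw [Lp.norm_toLp, Lp.norm_def]
      have h1 : eLpNorm (fun p : E n × E n => ψ p.1) 2 (eqMeasure V)
          ≤ ENNReal.ofReal (Real.sqrt W) * eLpNorm ψ 2 volume := by
        have e1 := eLpNorm_comp_measurePreserving (p := 2)
          (h.memLp_xMeasure (Lp.memLp ψ)).1 h.measurePreserving_fst
        have e2 := eLpNorm_mono_measure (p := 2) (ψ : E n → ℝ) hW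
        rw [eLpNorm_smul_measure_of_ne_top ENNReal.ofNat_ne_top] at e2
        refine (e1.le.trans e2).trans (le_of_eq ?_)
        rw [smul_eq_mul, Real.sqrt_eq_rpow, ← ENNReal.ofReal_rpow_of_nonneg W.coe_nonneg (by norm_num)]
        simp
      refine (ENNReal.toReal_mono (ENNReal.mul_ne_top ENNReal.ofReal_ne_top (Lp.eLpNorm_ne_top ψ))
        h1).trans ?_
      rw [ENNReal.toReal_mul, ENNReal.toReal_ofReal (Real.sqrt_nonneg _)]

theorem lift_toLp (h : Admissible V gradV G) {ψ : E n → ℝ} (hψ : MemLp ψ 2 volume) :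
    h.lift (hψ.toLp ψ) = (h.memLp_comp_fst hψ).toLp _ := by
  change (h.memLp_comp_fst (Lp.memLp (hψ.toLp ψ))).toLp _ = _
  refine MemLp.toLp_congr _ _ ?_
  have := h.measurePreserving_fst.quasiMeasurePreserving.ae
    (h.xMeasure_ac.ae_le hψ.coeFn_toLp)
  filter_upwards [this] with p hp
  exact hp

/-- `HasDissipation` only tests in constant directions `w`; gradients are reached by decomposing
along an orthonormal basis and summing. -/
theorem inner_toLp_eq_sum {α F ι : Type*} [MeasurableSpace α] {μ : Measure α}
    [NormedAddCommGroup F] [InnerProductSpace ℝ F] [Fintype ι] (u : Lp F 2 μ) {g : ι → α → F}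
    (hg : ∀ i, MemLp (g i) 2 μ) {f : α → F} (hf : MemLp f 2 μ) (hfg : ∀ a, f a = ∑ i, g i a) :
    inner ℝ u (hf.toLp f) = ∑ i, inner ℝ u ((hg i).toLp (g i)) := by
  simp_rw [inner_toLp_right]
  rw [← integral_finsetSum _ fun i _ => integrable_inner_of_memLp (Lp.memLp u) (hg i)]
  simp_rw [hfg, inner_sum]

theorem sum_inner_mul_fderiv (φ : XTest n) (x v : E n) :
    ∑ i, inner ℝ (EuclideanSpace.basisFun (Fin n) ℝ i) v
      * fderiv ℝ φ.1 x (EuclideanSpace.basisFun (Fin n) ℝ i) = fderiv ℝ φ.1 x v := by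
  conv_rhs => rw [← (EuclideanSpace.basisFun (Fin n) ℝ).sum_repr' v]
  rw [map_sum]
  simp only [map_smul, smul_eq_mul]

theorem sum_fderiv_smul (φ : XTest n) (x : E n) :
    ∑ i, fderiv ℝ φ.1 x (EuclideanSpace.basisFun (Fin n) ℝ i)
      • EuclideanSpace.basisFun (Fin n) ℝ i = gradient φ.1 x := by
  conv_rhs => rw [← (EuclideanSpace.basisFun (Fin n) ℝ).sum_repr' (gradient φ.1 x)]
  refine Finset.sum_congr rfl fun i _ => ?_
  rw [real_inner_comm, φ.inner_gradient]

theorem memLp_inner_snd_smul_clm_gradient (h : Admissible V gradV G) {B : E n → E n →L[ℝ] E n}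
    (hB : AEStronglyMeasurable B volume) (hBl : LocallyIntegrable (fun x => ‖B x‖ ^ 2) volume)
    (φ : XTest n) (w : E n) :
    MemLp (fun p : E n × E n => inner ℝ w p.2 • B p.1 (gradient φ.1 p.1)) 2 (eqMeasure V) := by
  have h1 : ∀ i, MemLp (fun p : E n × E n => B p.1 ((inner ℝ w p.2
      * (φ.deriv (EuclideanSpace.basisFun (Fin n) ℝ i)).1 p.1)
        • EuclideanSpace.basisFun (Fin n) ℝ i)) 2 (eqMeasure V) := fun i =>
    h.memLp_clm_const hB hBl ((φ.deriv _).isTest.inner_snd_mul w) _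
  refine (memLp_finsetSum Finset.univ fun i _ => h1 i).ae_eq (Eventually.of_forall fun p => ?_)
  simp only
  rw [← sum_fderiv_smul, map_sum, Finset.smul_sum]
  refine Finset.sum_congr rfl fun i _ => ?_
  rw [← (B p.1).map_smul, smul_smul]
  rfl

/-- The first two velocity moments of the weak form of `L_ε u = g`. -/
theorem moment_identities (h : Admissible V gradV G) {R Q : E n → E n →L[ℝ] E n}
    (hR : IsSqrtField G R Q) {ε : ℝ} (hε : 0 < ε) {u g : L2eq V}
    {k : Lp (E n) 2 (eqMeasure V)}
    (hform : ∀ Φ : testSpace n, -(ε⁻¹ * inner ℝ u (h.transportToLp Φ))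
        + (ε ^ 2)⁻¹ * inner ℝ k (h.dissipationToLp hR Φ) = inner ℝ g (h.testToLp Φ))
    (hk : h.HasDissipation hR u k) (φ : XTest n) (w : E n) :
    -inner ℝ g (h.lift ((memLp_xTest φ).toLp _)) = ε⁻¹ * inner ℝ k
        ((h.memLp_comp_fst (memLp_clm_gradient_xTest hR.measQ hR.locQ φ)).toLp _) ∧
      inner ℝ u (h.lift ((h.memLp_adjGrad φ w).toLp _))
        + inner ℝ k ((h.memLp_inner_snd_smul_clm_gradient hR.measQ hR.locQ φ w).toLp _)
        - ε⁻¹ * inner ℝ k ((h.memLp_comp_fst (memLp_clm_smul_xTest hR.measR hR.locR φ w)).toLp _)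
      = -(ε * inner ℝ g ((h.memLp_test (φ.isTest.inner_snd_mul w)).toLp _)) := by
  set e := EuclideanSpace.basisFun (Fin n) ℝ with he
  have hfst : ∀ (ψ : XTest n) (p y : E n × E n),
      fderiv ℝ (fun p : E n × E n => ψ.1 p.1) p y = fderiv ℝ ψ.1 p.1 y.1 := fun ψ p y => by
    rw [IsTest.fderiv_comp_fst ψ.differentiable]; rfl
  constructor
  · have f1 := hform ⟨_, φ.isTest⟩
    change -(ε⁻¹ * inner ℝ u ((h.memLp_transport φ.isTest).toLp _))
      + (ε ^ 2)⁻¹ * inner ℝ k ((h.memLp_clm_vGrad hR.measR hR.locR φ.isTest).toLp _)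
        = inner ℝ g ((h.memLp_test φ.isTest).toLp _) at f1
    have e0 : inner ℝ k ((h.memLp_clm_vGrad hR.measR hR.locR φ.isTest).toLp _) = 0 := by
      rw [inner_toLp_right]
      have : ∀ p : E n × E n, vGrad (fun p : E n × E n => φ.1 p.1) p = 0 := fun p =>
        ext_inner_right ℝ fun y => by rw [inner_vGrad, hfst]; simp
      simp [this]
    -- `v·∇φ = ∑ vᵢ ∂ᵢφ`, and since `∂ᵢφ` does not depend on `v` each summand is the Gaussian
    -- adjoint of `∂/∂vᵢ` applied to it. Hence the transport term is a pairing with `k` alone.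
    have e1 : inner ℝ u ((h.memLp_transport φ.isTest).toLp _) = inner ℝ k
        ((h.memLp_comp_fst (memLp_clm_gradient_xTest hR.measQ hR.locQ φ)).toLp _) := by
      rw [inner_toLp_eq_sum u (fun i => h.memLp_gaussAdj (φ.deriv (e i)).isTest (e i)),
        inner_toLp_eq_sum k (fun i => h.memLp_clm_const hR.measQ hR.locQ (φ.deriv (e i)).isTest
          (e i))]
      · exact Finset.sum_congr rfl fun i _ => hk _ (φ.deriv (e i)).isTest (e i)
      · intro p
        rw [← sum_fderiv_smul, map_sum]
        rfl
      · intro p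
        simp_rw [hfst]
        rw [← sum_inner_mul_fderiv]
        refine Finset.sum_congr rfl fun i _ => ?_
        simp [XTest.deriv, he]
    rw [h.lift_toLp, ← f1, e0, e1]
    ring
  · have ht := φ.isTest.inner_snd_mul w
    have f1 := hform ⟨_, ht⟩
    change -(ε⁻¹ * inner ℝ u ((h.memLp_transport ht).toLp _))
      + (ε ^ 2)⁻¹ * inner ℝ k ((h.memLp_clm_vGrad hR.measR hR.locR ht).toLp _)
        = inner ℝ g ((h.memLp_test ht).toLp _) at f1
    have e0 : inner ℝ k ((h.memLp_clm_vGrad hR.measR hR.locR ht).toLp _)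
        = inner ℝ k ((h.memLp_comp_fst (memLp_clm_smul_xTest hR.measR hR.locR φ w)).toLp _) := by
      rw [inner_toLp_right, inner_toLp_right]
      have : ∀ p : E n × E n, vGrad (fun p : E n × E n => inner ℝ w p.2 * φ.1 p.1) p
          = φ.1 p.1 • w := fun p =>
        ext_inner_right ℝ fun y => by
          rw [inner_vGrad, φ.fderiv_inner_snd_mul, inner_smul_left]; simp [mul_comm]
      simp only [this]
    -- The sum over `i` of the Gaussian adjoints of `∂/∂vᵢ` applied to `(w·v)∂ᵢφ` is `(w·v)(v·∇φ) -
    -- ∂_wφ`. The transport of `(w·v)φ` is this plus `∂_wφ - ∂_wV φ`, which depends on `x` only and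
    -- is seen by the density.
    have hA : MemLp (fun p : E n × E n => inner ℝ w p.2 * fderiv ℝ φ.1 p.1 p.2
        - fderiv ℝ φ.1 p.1 w) 2 (eqMeasure V) := by
      refine ((h.memLp_transport ht).sub (h.memLp_comp_fst (h.memLp_adjGrad φ w))).ae_eq
        (Eventually.of_forall fun p => ?_)
      simp only [Pi.sub_apply, φ.fderiv_inner_snd_mul, adjGrad, inner_neg_right, real_inner_comm]
      ring
    have e1 : inner ℝ u (hA.toLp _) = inner ℝ k
        ((h.memLp_inner_snd_smul_clm_gradient hR.measQ hR.locQ φ w).toLp _) := by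
      rw [inner_toLp_eq_sum u (fun i => h.memLp_gaussAdj
          ((φ.deriv (e i)).isTest.inner_snd_mul w) (e i)),
        inner_toLp_eq_sum k (fun i => h.memLp_clm_const hR.measQ hR.locQ
          ((φ.deriv (e i)).isTest.inner_snd_mul w) (e i))]
      · exact Finset.sum_congr rfl fun i _ => hk _ ((φ.deriv (e i)).isTest.inner_snd_mul w) (e i)
      · intro p
        rw [← sum_fderiv_smul, map_sum, Finset.smul_sum]
        refine Finset.sum_congr rfl fun i _ => ?_
        rw [← (Q p.1).map_smul, smul_smul]
        rfl
      · intro p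
        rw [← sum_inner_mul_fderiv φ p.1 p.2, ← sum_inner_mul_fderiv φ p.1 w, Finset.mul_sum,
          ← Finset.sum_sub_distrib]
        refine Finset.sum_congr rfl fun i _ => ?_
        rw [(φ.deriv (e i)).fderiv_inner_snd_mul]
        simp only [XTest.deriv, map_zero, mul_zero, add_zero, real_inner_comm, he]
        ring
    have e2 : inner ℝ u ((h.memLp_transport ht).toLp _)
        = inner ℝ u (hA.toLp _) + inner ℝ u (h.lift ((h.memLp_adjGrad φ w).toLp _)) := by
      rw [h.lift_toLp, ← inner_add_right, ← MemLp.toLp_add]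
      congr 1
      refine MemLp.toLp_congr _ _ (Eventually.of_forall fun p => ?_)
      simp only [Pi.add_apply, φ.fderiv_inner_snd_mul, adjGrad, inner_neg_right, real_inner_comm]
      ring
    rw [← f1, e0, e2, e1]
    field_simp
    ring

end Admissible

end KineticFP

namespace KineticFP

/-! ### Step functions in time and the approximate flux -/

section TimeSlab

variable {Y F : Type*} [MeasurableSpace Y] {ν : Measure Y} [NormedAddCommGroup F]
  [InnerProductSpace ℝ F]

/-- The product of Lebesgue measure on the half-line `t > 0` with `ν`. -/
abbrev timeProd (ν : Measure Y) : Measure (ℝ × Y) := (volume.restrict (Ioi (0 : ℝ))).prod ν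

theorem memLp_indicator_Ioc (a b : ℝ) (y : Lp F 2 ν) :
    MemLp (fun q : ℝ × Y => (Ioc a b).indicator (fun _ => (1 : ℝ)) q.1 • y q.2) 2
      (timeProd ν) := by
  have hm : AEStronglyMeasurable
      (fun q : ℝ × Y => (Ioc a b).indicator (fun _ => (1 : ℝ)) q.1 • y q.2) (timeProd ν) := by
    refine AEStronglyMeasurable.smul ?_ ?_
    · exact ((measurable_const.indicator measurableSet_Ioc).comp
        measurable_fst).aestronglyMeasurable
    · exact (Lp.memLp y).1.comp_quasiMeasurePreserving Measure.quasiMeasurePreserving_snd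
  rw [memLp_two_iff_integrable_sq_norm hm]
  have h1 : Integrable ((Ioc a b).indicator (fun _ => (1 : ℝ))) (volume.restrict (Ioi (0 : ℝ))) :=
    ((integrable_indicator_iff measurableSet_Ioc).mpr
      (integrableOn_const measure_Ioc_lt_top.ne)).restrict
  have h2 := (memLp_two_iff_integrable_sq_norm (Lp.memLp y).1).mp (Lp.memLp y)
  refine (h1.mul_prod h2).congr (Eventually.of_forall fun q => ?_)
  by_cases hq : q.1 ∈ Ioc a b <;> simp [hq]

/-- The function `(s, x) ↦ 1_{(a,b]}(s) y(x)`. -/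
def timeSlab (a b : ℝ) (y : Lp F 2 ν) : Lp F 2 (timeProd ν) :=
  (memLp_indicator_Ioc a b y).toLp _

theorem inner_timeSlab [SFinite ν] {a b c d : ℝ} (ha : 0 ≤ a) (y z : Lp F 2 ν) :
    inner ℝ (timeSlab a b y) (timeSlab c d z) = max (min b d - max a c) 0 * inner ℝ y z := by
  rw [timeSlab, timeSlab, inner_toLp_toLp]
  have e : ∀ q : ℝ × Y, inner ℝ ((Ioc a b).indicator (fun _ => (1 : ℝ)) q.1 • y q.2)
      ((Ioc c d).indicator (fun _ => (1 : ℝ)) q.1 • z q.2)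
      = (Ioc (max a c) (min b d)).indicator (fun _ => (1 : ℝ)) q.1 * inner ℝ (y q.2) (z q.2) := by
    intro q
    rw [show Ioc (max a c) (min b d) = Ioc a b ∩ Ioc c d from Ioc_inter_Ioc.symm, inner_smul_left, inner_smul_right]
    by_cases h1 : q.1 ∈ Ioc a b <;> by_cases h2 : q.1 ∈ Ioc c d <;>
      simp [indicator, h1, h2, -mem_Ioc]
  simp_rw [e]
  rw [integral_prod_mul (fun s => (Ioc (max a c) (min b d)).indicator (fun _ => (1 : ℝ)) s)
    (fun x => inner ℝ (y x) (z x)), L2.inner_def]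
  congr 1
  have hsub : Ioc (max a c) (min b d) ⊆ Ioi 0 := fun s hs =>
    ha.trans_lt ((le_max_left a c).trans_lt hs.1)
  rw [integral_indicator_const _ measurableSet_Ioc, smul_eq_mul, mul_one, Measure.real,
    Measure.restrict_apply measurableSet_Ioc,
    inter_eq_left.mpr hsub, Real.volume_Ioc,
    ENNReal.toReal_ofReal']

theorem timeSlab_sub_timeSlab {s t : ℝ} (hs : 0 ≤ s) (hst : s ≤ t) (y : Lp F 2 ν) :
    timeSlab 0 t y - timeSlab 0 s y = timeSlab s t y := by
  rw [timeSlab, timeSlab, timeSlab, ← MemLp.toLp_sub]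
  refine MemLp.toLp_congr _ _ (Eventually.of_forall fun q => ?_)
  simp only [Pi.sub_apply]
  rw [← sub_smul]
  congr 1
  rw [← Ioc_union_Ioc_eq_Ioc hs hst, indicator_union_of_disjoint (by
    rw [Set.disjoint_left]; intro r h1 h2; exact absurd h1.2 (not_le.mpr h2.1))]
  simp

theorem norm_timeSlab [SFinite ν] {s t : ℝ} (hs : 0 ≤ s) (hst : s ≤ t) (y : Lp F 2 ν) :
    ‖timeSlab s t y‖ = Real.sqrt (t - s) * ‖y‖ := by
  have h1 := inner_timeSlab (b := t) (c := s) (d := t) hs y y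
  rw [real_inner_self_eq_norm_sq, real_inner_self_eq_norm_sq, min_self, max_self,
    max_eq_left (by linarith)] at h1
  rw [← Real.sqrt_sq (norm_nonneg (timeSlab s t y)), h1, Real.sqrt_mul (by linarith),
    Real.sqrt_sq (norm_nonneg y)]

/-- Two slabs differ by a slab of length `|t - s|`, whose norm is `√|t - s| ‖y‖`. This
equicontinuity in time replaces an Arzelà–Ascoli argument for the densities. -/
theorem continuousOn_timeSlab [SFinite ν] (y : Lp F 2 ν) :
    ContinuousOn (fun t => timeSlab 0 t y) (Ici 0) := by
  have hsym : ∀ s t : ℝ, 0 ≤ s → 0 ≤ t →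
      dist (timeSlab 0 t y) (timeSlab 0 s y) ≤ Real.sqrt |t - s| * ‖y‖ := by
    have key : ∀ s t : ℝ, 0 ≤ s → s ≤ t →
        dist (timeSlab 0 t y) (timeSlab 0 s y) ≤ Real.sqrt |t - s| * ‖y‖ := by
      intro s t hs hst
      rw [dist_eq_norm, timeSlab_sub_timeSlab hs hst, norm_timeSlab hs hst,
        abs_of_nonneg (by linarith)]
    intro s t hs ht
    rcases le_total s t with hst | hst
    · exact key s t hs hst
    · rw [dist_comm, abs_sub_comm]; exact key t s ht hst
  intro s hs
  rw [ContinuousWithinAt, tendsto_iff_dist_tendsto_zero]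
  have h1 : Tendsto (fun t : ℝ => Real.sqrt |t - s| * ‖y‖) (𝓝[Ici 0] s) (𝓝 0) := by
    have : Continuous fun t : ℝ => Real.sqrt |t - s| * ‖y‖ := by fun_prop
    simpa using (this.tendsto s).mono_left nhdsWithin_le_nhds
  refine squeeze_zero' (Eventually.of_forall fun _ => dist_nonneg) ?_ h1
  filter_upwards [self_mem_nhdsWithin] with t ht
  exact hsym s t hs ht

/-- The step function with values `y i` on the cells `(iτ, (i+1)τ]`, `i < m`. -/
def stepSlab (τ : ℝ) (m : ℕ) (y : ℕ → Lp F 2 ν) : Lp F 2 (timeProd ν) :=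
  ∑ i ∈ Finset.range m, timeSlab (i * τ) ((i + 1) * τ) (y i)

theorem norm_stepSlab_sq [SFinite ν] {τ : ℝ} (hτ : 0 < τ) (m : ℕ) (y : ℕ → Lp F 2 ν) :
    ‖stepSlab τ m y‖ ^ 2 = τ * ∑ i ∈ Finset.range m, ‖y i‖ ^ 2 := by
  rw [← real_inner_self_eq_norm_sq, stepSlab, sum_inner, Finset.mul_sum]
  refine Finset.sum_congr rfl fun i hi => ?_
  rw [inner_sum, Finset.sum_eq_single i]
  · rw [inner_timeSlab (by positivity), min_self, max_self, real_inner_self_eq_norm_sq,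
      max_eq_left] <;> ring_nf
    exact hτ.le
  · intro l _ hl
    rw [inner_timeSlab (by positivity), max_eq_right, zero_mul]
    rcases lt_or_gt_of_ne hl with h | h
    · have : (l : ℝ) + 1 ≤ i := by exact_mod_cast h
      have h1 := min_le_right (((i : ℝ) + 1) * τ) ((l + 1) * τ)
      have h2 := le_max_left ((i : ℝ) * τ) (l * τ)
      nlinarith
    · have : (i : ℝ) + 1 ≤ l := by exact_mod_cast h
      have h1 := min_le_left (((i : ℝ) + 1) * τ) ((l + 1) * τ)
      have h2 := le_max_right ((i : ℝ) * τ) (l * τ)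
      nlinarith
  · exact fun h => absurd hi h

theorem inner_stepSlab [SFinite ν] {τ : ℝ} (hτ : 0 < τ) {j m : ℕ} (hjm : j ≤ m) (y : ℕ → Lp F 2 ν)
    (z : Lp F 2 ν) :
    inner ℝ (stepSlab τ m y) (timeSlab 0 (j * τ) z)
      = τ * ∑ i ∈ Finset.range j, inner ℝ (y i) z := by
  rw [stepSlab, sum_inner, Finset.mul_sum, ← Finset.sum_subset (Finset.range_mono hjm)]
  · refine Finset.sum_congr rfl fun i hi => ?_
    have h1 : (i : ℝ) + 1 ≤ j := by exact_mod_cast Finset.mem_range.mp hi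
    have h2 : 0 ≤ (i : ℝ) * τ := by positivity
    rw [inner_timeSlab h2, min_eq_left (by gcongr), max_eq_left h2,
      show ((i : ℝ) + 1) * τ - i * τ = τ by ring, max_eq_left hτ.le]
  · intro i _ hi
    have h1 : (j : ℝ) ≤ i := by exact_mod_cast not_lt.mp (fun h => hi (Finset.mem_range.mpr h))
    rw [inner_timeSlab (by positivity), max_eq_right, zero_mul]
    have h2 := min_le_right (((i : ℝ) + 1) * τ) (j * τ)
    have h3 := le_max_left ((i : ℝ) * τ) 0
    nlinarith

theorem abs_inner_stepSlab_sub_le [SFinite ν] {τ t : ℝ} {j : ℕ} (hτ : 0 < τ) (hjt : j * τ ≤ t)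
    (htj : t ≤ (j + 1) * τ) (κ : Lp F 2 (timeProd ν)) (z : Lp F 2 ν) :
    |inner ℝ κ (timeSlab 0 t z) - inner ℝ κ (timeSlab 0 (j * τ) z)|
      ≤ ‖κ‖ * (Real.sqrt τ * ‖z‖) := by
  have h0 : 0 ≤ (j : ℝ) * τ := by positivity
  rw [← inner_sub_right, timeSlab_sub_timeSlab h0 hjt]
  refine (abs_real_inner_le_norm _ _).trans ?_
  rw [norm_timeSlab h0 hjt]
  gcongr
  linarith

end TimeSlab

variable {n : ℕ}

namespace Admissible

variable {V : E n → ℝ} {gradV : E n → E n} {G : E n → Matrix (Fin n) (Fin n) ℝ}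

set_option maxHeartbeats 1600000 in
/-- For small `ε`, the orbits of `-L_ε` carry an approximate flux `κ`, bounded in `L²(dt ⊗ ν)`. -/
theorem exists_flux (h : Admissible V gradV G) {R Q : E n → E n →L[ℝ] E n}
    (hR : IsSqrtField G R Q) {B : ℝ} (hB : 0 ≤ B) :
    ∃ D : XTest n → E n → ℝ, ∀ (ε : ℝ) (S : ℝ → L2eq V →L[ℝ] L2eq V) (h₀ : L2eq V),
      0 < ε → ε ≤ 1 → IsC0Semigroup S →
      (IsGenerator S fun u g => IsKFPOperator ε V gradV G u (-g)) → ‖h₀‖ ≤ B →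
      ∃ κ : Lp (E n) 2 (timeProd (xMeasure V)), ‖κ‖ ≤ B + 3 ∧
        ∀ (φ : XTest n) (w : E n) (t : ℝ), 0 ≤ t → t * Real.sqrt ε ≤ 1 →
          |inner ℝ (S t h₀ - h₀) (h.lift ((memLp_xTest φ).toLp _)) - inner ℝ κ (timeSlab 0 t
            ((h.memLp_xMeasure (memLp_clm_gradient_xTest hR.measQ hR.locQ φ)).toLp _))|
            ≤ Real.sqrt ε * D φ w ∧
          |(∫ s in (0 : ℝ)..t, inner ℝ (S (max s 0) h₀) (h.lift ((h.memLp_adjGrad φ w).toLp _)))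
            - inner ℝ κ (timeSlab 0 t
              ((h.memLp_xMeasure (memLp_clm_smul_xTest hR.measR hR.locR φ w)).toLp _))|
            ≤ Real.sqrt ε * D φ w := by
  set a : XTest n → L2eq V := fun φ => h.lift ((memLp_xTest φ).toLp _) with ha
  set d : XTest n → E n → L2eq V := fun φ w => h.lift ((h.memLp_adjGrad φ w).toLp _) with hd
  set c : XTest n → E n → L2eq V :=
    fun φ w => (h.memLp_test (φ.isTest.inner_snd_mul w)).toLp _ with hc
  set e : XTest n → E n → Lp (E n) 2 (eqMeasure V) := fun φ w =>
    (h.memLp_inner_snd_smul_clm_gradient hR.measQ hR.locQ φ w).toLp _ with he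
  set zQ : XTest n → Lp (E n) 2 (xMeasure V) := fun φ =>
    (h.memLp_xMeasure (memLp_clm_gradient_xTest hR.measQ hR.locQ φ)).toLp _ with hzQ
  set zR : XTest n → E n → Lp (E n) 2 (xMeasure V) := fun φ w =>
    (h.memLp_xMeasure (memLp_clm_smul_xTest hR.measR hR.locR φ w)).toLp _ with hzR
  -- `Pb` regards a field in `x` as a field in `(x, v)`; its adjoint is the average over the
  -- Gaussian in `v`, a contraction.
  let Pb : Lp (E n) 2 (xMeasure V) →L[ℝ] Lp (E n) 2 (eqMeasure V) :=
    (Lp.compMeasurePreservingₗᵢ ℝ Prod.fst h.measurePreserving_fst).toContinuousLinearMap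
  have hPb : ‖Pb‖ ≤ 1 := LinearIsometry.norm_toContinuousLinearMap_le _
  refine ⟨fun φ w => (3 * ‖a φ‖ + (B + 3) * ‖zQ φ‖) + ((B + 4) * ‖d φ w‖
    + (2 * (B + 1) * ‖c φ w‖ + ((B + 1) ^ 2 + 4) * ‖e φ w‖) + (B + 3) * ‖zR φ w‖),
    fun ε S h₀ hε hε1 hS hA hh₀ => ?_⟩
  have hdiss := h.generator_dissipative hε hS hA
  set s := Real.sqrt ε with hs
  have hs0 : 0 < s := Real.sqrt_pos.mpr hε
  have hss : s * s = ε := Real.mul_self_sqrt hε.le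
  have hs1 : s ≤ 1 := Real.sqrt_le_one.mpr hε1
  -- A horizon of order `ε^{-1/2}` eventually exceeds every fixed time, while `ε T ≤ 2√ε` keeps the
  -- errors proportional to `ε T` small.
  set T := ⌈s⁻¹⌉₊ with hT
  have hT1 : (T : ℝ) < s⁻¹ + 1 := Nat.ceil_lt_add_one (by positivity)
  have hTε : ε * T ≤ 2 * s := by
    calc ε * T ≤ ε * (s⁻¹ + 1) := by gcongr
      _ = s + ε := by rw [← hss]; field_simp
      _ ≤ 2 * s := by nlinarith
  have hεs : ε ≤ s := by nlinarith
  obtain ⟨m, τ, K, hτ, hτη, hmτ, hsum, hest⟩ := hS.exists_mesh_flux hA hdiss hε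
    (ι := XTest n × E n) (fun i => a i.1) (fun i => c i.1 i.2) (fun i => d i.1 i.2)
    (fun i => Pb (zQ i.1)) (fun i => e i.1 i.2) (fun i => Pb (zR i.1 i.2))
    (fun u g hug δ hδ => by
      obtain ⟨k, hk1, hk2, hk3⟩ := h.exists_dissipation hR hε hS hA (g := g) (by simpa using hug) hδ
      exact ⟨k, hk1, fun i => h.moment_identities hR hε hk2 hk3 i.1 i.2⟩)
    h₀ T (η := ε ^ 2) (by positivity) (pow_le_one₀ hε.le hε1)
  -- `K i` stands for the integral of `k` over a cell of length `τ`, so `y i` is the time and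
  -- velocity average of `k/ε` there. The bound on `∑ ‖K i‖²` exactly compensates the factors `ε`
  -- and `τ`.
  set y : ℕ → Lp (E n) 2 (xMeasure V) := fun i => (ε * τ)⁻¹ • ContinuousLinearMap.adjoint Pb (K i)
  have hετ : 0 < ε * τ := by positivity
  have hC : (‖h₀‖ + 1) ^ 2 + 2 ≤ (B + 1) ^ 2 + 2 := by gcongr
  have hκ : ‖stepSlab τ m y‖ ≤ B + 3 := by
    refine le_of_sq_le_sq ?_ (by positivity)
    rw [norm_stepSlab_sq hτ]
    have h1 : ∀ i ∈ Finset.range m, ‖y i‖ ^ 2 ≤ ((ε * τ)⁻¹) ^ 2 * ‖K i‖ ^ 2 := by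
      intro i _
      rw [← mul_pow, norm_smul, Real.norm_of_nonneg (by positivity)]
      gcongr
      refine (ContinuousLinearMap.le_opNorm _ _).trans ?_
      rw [LinearIsometryEquiv.norm_map]
      exact mul_le_of_le_one_left (norm_nonneg _) hPb
    calc τ * ∑ i ∈ Finset.range m, ‖y i‖ ^ 2
        ≤ τ * (((ε * τ)⁻¹) ^ 2 * (ε ^ 2 * τ * ((B + 1) ^ 2 + 2))) := by
          gcongr
          refine (Finset.sum_le_sum h1).trans ?_
          rw [← Finset.mul_sum]
          gcongr
          refine hsum.trans ?_
          gcongr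
      _ = (B + 1) ^ 2 + 2 := by field_simp
      _ ≤ (B + 3) ^ 2 := by nlinarith
  have hstep : ∀ (j : ℕ), j ≤ m → ∀ z, inner ℝ (stepSlab τ m y) (timeSlab 0 (j * τ) z)
      = ε⁻¹ * inner ℝ (∑ l ∈ Finset.range j, K l) (Pb z) := by
    intro j hj z
    rw [inner_stepSlab hτ hj, sum_inner, Finset.mul_sum, Finset.mul_sum]
    refine Finset.sum_congr rfl fun i _ => ?_
    rw [inner_smul_left, ContinuousLinearMap.adjoint_inner_left]
    simp only [conj_trivial]
    field_simp
  refine ⟨stepSlab τ m y, hκ, fun φ w t ht hts => ?_⟩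
  have htT : t ≤ T := by
    refine le_trans ?_ (Nat.le_ceil _)
    rw [← one_div, le_div_iff₀ hs0]; exact hts
  set j := ⌊t / τ⌋₊ with hj
  have hjt : (j : ℝ) * τ ≤ t := by
    rw [← le_div_iff₀ hτ]; exact Nat.floor_le (by positivity)
  have htj : t ≤ (j + 1) * τ := by
    rw [← div_le_iff₀ hτ]; exact (Nat.lt_floor_add_one _).le
  have hjm : j ≤ m := by
    have : (j : ℝ) * τ ≤ m * τ := by rw [hmτ]; exact hjt.trans htT
    exact_mod_cast le_of_mul_le_mul_right this hτ
  have hsτ : Real.sqrt τ ≤ s := by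
    refine Real.sqrt_le_sqrt (hτη.trans ?_)
    nlinarith
  obtain ⟨q1, q2⟩ := hest (φ, w) t j hjt htj hjm
  simp only at q1 q2
  rw [← hstep j hjm] at q1 q2
  have hfin : ∀ z, |inner ℝ (stepSlab τ m y) (timeSlab 0 t z)
      - inner ℝ (stepSlab τ m y) (timeSlab 0 (j * τ) z)| ≤ s * ((B + 3) * ‖z‖) := by
    intro z
    refine (abs_inner_stepSlab_sub_le hτ hjt htj _ z).trans ?_
    calc ‖stepSlab τ m y‖ * (Real.sqrt τ * ‖z‖) ≤ (B + 3) * (s * ‖z‖) := by gcongr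
      _ = _ := by ring
  have hη : ε ^ 2 ≤ s := by nlinarith
  have hp1 : 0 ≤ s * (3 * ‖a φ‖ + (B + 3) * ‖zQ φ‖) := by positivity
  have hp2 : 0 ≤ s * ((B + 4) * ‖d φ w‖
    + (2 * (B + 1) * ‖c φ w‖ + ((B + 1) ^ 2 + 4) * ‖e φ w‖) + (B + 3) * ‖zR φ w‖) := by positivity
  constructor
  · have h3 : 3 * ε ^ 2 * ‖a φ‖ ≤ s * (3 * ‖a φ‖) := by
      calc 3 * ε ^ 2 * ‖a φ‖ ≤ 3 * s * ‖a φ‖ := by gcongr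
        _ = _ := by ring
    have h4 := abs_sub_le (inner ℝ (S t h₀ - h₀) (a φ))
      (inner ℝ (stepSlab τ m y) (timeSlab 0 (j * τ) (zQ φ)))
      (inner ℝ (stepSlab τ m y) (timeSlab 0 t (zQ φ)))
    have h5 := hfin (zQ φ)
    rw [abs_sub_comm] at h5
    linarith
  · have h3 : ε ^ 2 * (T + ‖h₀‖ + 2) * ‖d φ w‖ ≤ s * ((B + 4) * ‖d φ w‖) := by
      have : ε ^ 2 * (T + ‖h₀‖ + 2) ≤ s * (B + 4) := by
        calc ε ^ 2 * (T + ‖h₀‖ + 2) = ε * (ε * T) + ε ^ 2 * (‖h₀‖ + 2) := by ring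
          _ ≤ 1 * (2 * s) + s * (B + 2) := by gcongr
          _ = _ := by ring
      calc _ ≤ s * (B + 4) * ‖d φ w‖ := by gcongr
        _ = _ := by ring
    have h3' : ε * (2 * (‖h₀‖ + 1) * ‖c φ w‖ + ((‖h₀‖ + 1) ^ 2 + 2 + T) * ‖e φ w‖)
        ≤ s * (2 * (B + 1) * ‖c φ w‖ + ((B + 1) ^ 2 + 4) * ‖e φ w‖) := by
      have e1 : ε * (2 * (‖h₀‖ + 1) * ‖c φ w‖) ≤ s * (2 * (B + 1) * ‖c φ w‖) := by gcongr
      have e2 : ε * ((‖h₀‖ + 1) ^ 2 + 2 + T) ≤ s * ((B + 1) ^ 2 + 4) := by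
        calc ε * ((‖h₀‖ + 1) ^ 2 + 2 + T) = ε * ((‖h₀‖ + 1) ^ 2 + 2) + ε * T := by ring
          _ ≤ s * ((B + 1) ^ 2 + 2) + 2 * s := by gcongr
          _ = _ := by ring
      calc _ = ε * (2 * (‖h₀‖ + 1) * ‖c φ w‖) + ε * ((‖h₀‖ + 1) ^ 2 + 2 + T) * ‖e φ w‖ := by ring
        _ ≤ s * (2 * (B + 1) * ‖c φ w‖) + s * ((B + 1) ^ 2 + 4) * ‖e φ w‖ := by gcongr
        _ = _ := by ring
    have h4 := abs_sub_le (∫ s in (0 : ℝ)..t, inner ℝ (S (max s 0) h₀) (d φ w))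
      (inner ℝ (stepSlab τ m y) (timeSlab 0 (j * τ) (zR φ w)))
      (inner ℝ (stepSlab τ m y) (timeSlab 0 t (zR φ w)))
    have h5 := hfin (zR φ w)
    rw [abs_sub_comm] at h5
    linarith

end Admissible

end KineticFP

/-! ### Weak compactness and passage to the limit -/

namespace KineticFP

/-- Bounded functions of time converge weakly, locally uniformly in time, when they converge
against a dense set. -/
theorem exists_uniform_weak_limit_of_dense {H : Type*} [NormedAddCommGroup H]
    [InnerProductSpace ℝ H] [CompleteSpace H] [TopologicalSpace.SeparableSpace H]
    (x : ℕ → ℝ → H) {C : ℝ} (hx : ∀ k t, 0 ≤ t → ‖x k t‖ ≤ C) {s : Set H} (hs : Dense s)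
    (c : H → ℝ → ℝ) (hlim : ∀ y ∈ s, ∀ T : ℝ,
      TendstoUniformlyOn (fun k t => inner ℝ (x k t) y) (c y) atTop (Icc 0 T)) :
    ∃ ρ : ℝ → H, (∀ t, 0 ≤ t → ‖ρ t‖ ≤ C) ∧
      (∀ y, ∀ T : ℝ, TendstoUniformlyOn (fun k t => inner ℝ (x k t) y)
        (fun t => inner ℝ (ρ t) y) atTop (Icc 0 T)) ∧
      ∀ y ∈ s, ∀ t, 0 ≤ t → inner ℝ (ρ t) y = c y t := by
  have hpt : ∀ t, ∃ a : H, 0 ≤ t → ‖a‖ ≤ C ∧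
      ∀ y, Tendsto (fun k => inner ℝ (x k t) y) atTop (𝓝 (inner ℝ a y)) := by
    intro t
    by_cases ht : 0 ≤ t
    · obtain ⟨a, h⟩ := exists_weak_limit_of_dense (fun k => x k t) C (fun k => hx k t ht) s hs
        fun y hy => ⟨c y t, (hlim y hy t).tendsto_at ⟨ht, le_rfl⟩⟩
      exact ⟨a, fun _ => h⟩
    -- Negative times are irrelevant; zero is a filler.
    · exact ⟨0, fun h => absurd h ht⟩
  choose ρ hρ using hpt
  have hC : 0 ≤ C := (norm_nonneg _).trans (hx 0 0 le_rfl)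
  have hc : ∀ y ∈ s, ∀ t, 0 ≤ t → inner ℝ (ρ t) y = c y t := fun y hy t ht =>
    tendsto_nhds_unique ((hρ t ht).2 y) ((hlim y hy t).tendsto_at ⟨ht, le_rfl⟩)
  refine ⟨ρ, fun t ht => (hρ t ht).1, fun y T => ?_, hc⟩
  rw [Metric.tendstoUniformlyOn_iff]
  intro δ hδ
  obtain ⟨z, hz, hyz⟩ := hs.exists_dist_lt y (ε := δ / (3 * (C + 1))) (by positivity)
  filter_upwards [Metric.tendstoUniformlyOn_iff.mp (hlim z hz T) (δ / 3) (by positivity)]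
    with k hk t ht
  have h1 : ∀ b : H, ‖b‖ ≤ C → |inner ℝ b (y - z)| ≤ δ / 3 := by
    intro b hb
    calc |inner ℝ b (y - z)| ≤ ‖b‖ * ‖y - z‖ := abs_real_inner_le_norm _ _
      _ ≤ (C + 1) * (δ / (3 * (C + 1))) := by
          rw [← dist_eq_norm]; gcongr; linarith
      _ = δ / 3 := by field_simp
  have h2 := hk t ht
  rw [Real.dist_eq, ← hc z hz t ht.1] at h2
  have e : inner ℝ (ρ t) y - inner ℝ (x k t) y
      = inner ℝ (ρ t) (y - z) + (inner ℝ (ρ t) z - inner ℝ (x k t) z)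
        - inner ℝ (x k t) (y - z) := by
    simp only [inner_sub_right]; ring
  rw [Real.dist_eq, e]
  have h3 := h1 _ (hx k t ht.1)
  have h4 := h1 _ (hρ t ht.1).1
  rw [abs_le] at h3 h4
  rw [abs_lt] at h2 ⊢
  constructor <;> linarith [h2.1, h2.2, h3.1, h3.2, h4.1, h4.2]

variable {n : ℕ}

theorem dense_xTest : Dense (range fun φ : XTest n => (memLp_xTest φ).toLp φ.1) := by
  refine (Lp.dense_hasCompactSupport_contDiff (F := ℝ) (μ := (volume : Measure (E n)))
    ENNReal.ofNat_ne_top (p := 2)).mono ?_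
  rintro f ⟨g, hfg, hc, hg⟩
  refine ⟨⟨g, hg, hc⟩, ?_⟩
  refine Lp.ext ((MemLp.coeFn_toLp _).trans hfg.symm)

namespace Admissible

variable {V : E n → ℝ} {gradV : E n → E n} {G : E n → Matrix (Fin n) (Fin n) ℝ}

set_option maxHeartbeats 1600000 in
/-- Along a subsequence, the densities converge to a solution of the limit equation, written with
the limit `κ` of the fluxes. -/
theorem exists_hydrodynamic_limit (h : Admissible V gradV G) {R Q : E n → E n →L[ℝ] E n}
    (hR : IsSqrtField G R Q) {B : ℝ} (hB : 0 ≤ B) {ε : ℕ → ℝ} (hε : ∀ k, 0 < ε k)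
    (hε0 : Tendsto ε atTop (𝓝 0)) {S : ℕ → ℝ → L2eq V →L[ℝ] L2eq V}
    (hS : ∀ k, IsC0Semigroup (S k))
    (hA : ∀ k, IsGenerator (S k) fun u g => IsKFPOperator (ε k) V gradV G u (-g))
    {h₀ : ℕ → L2eq V} (hh₀ : ∀ k, ‖h₀ k‖ ≤ B) :
    ∃ (σ : ℕ → ℕ) (ρ : ℝ → Lp ℝ 2 (volume : Measure (E n)))
      (κ : Lp (E n) 2 (timeProd (xMeasure V))), StrictMono σ ∧ (∃ C, ∀ t, 0 ≤ t → ‖ρ t‖ ≤ C) ∧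
      (∀ y, ∀ T : ℝ, TendstoUniformlyOn
        (fun k t => inner ℝ (S (σ k) t (h₀ (σ k))) (h.lift y))
        (fun t => inner ℝ (ρ t) y) atTop (Icc 0 T)) ∧
      (∀ (φ : XTest n) (t : ℝ), 0 ≤ t →
        inner ℝ (ρ t) ((memLp_xTest φ).toLp _) - inner ℝ (ρ 0) ((memLp_xTest φ).toLp _)
          = inner ℝ κ (timeSlab 0 t
            ((h.memLp_xMeasure (memLp_clm_gradient_xTest hR.measQ hR.locQ φ)).toLp _))) ∧
      (∀ (φ : XTest n) (w : E n) (t : ℝ), 0 ≤ t →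
        ∫ s in (0 : ℝ)..t, inner ℝ (ρ (max s 0)) ((h.memLp_adjGrad φ w).toLp _)
          = inner ℝ κ (timeSlab 0 t
            ((h.memLp_xMeasure (memLp_clm_smul_xTest hR.measR hR.locR φ w)).toLp _))) := by
  obtain ⟨D, hD⟩ := h.exists_flux hR hB
  have hκ0 : ∀ k, ∃ κ : Lp (E n) 2 (timeProd (xMeasure V)), ‖κ‖ ≤ B + 3 ∧ (ε k ≤ 1 →
      ∀ (φ : XTest n) (w : E n) (t : ℝ), 0 ≤ t → t * Real.sqrt (ε k) ≤ 1 →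
        |inner ℝ (S k t (h₀ k) - h₀ k) (h.lift ((memLp_xTest φ).toLp _)) - inner ℝ κ (timeSlab 0 t
          ((h.memLp_xMeasure (memLp_clm_gradient_xTest hR.measQ hR.locQ φ)).toLp _))|
          ≤ Real.sqrt (ε k) * D φ w ∧
        |(∫ s in (0 : ℝ)..t,
            inner ℝ (S k (max s 0) (h₀ k)) (h.lift ((h.memLp_adjGrad φ w).toLp _)))
          - inner ℝ κ (timeSlab 0 t
            ((h.memLp_xMeasure (memLp_clm_smul_xTest hR.measR hR.locR φ w)).toLp _))|
          ≤ Real.sqrt (ε k) * D φ w) := by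
    intro k
    by_cases hk : ε k ≤ 1
    · obtain ⟨κ, h1, h2⟩ := hD (ε k) (S k) (h₀ k) (hε k) hk (hS k) (hA k) (hh₀ k)
      exact ⟨κ, h1, fun _ => h2⟩
    -- Zero is a filler for `ε k > 1`, which concerns only finitely many `k`.
    · exact ⟨0, by rw [norm_zero]; positivity, fun h => absurd h hk⟩
  choose κ hκB hκ using hκ0
  have hfin := h.isFiniteMeasure_xMeasure
  have h2 : Fact ((2 : ℝ≥0∞) ≠ ⊤) := ⟨ENNReal.ofNat_ne_top⟩
  obtain ⟨σ₁, κ', hσ₁, -, hlim₁⟩ := exists_subseq_weak_tendsto κ (B + 3) hκB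
  set L := ContinuousLinearMap.adjoint h.lift with hL
  have hLn : ∀ u : L2eq V, ‖u‖ ≤ B → ‖L u‖ ≤ ‖L‖ * B := fun u hu =>
    (L.le_opNorm u).trans (by gcongr)
  -- The adjoint of `h.lift` is the velocity average, so this second extraction makes the initial
  -- densities converge weakly in `L²(dx)`. No extraction is needed at later times, since the flux
  -- determines the increments.
  obtain ⟨σ₂, a, hσ₂, -, hlim₂⟩ := exists_subseq_weak_tendsto (fun k => L (h₀ (σ₁ k))) (‖L‖ * B)
    fun k => hLn _ (hh₀ _)
  set σ := σ₁ ∘ σ₂ with hσdef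
  have hσ : StrictMono σ := hσ₁.comp hσ₂
  have hκlim : ∀ y, Tendsto (fun k => inner ℝ (κ (σ k)) y) atTop (𝓝 (inner ℝ κ' y)) :=
    fun y => (hlim₁ y).comp hσ₂.tendsto_atTop
  have hεσ : Tendsto (fun k => ε (σ k)) atTop (𝓝 0) := hε0.comp hσ.tendsto_atTop
  have hsq : Tendsto (fun k => Real.sqrt (ε (σ k))) atTop (𝓝 0) := by
    simpa using hεσ.sqrt
  have hle1 : ∀ᶠ k in atTop, ε (σ k) ≤ 1 := hεσ.eventually_le_const one_pos
  have hT1 : ∀ T : ℝ, ∀ᶠ k in atTop, ∀ t ≤ T, t * Real.sqrt (ε (σ k)) ≤ 1 := by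
    intro T
    have : Tendsto (fun k => T * Real.sqrt (ε (σ k))) atTop (𝓝 0) := by
      simpa using hsq.const_mul T
    filter_upwards [this.eventually_le_const one_pos] with k hk t ht
    exact le_trans (by gcongr) hk
  have hcontr : ∀ k t, 0 ≤ t → ‖S k t (h₀ k)‖ ≤ B := fun k t ht =>
    ((hS k).norm_apply_le (hA k) (h.generator_dissipative (hε k) (hS k) (hA k)) ht _).trans (hh₀ k)
  set zQ : XTest n → Lp (E n) 2 (xMeasure V) := fun φ =>
    (h.memLp_xMeasure (memLp_clm_gradient_xTest hR.measQ hR.locQ φ)).toLp _ with hzQ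
  set ι : XTest n → Lp ℝ 2 (volume : Measure (E n)) := fun φ => (memLp_xTest φ).toLp _ with hι
  have hLi : ∀ u y, inner ℝ (L u) y = inner ℝ u (h.lift y) := fun u y =>
    ContinuousLinearMap.adjoint_inner_left _ _ _
  have hunif : ∀ φ, ∀ T : ℝ, TendstoUniformlyOn
      (fun k t => inner ℝ (L (S (σ k) t (h₀ (σ k)))) (ι φ))
      (fun t => inner ℝ a (ι φ) + inner ℝ κ' (timeSlab 0 t (zQ φ))) atTop (Icc 0 T) := by
    intro φ T
    -- As `t` runs over `[0, T]` the test fields `1_{(0,t]} Q∇φ` trace a compact curve, on which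
    -- weak convergence of the bounded fluxes is uniform.
    have hcomp : IsCompact ((fun t => timeSlab 0 t (zQ φ)) '' Icc 0 T) :=
      isCompact_Icc.image_of_continuousOn
        ((continuousOn_timeSlab _).mono fun t ht => ht.1)
    have u1 := tendstoUniformlyOn_inner_of_isCompact (fun k => κ (σ k)) κ' (B + 3)
      (fun k => hκB _) hκlim _ hcomp
    rw [Metric.tendstoUniformlyOn_iff] at u1 ⊢
    intro δ hδ
    have t2 : Tendsto (fun k => Real.sqrt (ε (σ k)) * D φ 0) atTop (𝓝 0) := by
      simpa using hsq.mul_const (D φ 0)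
    have t3 := Metric.tendsto_nhds.mp (hlim₂ (ι φ)) (δ / 3) (by positivity)
    filter_upwards [u1 (δ / 3) (by positivity), t3,
      t2.eventually_le_const (u := δ / 4) (by positivity), hle1, hT1 T] with k k1 k2 k3 k4 k5 t ht
    have e1 := k1 _ (mem_image_of_mem _ ht)
    have e2 : |inner ℝ (S (σ k) t (h₀ (σ k)) - h₀ (σ k)) (h.lift (ι φ))
        - inner ℝ (κ (σ k)) (timeSlab 0 t (zQ φ))| ≤ Real.sqrt (ε (σ k)) * D φ 0 :=
      (hκ (σ k) k4 φ 0 t ht.1 (k5 t ht.2)).1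
    have e3 : dist (inner ℝ (L (h₀ (σ k))) (ι φ)) (inner ℝ a (ι φ)) < δ / 3 := k2
    rw [Real.dist_eq, abs_lt] at e1 e3
    rw [inner_sub_left, abs_le] at e2
    rw [hLi] at e3
    rw [Real.dist_eq, abs_lt, hLi]
    constructor <;> linarith [e1.1, e1.2, e2.1, e2.2, e3.1, e3.2]
  have hcl : ∀ y ∈ range ι, ∃ c : ℝ → ℝ, (∀ T : ℝ, TendstoUniformlyOn
      (fun k t => inner ℝ (L (S (σ k) t (h₀ (σ k)))) y) c atTop (Icc 0 T)) := by
    rintro _ ⟨φ, rfl⟩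
    exact ⟨_, hunif φ⟩
  choose! c hc using hcl
  obtain ⟨ρ, hρC, hρu, -⟩ := exists_uniform_weak_limit_of_dense
    (fun k t => L (S (σ k) t (h₀ (σ k)))) (fun k t ht => hLn _ (hcontr (σ k) t ht))
    dense_xTest c hc
  have hρφ : ∀ φ t, 0 ≤ t → inner ℝ (ρ t) (ι φ)
      = inner ℝ a (ι φ) + inner ℝ κ' (timeSlab 0 t (zQ φ)) := fun φ t ht =>
    tendsto_nhds_unique ((hρu (ι φ) t).tendsto_at ⟨ht, le_rfl⟩)
      ((hunif φ t).tendsto_at ⟨ht, le_rfl⟩)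
  refine ⟨σ, ρ, κ', hσ, ⟨_, hρC⟩, fun y T => ?_, fun φ t ht => ?_, fun φ w t ht => ?_⟩
  · simpa only [hLi] using hρu y T
  · have h0 : timeSlab 0 0 (zQ φ) = 0 := by
      rw [← norm_eq_zero, norm_timeSlab le_rfl le_rfl]; simp
    rw [hρφ φ t ht, hρφ φ 0 le_rfl, h0, inner_zero_right]
    ring
  · set χ := (h.memLp_adjGrad φ w).toLp _ with hχ
    set zR := (h.memLp_xMeasure (memLp_clm_smul_xTest hR.measR hR.locR φ w)).toLp _ with hzR
    -- The densities converge against the fixed `χ` at each time and are uniformly bounded, so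
    -- dominated convergence in `s` suffices; no strong compactness is involved.
    have l1 : Tendsto (fun k => ∫ s in (0 : ℝ)..t,
        inner ℝ (S (σ k) (max s 0) (h₀ (σ k))) (h.lift χ)) atTop
        (𝓝 (∫ s in (0 : ℝ)..t, inner ℝ (ρ (max s 0)) χ)) := by
      refine intervalIntegral.tendsto_integral_filter_of_dominated_convergence
        (fun _ => B * ‖h.lift χ‖) (Eventually.of_forall fun k => ?_)
        (Eventually.of_forall fun k => Eventually.of_forall fun s _ => ?_)
        intervalIntegrable_const (Eventually.of_forall fun s _ => ?_)
      · exact (((hS (σ k)).continuous_orbit _).inner continuous_const).aestronglyMeasurable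
      · refine (norm_inner_le_norm _ _).trans ?_
        gcongr
        exact hcontr _ _ (le_max_right _ _)
      · have := (hρu χ (max s 0)).tendsto_at ⟨le_max_right _ _, le_rfl⟩
        simpa only [hLi] using this
    have l2 : Tendsto (fun k => Real.sqrt (ε (σ k)) * D φ w) atTop (𝓝 0) := by
      simpa using hsq.mul_const (D φ w)
    have l3 : Tendsto (fun k => (∫ s in (0 : ℝ)..t,
        inner ℝ (S (σ k) (max s 0) (h₀ (σ k))) (h.lift χ))
        - inner ℝ (κ (σ k)) (timeSlab 0 t zR)) atTop (𝓝 0) := by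
      refine squeeze_zero_norm' ?_ l2
      filter_upwards [hle1, hT1 t] with k k1 k2
      exact (hκ (σ k) k1 φ w t ht (k2 t le_rfl)).2
    have := tendsto_nhds_unique l3 (l1.sub (hκlim _))
    linarith

end Admissible

end KineticFP

/-! ### Measurable representatives and countable families of test functions -/

namespace KineticFP

variable {n : ℕ}

/-- A function whose integrals over the intervals `(0, t]` all vanish is zero almost everywhere. -/
theorem ae_eq_zero_of_forall_integral_eq_zero {f : ℝ → ℝ}
    (hf : ∀ t, 0 ≤ t → IntervalIntegrable f volume 0 t)
    (h0 : ∀ t, 0 ≤ t → ∫ s in (0 : ℝ)..t, f s = 0) :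
    ∀ᵐ s ∂(volume.restrict (Ioi (0 : ℝ))), f s = 0 := by
  have key : ∀ N : ℕ, ∀ᵐ s : ℝ, s ∈ Ioo (0 : ℝ) N → f s = 0 := by
    intro N
    have hN : (0 : ℝ) ≤ N := N.cast_nonneg
    filter_upwards [(hf N hN).ae_hasDerivAt_integral] with s hs hsN
    rw [uIcc_of_le hN] at hs
    have h1 := hs ⟨hsN.1.le, hsN.2.le⟩ 0 ⟨le_rfl, hN⟩
    have h2 : HasDerivAt (fun x => ∫ t in (0 : ℝ)..x, f t) 0 s := by
      refine (hasDerivAt_const s (0 : ℝ)).congr_of_eventuallyEq ?_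
      filter_upwards [lt_mem_nhds hsN.1] with x hx
      exact h0 x hx.le
    exact h1.unique h2
  rw [ae_restrict_iff' measurableSet_Ioi]
  filter_upwards [ae_all_iff.mpr key] with s hs hs0
  obtain ⟨N, hN⟩ := exists_nat_gt s
  exact hs N ⟨hs0, hN⟩

/-- A weakly continuous function with values in `L²` has a jointly measurable representative. -/
theorem exists_stronglyMeasurable_representative (ρ : ℝ → Lp ℝ 2 (volume : Measure (E n)))
    (hρ : ∀ y, ContinuousOn (fun t => inner ℝ (ρ t) y) (Ici 0)) :
    ∃ r : ℝ → E n → ℝ, StronglyMeasurable (Function.uncurry r) ∧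
      ∀ t, 0 ≤ t → r t =ᵐ[volume] ρ t := by
  have hloc : ∀ t, LocallyIntegrable (ρ t) volume := fun t =>
    (Lp.memLp (ρ t)).locallyIntegrable one_le_two
  -- A mollified value is the pairing of `ρ t` with a fixed smooth function: continuous in `t` by
  -- weak continuity and smooth in `x`. So `F m` is jointly measurable, and its pointwise limit is a
  -- representative.
  set F : ℕ → ℝ → E n → ℝ := fun m t x => mollify m (ρ (max t 0)) x with hF
  have hmeas : ∀ m, StronglyMeasurable (Function.uncurry (F m)) := by
    intro m
    refine stronglyMeasurable_uncurry_of_continuous_of_stronglyMeasurable (fun x => ?_) fun t =>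
      (contDiff_mollify (hloc _) m (k := 0)).continuous.stronglyMeasurable
    have hc : HasCompactSupport fun y => moll n m (x - y) :=
      (hasCompactSupport_moll m).comp_homeomorph (Homeomorph.subLeft x)
    have hL : MemLp (fun y => moll n m (x - y)) 2 volume :=
      ((continuous_moll m).comp (continuous_const.sub continuous_id)).memLp_of_hasCompactSupport hc
    have e : (fun t => F m t x) = fun t => inner ℝ (ρ (max t 0)) (hL.toLp _) := by
      funext t
      rw [inner_toLp_right, hF]
      simp only [mollify_apply_swap]
      rfl
    rw [e]
    exact (hρ _).comp_continuous (by fun_prop) fun t => mem_Ici.mpr (le_max_right _ _)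
  refine ⟨fun t x => limUnder atTop fun m => F m t x,
    by simpa only [Function.uncurry_def] using
      StronglyMeasurable.limUnder (l := atTop) hmeas, fun t ht => ?_⟩
  filter_upwards [ae_tendsto_mollify (hloc t)] with x hx
  simp only [hF, max_eq_left ht]
  exact hx.limUnder_eq

/-- There is a countable set of test functions that is dense for the `C¹` norm, with control of
the supports. -/
theorem exists_countable_dense_xTest : ∃ c : Set (XTest n), c.Countable ∧ ∀ φ : XTest n,
    ∃ r : ℝ, (∀ x ∉ Metric.closedBall (0 : E n) r, φ.1 x = 0 ∧ gradient φ.1 x = 0) ∧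
      ∀ δ > 0, ∃ ψ ∈ c, (∀ x ∉ Metric.closedBall (0 : E n) r, ψ.1 x = 0 ∧ gradient ψ.1 x = 0) ∧
        ∀ x, ‖φ.1 x - ψ.1 x‖ ≤ δ ∧ ‖gradient φ.1 x - gradient ψ.1 x‖ ≤ δ := by
  set A : ℕ → Set (XTest n) := fun N =>
    {φ | ∀ x ∉ Metric.closedBall (0 : E n) N, φ.1 x = 0 ∧ gradient φ.1 x = 0} with hA
  -- A test function is recorded by its value and gradient on a ball. The space of continuous
  -- functions there is separable, hence so is the image of the functions supported in that ball.
  set F : ∀ N : ℕ, XTest n → C(Metric.closedBall (0 : E n) N, ℝ × E n) := fun N φ =>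
    ⟨fun x => (φ.1 x, gradient φ.1 x),
      (φ.continuous.comp continuous_subtype_val).prodMk
        (φ.continuous_gradient.comp continuous_subtype_val)⟩ with hF
  have : Nonempty (XTest n) := ⟨⟨0, contDiff_const, HasCompactSupport.zero⟩⟩
  have hsep : ∀ N, ∃ c : Set (XTest n), c.Countable ∧ c ⊆ A N ∧ F N '' A N ⊆ closure (F N '' c) := by
    intro N
    obtain ⟨t, hts, htc, hd⟩ :=
      (TopologicalSpace.IsSeparable.of_separableSpace (F N '' A N)).exists_countable_dense_subset
    have hts' : ∀ y ∈ t, ∃ φ, φ ∈ A N ∧ F N φ = y := hts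
    choose! g hg using hts'
    refine ⟨g '' t, htc.image _, ?_, hd.trans (closure_mono fun y hy => ?_)⟩
    · rintro _ ⟨y, hy, rfl⟩
      exact (hg y hy).1
    · exact ⟨g y, mem_image_of_mem _ hy, (hg y hy).2⟩
  choose c hcc hcA hcd using hsep
  refine ⟨⋃ N, c N, countable_iUnion hcc, fun φ => ?_⟩
  obtain ⟨C, K, hK, -, h0⟩ := φ.exists_bound
  obtain ⟨r, hr⟩ := hK.isBounded.subset_closedBall (0 : E n)
  obtain ⟨N, hN⟩ := exists_nat_ge r
  have hφA : φ ∈ A N := fun x hx => by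
    have hxK : x ∉ K := fun h => hx (Metric.closedBall_subset_closedBall hN (hr h))
    exact ⟨(h0 x hxK).1, by simp [gradient, (h0 x hxK).2]⟩
  refine ⟨N, hφA, fun δ hδ => ?_⟩
  obtain ⟨_, ⟨ψ, hψ, rfl⟩, hdist⟩ := Metric.mem_closure_iff.mp
    (hcd N (mem_image_of_mem _ hφA)) δ hδ
  refine ⟨ψ, mem_iUnion.mpr ⟨N, hψ⟩, hcA N hψ, fun x => ?_⟩
  by_cases hx : x ∈ Metric.closedBall (0 : E n) N
  · have h1 := (ContinuousMap.dist_apply_le_dist (f := F N φ) (g := F N ψ) ⟨x, hx⟩).trans hdist.le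
    rw [Prod.dist_eq, dist_eq_norm, dist_eq_norm] at h1
    exact ⟨(le_max_left _ _).trans h1, (le_max_right _ _).trans h1⟩
  · rw [(hφA x hx).1, (hφA x hx).2, (hcA N hψ x hx).1, (hcA N hψ x hx).2]
    simp [hδ.le]

/-- The weak gradient can be tested on a suitable countable set of test functions. -/
theorem exists_countable_isWeakGrad : ∃ c : Set (XTest n), c.Countable ∧
    ∀ (u : E n → ℝ) (g : E n → E n), LocallyIntegrable u volume → LocallyIntegrable g volume →
      (∀ φ ∈ c, ∀ i, ∫ x, u x * fderiv ℝ φ.1 x (EuclideanSpace.basisFun (Fin n) ℝ i)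
        = -∫ x, inner ℝ (g x) (EuclideanSpace.basisFun (Fin n) ℝ i) * φ.1 x) →
      IsWeakGrad u g := by
  obtain ⟨c, hc, hdense⟩ := exists_countable_dense_xTest (n := n)
  refine ⟨c, hc, fun u g hu hg htest => ?_⟩
  have i1 : ∀ φ : XTest n, Integrable (fun x => u x • gradient φ.1 x) volume := fun φ =>
    hu.integrable_smul_right_of_hasCompactSupport φ.continuous_gradient
      ((φ.2.2.fderiv ℝ).comp_left (map_zero _))
  have i2 : ∀ φ : XTest n, Integrable (fun x => φ.1 x • g x) volume := fun φ =>
    hg.integrable_smul_left_of_hasCompactSupport φ.continuous φ.2.2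
  -- `Λ φ` is the defect in the weak gradient identity. It is linear in `φ` and continuous for the
  -- `C¹` norm among functions supported in a fixed ball, so it vanishes everywhere once it vanishes
  -- on `c`.
  set Λ : XTest n → E n := fun φ => (∫ x, u x • gradient φ.1 x) + ∫ x, φ.1 x • g x with hΛ
  have hinn : ∀ φ w, inner ℝ w (Λ φ)
      = (∫ x, u x * fderiv ℝ φ.1 x w) + ∫ x, inner ℝ (g x) w * φ.1 x := by
    intro φ w
    rw [hΛ, inner_add_right, ← integral_inner (i1 φ), ← integral_inner (i2 φ)]
    congr 1 <;> refine integral_congr_ae (Eventually.of_forall fun x => ?_) <;>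
      simp only [inner_smul_right]
    · rw [real_inner_comm, φ.inner_gradient]
    · rw [real_inner_comm, mul_comm]
  have hzero : ∀ φ ∈ c, Λ φ = 0 := by
    intro φ hφ
    rw [← (EuclideanSpace.basisFun (Fin n) ℝ).sum_repr' (Λ φ)]
    refine Finset.sum_eq_zero fun i _ => ?_
    rw [hinn, htest φ hφ i, neg_add_cancel, zero_smul]
  have hall : ∀ φ, Λ φ = 0 := by
    intro φ
    obtain ⟨r, hφr, happ⟩ := hdense φ
    have hur := (hu.integrableOn_isCompact (isCompact_closedBall (0 : E n) r)).norm
    have hgr := (hg.integrableOn_isCompact (isCompact_closedBall (0 : E n) r)).norm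
    set M := (∫ x in Metric.closedBall (0 : E n) r, ‖u x‖)
      + ∫ x in Metric.closedBall (0 : E n) r, ‖g x‖ with hM
    have hM0 : 0 ≤ M := by positivity
    have hbound : ∀ δ > 0, ‖Λ φ‖ ≤ M * δ := by
      intro δ hδ
      obtain ⟨ψ, hψc, hψr, hd⟩ := happ δ hδ
      have e : Λ φ = (∫ x in Metric.closedBall (0 : E n) r,
            u x • (gradient φ.1 x - gradient ψ.1 x))
          + ∫ x in Metric.closedBall (0 : E n) r, (φ.1 x - ψ.1 x) • g x := by
        have e0 : Λ φ = Λ φ - Λ ψ := by rw [hzero ψ hψc, sub_zero]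
        rw [e0, setIntegral_eq_integral_of_forall_compl_eq_zero
          fun x hx => by rw [(hφr x hx).2, (hψr x hx).2, sub_zero, smul_zero],
          setIntegral_eq_integral_of_forall_compl_eq_zero
          fun x hx => by rw [(hφr x hx).1, (hψr x hx).1, sub_zero, zero_smul]]
        simp_rw [smul_sub, sub_smul]
        rw [integral_sub (i1 φ) (i1 ψ), integral_sub (i2 φ) (i2 ψ)]
        simp only [hΛ]
        abel
      rw [e, hM, add_mul]
      refine (norm_add_le _ _).trans (add_le_add ?_ ?_)
      · rw [← integral_mul_const]
        refine norm_integral_le_of_norm_le (hur.mul_const _) (Eventually.of_forall fun x => ?_)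
        rw [norm_smul]
        gcongr
        exact (hd x).2
      · rw [← integral_mul_const]
        refine norm_integral_le_of_norm_le (hgr.mul_const _) (Eventually.of_forall fun x => ?_)
        rw [norm_smul, mul_comm]
        gcongr
        exact (hd x).1
    rw [← norm_le_zero_iff]
    refine le_of_forall_pos_le_add fun η hη => ?_
    refine (hbound (η / (M + 1)) (by positivity)).trans ?_
    rw [zero_add, ← mul_div_assoc, div_le_iff₀ (by positivity)]
    nlinarith
  refine ⟨hu, hg, fun φ hφ hφc w => ?_⟩
  have := hinn ⟨φ, hφ, hφc⟩ w
  rw [hall, inner_zero_right] at this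
  linarith

namespace Admissible

variable {V : E n → ℝ} {gradV : E n → E n} {G : E n → Matrix (Fin n) (Fin n) ℝ}

/-- The velocity average of an element of `L²_{M_eq}`. -/
theorem ae_integrable_and_integral_eq (h : Admissible V gradV G) {u : L2eq V} {f : E n × E n → ℝ}
    (hf : (fun p => f p / equilibrium V p) =ᵐ[eqMeasure V] u) :
    (∀ᵐ x, Integrable (fun v => f (x, v)) volume) ∧
      (fun x => ∫ v, f (x, v)) =ᵐ[volume] ContinuousLinearMap.adjoint h.lift u := by
  have hfu : f =ᵐ[volume] fun p => equilibrium V p * u p := by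
    filter_upwards [h.ac_eqMeasure.ae_le hf] with p hp
    rw [← hp, mul_div_cancel₀ _ (h.equilibrium_pos p).ne']
  have hfi : Integrable f (volume.prod volume) :=
    (h.integrable_eqMeasure_iff.mp (h.integrable_coe u)).congr hfu.symm
  refine ⟨hfi.prod_right_ae, ?_⟩
  refine ae_eq_of_integral_contDiff_smul_eq hfi.integral_prod_left.locallyIntegrable
    ((Lp.memLp _).locallyIntegrable one_le_two) fun φ hφ hc => ?_
  set φ' : XTest n := ⟨φ, hφ, hc⟩
  have h1 : inner ℝ (ContinuousLinearMap.adjoint h.lift u) ((memLp_xTest φ').toLp _)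
      = inner ℝ u (h.lift ((memLp_xTest φ').toLp _)) := ContinuousLinearMap.adjoint_inner_left _ _ _
  rw [inner_toLp_right, h.lift_toLp, inner_toLp_right, h.integral_eqMeasure] at h1
  obtain ⟨C, hC⟩ := hc.exists_bound_of_continuous hφ.continuous
  have h2 : Integrable (fun p : E n × E n => φ p.1 * f p) (volume.prod volume) :=
    hfi.bdd_mul (hφ.continuous.comp continuous_fst).aestronglyMeasurable
      (Eventually.of_forall fun p => hC p.1)
  have h3 : ∫ p : E n × E n, φ p.1 * f p = ∫ x, φ x • ∫ v, f (x, v) := by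
    rw [Measure.volume_eq_prod, integral_prod _ h2]
    simp only [integral_const_mul, smul_eq_mul]
  rw [← h3]
  calc ∫ p : E n × E n, φ p.1 * f p
      = ∫ p, equilibrium V p • inner ℝ (u p) (φ'.1 p.1) := by
        refine integral_congr_ae ?_
        filter_upwards [hfu] with p hp
        rw [hp]
        simp only [smul_eq_mul, RCLike.inner_apply, conj_trivial, φ']
        ring
    _ = _ := by
        rw [← h1]
        refine integral_congr_ae (Eventually.of_forall fun x => ?_)
        simp [φ']

end Admissible

end KineticFP

/-! ### Identification of the limit equation -/

namespace KineticFP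

variable {n : ℕ}

/-- Fubini turns the space-time pairing into a time integral up to `t`; differentiating in `t` then
localizes the limit relations at almost every time. -/
theorem intervalIntegrable_and_inner_timeSlab {Y F : Type*} [MeasurableSpace Y] {ν : Measure Y}
    [SFinite ν] [NormedAddCommGroup F] [InnerProductSpace ℝ F] (κ : Lp F 2 (timeProd ν))
    {z : Y → F} (hz : MemLp z 2 ν) {t : ℝ} (ht : 0 ≤ t) :
    IntervalIntegrable (fun s => ∫ x, inner ℝ (κ (s, x)) (z x) ∂ν) volume 0 t ∧
      inner ℝ κ (timeSlab 0 t (hz.toLp z))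
        = ∫ s in (0 : ℝ)..t, ∫ x, inner ℝ (κ (s, x)) (z x) ∂ν := by
  set m : ℝ → ℝ := fun s => ∫ x, inner ℝ (κ (s, x)) (z x) ∂ν with hm
  have hi := integrable_inner_of_memLp (Lp.memLp κ) (memLp_indicator_Ioc 0 t (hz.toLp z))
  have hin : ∀ s, ∫ x, inner ℝ (κ (s, x))
      ((Ioc 0 t).indicator (fun _ => (1 : ℝ)) s • (hz.toLp z) x) ∂ν = (Ioc 0 t).indicator m s := by
    intro s
    simp_rw [inner_smul_right]
    rw [integral_const_mul]
    have e : ∫ x, inner ℝ (κ (s, x)) ((hz.toLp z) x) ∂ν = m s := by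
      refine integral_congr_ae ?_
      filter_upwards [hz.coeFn_toLp] with x hx
      rw [hx]
    rw [e]
    by_cases hs : s ∈ Ioc 0 t <;> simp [hs, -mem_Ioc]
  have hsub : Ioc 0 t ⊆ Ioi 0 := fun s hs => hs.1
  constructor
  · rw [intervalIntegrable_iff_integrableOn_Ioc_of_le ht]
    have h1 := hi.integral_prod_left
    simp only [hin] at h1
    have h2 := (integrable_indicator_iff measurableSet_Ioc).mp h1
    rwa [IntegrableOn, Measure.restrict_restrict measurableSet_Ioc, inter_eq_left.mpr hsub] at h2
  · rw [timeSlab, inner_toLp_right, integral_prod _ hi]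
    simp only [hin]
    rw [integral_indicator measurableSet_Ioc, Measure.restrict_restrict measurableSet_Ioc,
      inter_eq_left.mpr hsub, intervalIntegral.integral_of_le ht]

theorem volume_restrict_prod (s : Set ℝ) (K : Set (E n)) :
    (volume : Measure (ℝ × E n)).restrict (s ×ˢ K)
      = (volume.restrict s).prod (volume.restrict K) := by
  rw [Measure.prod_restrict, Measure.volume_eq_prod]

/-- Countably many boxes exhaust the half-space, so a single null set of times serves all compact
sets. -/
theorem ae_locallyIntegrable_of_integrableOn_prod {F : ℝ → E n → E n}
    (hF : ∀ (T : ℝ) (K : Set (E n)), 0 < T → IsCompact K →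
      IntegrableOn (Function.uncurry F) (Ioc 0 T ×ˢ K) volume) :
    ∀ᵐ s ∂(volume.restrict (Ioi (0 : ℝ))), LocallyIntegrable (F s) volume := by
  have key : ∀ N : ℕ, ∀ᵐ s : ℝ, s ∈ Ioc (0 : ℝ) (N + 1) →
      IntegrableOn (F s) (Metric.closedBall 0 N) volume := by
    intro N
    have h1 := hF (N + 1) (Metric.closedBall 0 N) (by positivity) (isCompact_closedBall _ _)
    rw [IntegrableOn, volume_restrict_prod] at h1
    exact (ae_restrict_iff' measurableSet_Ioc).mp h1.prod_right_ae
  rw [ae_restrict_iff' measurableSet_Ioi]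
  filter_upwards [ae_all_iff.mpr key] with s hs hs0
  rw [locallyIntegrable_iff]
  intro K hK
  obtain ⟨r, hr⟩ := hK.isBounded.subset_closedBall (0 : E n)
  obtain ⟨N, hN⟩ := exists_nat_ge (max r s)
  exact (hs N ⟨hs0, by linarith [(le_max_right r s).trans hN]⟩).mono_set
    (hr.trans (Metric.closedBall_subset_closedBall ((le_max_left r s).trans hN)))

theorem integrableOn_comp_snd {F : Type*} [NormedAddCommGroup F] {b : E n → F}
    (hb : LocallyIntegrable b volume) (T : ℝ) {K : Set (E n)} (hK : IsCompact K) :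
    IntegrableOn (fun q : ℝ × E n => b q.2) (Ioc 0 T ×ˢ K) volume := by
  rw [IntegrableOn, volume_restrict_prod]
  exact (hb.integrableOn_isCompact hK).comp_snd _

theorem aestronglyMeasurable_comp_snd {F : Type*} [TopologicalSpace F]
    {b : E n → F} (hb : AEStronglyMeasurable b volume) :
    AEStronglyMeasurable (fun q : ℝ × E n => b q.2) volume :=
  hb.comp_quasiMeasurePreserving Measure.quasiMeasurePreserving_snd

theorem integrableOn_sq_of_norm_le {ρ : ℝ → Lp ℝ 2 (volume : Measure (E n))} {C : ℝ}
    (hC : ∀ t, 0 ≤ t → ‖ρ t‖ ≤ C) {r : ℝ → E n → ℝ} (hr : StronglyMeasurable (Function.uncurry r))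
    (hrρ : ∀ t, 0 ≤ t → r t =ᵐ[volume] ρ t) (T : ℝ) (K : Set (E n)) :
    IntegrableOn (fun q : ℝ × E n => r q.1 q.2 ^ 2) (Ioc 0 T ×ˢ K) volume := by
  have hsm : StronglyMeasurable fun q : ℝ × E n => r q.1 q.2 ^ 2 := hr.pow 2
  suffices h : Integrable (fun q : ℝ × E n => r q.1 q.2 ^ 2)
      ((volume.restrict (Ioc 0 T)).prod volume) by
    have h2 : IntegrableOn (fun q : ℝ × E n => r q.1 q.2 ^ 2) (Ioc 0 T ×ˢ univ) volume := by
      rwa [IntegrableOn, volume_restrict_prod, Measure.restrict_univ]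
    exact h2.mono_set (prod_mono_right (subset_univ _))
  have hsl : ∀ t, 0 ≤ t → Integrable (fun x => r t x ^ 2) volume ∧ ∫ x, r t x ^ 2 ≤ C ^ 2 := by
    intro t ht
    have h1 := integrable_inner_of_memLp (Lp.memLp (ρ t)) (Lp.memLp (ρ t))
    have e : (fun x => r t x ^ 2) =ᵐ[volume] fun x => inner ℝ (ρ t x) (ρ t x) := by
      filter_upwards [hrρ t ht] with x hx
      rw [hx]; simp [sq]
    refine ⟨h1.congr e.symm, ?_⟩
    rw [integral_congr_ae e, ← L2.inner_def, real_inner_self_eq_norm_sq]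
    gcongr
    exact hC t ht
  rw [integrable_prod_iff hsm.aestronglyMeasurable]
  constructor
  · refine (ae_restrict_iff' measurableSet_Ioc).mpr (Eventually.of_forall fun t ht => ?_)
    exact (hsl t ht.1.le).1
  · refine Integrable.mono' (g := fun _ => C ^ 2) (integrable_const _)
      (hsm.norm.integral_prod_right).aestronglyMeasurable
      ((ae_restrict_iff' measurableSet_Ioc).mpr (Eventually.of_forall fun t ht => ?_))
    have e : ∀ x, ‖r t x ^ 2‖ = r t x ^ 2 := fun x => Real.norm_of_nonneg (sq_nonneg _)
    simp only [e]
    rw [Real.norm_of_nonneg (integral_nonneg fun x => sq_nonneg _)]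
    exact (hsl t ht.1.le).2

namespace Admissible

variable {V : E n → ℝ} {gradV : E n → E n} {G : E n → Matrix (Fin n) (Fin n) ℝ}

theorem integrableOn_smul_gradV (h : Admissible V gradV G) {r : ℝ → E n → ℝ}
    (hr : StronglyMeasurable (Function.uncurry r)) {T : ℝ} {K : Set (E n)} (hK : IsCompact K)
    (hr2 : IntegrableOn (fun q : ℝ × E n => r q.1 q.2 ^ 2) (Ioc 0 T ×ˢ K) volume) :
    IntegrableOn (fun q : ℝ × E n => r q.1 q.2 • gradV q.2) (Ioc 0 T ×ˢ K) volume := by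
  refine Integrable.mono' (hr2.add (integrableOn_comp_snd h.gradSq T hK))
    (hr.aestronglyMeasurable.smul
      (aestronglyMeasurable_comp_snd h.weakGrad.2.1.aestronglyMeasurable)).restrict
    (Eventually.of_forall fun q => ?_)
  rw [norm_smul, Pi.add_apply, Real.norm_eq_abs, ← sq_abs]
  nlinarith [sq_nonneg (|r q.1 q.2| - ‖gradV q.2‖), sq_nonneg (|r q.1 q.2|), sq_nonneg ‖gradV q.2‖]

theorem integrableOn_xWeight_mul_sq (h : Admissible V gradV G)
    (κ : Lp (E n) 2 (timeProd (xMeasure V))) (T : ℝ) (K : Set (E n)) :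
    IntegrableOn (fun q : ℝ × E n => xWeight V q.2 * ‖κ q‖ ^ 2) (Ioc 0 T ×ˢ K) volume := by
  have h1 : Integrable (fun q => ‖κ q‖ ^ 2) ((volume.restrict (Ioi (0 : ℝ))).prod
      ((volume : Measure (E n)).withDensity fun x => ENNReal.ofReal (xWeight V x))) :=
    (memLp_two_iff_integrable_sq_norm (Lp.memLp κ).1).mp (Lp.memLp κ)
  have hw : AEMeasurable (fun q : ℝ × E n => ENNReal.ofReal (xWeight V q.2))
      ((volume.restrict (Ioi (0 : ℝ))).prod volume) :=
    (h.aemeasurable_xWeight.comp_quasiMeasurePreserving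
      Measure.quasiMeasurePreserving_snd).ennreal_ofReal
  rw [prod_withDensity_right₀ h.aemeasurable_xWeight.ennreal_ofReal,
    integrable_withDensity_iff_integrable_smul₀' hw
      (Eventually.of_forall fun _ => ENNReal.ofReal_lt_top)] at h1
  have h2 : IntegrableOn (fun q : ℝ × E n => xWeight V q.2 * ‖κ q‖ ^ 2) (Ioi 0 ×ˢ univ) volume := by
    rw [IntegrableOn, volume_restrict_prod, Measure.restrict_univ]
    refine h1.congr (Eventually.of_forall fun q => ?_)
    simp only
    rw [ENNReal.toReal_ofReal (h.xWeight_pos _).le, smul_eq_mul]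
  exact h2.mono_set (prod_mono (fun s hs => hs.1) (subset_univ _))

/-- `‖B κ‖ ≤ ‖B‖² + ‖κ‖²`. The weight is bounded, which handles the first term; the second is
integrable because `κ` is square integrable for the weighted measure. -/
theorem integrableOn_xWeight_smul_clm (h : Admissible V gradV G) {B : E n → E n →L[ℝ] E n}
    (hB : AEStronglyMeasurable B volume) (hBl : LocallyIntegrable (fun x => ‖B x‖ ^ 2) volume)
    (κ : Lp (E n) 2 (timeProd (xMeasure V))) (T : ℝ) {K : Set (E n)} (hK : IsCompact K) :
    IntegrableOn (fun q : ℝ × E n => xWeight V q.2 • B q.2 (κ q)) (Ioc 0 T ×ˢ K) volume := by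
  obtain ⟨W, hW, hle⟩ := h.exists_xWeight_le
  refine Integrable.mono' (((integrableOn_comp_snd hBl T hK).const_mul W).add
    (h.integrableOn_xWeight_mul_sq κ T K)) (AEStronglyMeasurable.restrict ?_)
    (ae_restrict_of_ae ?_)
  · exact (aestronglyMeasurable_comp_snd h.aemeasurable_xWeight.aestronglyMeasurable).smul
      (isBoundedBilinearMap_apply.continuous.comp_aestronglyMeasurable
        ((aestronglyMeasurable_comp_snd hB).prodMk
          (Lp.stronglyMeasurable κ).aestronglyMeasurable))
  · have : ∀ᵐ q : ℝ × E n, xWeight V q.2 ≤ W := Measure.quasiMeasurePreserving_snd.ae hle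
    filter_upwards [this] with q hq
    have hw := h.xWeight_pos q.2
    rw [norm_smul, Real.norm_of_nonneg hw.le, Pi.add_apply]
    have h1 : ‖B q.2 (κ q)‖ ≤ ‖B q.2‖ ^ 2 + ‖κ q‖ ^ 2 := by
      refine ((B q.2).le_opNorm _).trans ?_
      nlinarith [sq_nonneg (‖B q.2‖ - ‖κ q‖), sq_nonneg ‖B q.2‖, sq_nonneg ‖κ q‖]
    calc xWeight V q.2 * ‖B q.2 (κ q)‖ ≤ xWeight V q.2 * (‖B q.2‖ ^ 2 + ‖κ q‖ ^ 2) := by gcongr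
      _ = xWeight V q.2 * ‖B q.2‖ ^ 2 + xWeight V q.2 * ‖κ q‖ ^ 2 := by ring
      _ ≤ _ := by gcongr

/-- The gradient of the limit density, in terms of the limit flux. -/
def limitGrad (V : E n → ℝ) (gradV : E n → E n) (R : E n → E n →L[ℝ] E n) (r : ℝ → E n → ℝ)
    (κ : ℝ × E n → E n) (s : ℝ) (x : E n) : E n :=
  -(r s x • gradV x + xWeight V x • R x (κ (s, x)))

/-- For each fixed test function the time-integrated relation forces an identity at almost every
time. The exceptional set depends on the test function, so only a countable determining family and
the finitely many basis directions are used. -/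
theorem ae_isWeakGrad_limitGrad (h : Admissible V gradV G) {R Q : E n → E n →L[ℝ] E n}
    (hR : IsSqrtField G R Q) {ρ : ℝ → Lp ℝ 2 (volume : Measure (E n))}
    (hρc : ∀ y, ContinuousOn (fun t => inner ℝ (ρ t) y) (Ici 0))
    {κ : Lp (E n) 2 (timeProd (xMeasure V))}
    (hκ : ∀ (φ : XTest n) (w : E n) (t : ℝ), 0 ≤ t →
      ∫ s in (0 : ℝ)..t, inner ℝ (ρ (max s 0)) ((h.memLp_adjGrad φ w).toLp _)
        = inner ℝ κ (timeSlab 0 t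
          ((h.memLp_xMeasure (memLp_clm_smul_xTest hR.measR hR.locR φ w)).toLp _)))
    {r : ℝ → E n → ℝ} (hrρ : ∀ t, 0 ≤ t → r t =ᵐ[volume] ρ t)
    (hD : ∀ᵐ s ∂(volume.restrict (Ioi (0 : ℝ))),
      LocallyIntegrable (limitGrad V gradV R r κ s) volume)
    (hRκ : ∀ᵐ s ∂(volume.restrict (Ioi (0 : ℝ))),
      LocallyIntegrable (fun x => xWeight V x • R x (κ (s, x))) volume) :
    ∀ᵐ s ∂(volume.restrict (Ioi (0 : ℝ))), IsWeakGrad (r s) (limitGrad V gradV R r κ s) := by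
  have hfin := h.isFiniteMeasure_xMeasure
  obtain ⟨c, hc, hcw⟩ := exists_countable_isWeakGrad (n := n)
  set e := EuclideanSpace.basisFun (Fin n) ℝ with he
  have hslice : ∀ (φ : XTest n) (w : E n), ∀ᵐ s ∂(volume.restrict (Ioi (0 : ℝ))),
      inner ℝ (ρ (max s 0)) ((h.memLp_adjGrad φ w).toLp _)
        - ∫ x, inner ℝ (κ (s, x)) (R x (φ.1 x • w)) ∂(xMeasure V) = 0 := by
    intro φ w
    have hz := h.memLp_xMeasure (memLp_clm_smul_xTest hR.measR hR.locR φ w)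
    have hcont : Continuous fun s => inner ℝ (ρ (max s 0)) ((h.memLp_adjGrad φ w).toLp _) :=
      (hρc _).comp_continuous (by fun_prop) fun t => mem_Ici.mpr (le_max_right _ _)
    refine ae_eq_zero_of_forall_integral_eq_zero (fun t ht => ?_) fun t ht => ?_
    · exact (hcont.intervalIntegrable _ _).sub (intervalIntegrable_and_inner_timeSlab κ hz ht).1
    · rw [intervalIntegral.integral_sub (hcont.intervalIntegrable _ _)
        (intervalIntegrable_and_inner_timeSlab κ hz ht).1,
        ← (intervalIntegrable_and_inner_timeSlab κ hz ht).2, hκ φ w t ht, sub_self]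
  have hall : ∀ᵐ s ∂(volume.restrict (Ioi (0 : ℝ))), ∀ φ ∈ c, ∀ i,
      inner ℝ (ρ (max s 0)) ((h.memLp_adjGrad φ (e i)).toLp _)
        - ∫ x, inner ℝ (κ (s, x)) (R x (φ.1 x • e i)) ∂(xMeasure V) = 0 :=
    (ae_ball_iff hc).mpr fun φ _ => ae_all_iff.mpr fun i => hslice φ (e i)
  filter_upwards [hall, hD, hRκ, ae_restrict_mem measurableSet_Ioi] with s hs hsD hsR hs0
  have hs0' : 0 ≤ s := (mem_Ioi.mp hs0).le
  have hr2 : MemLp (r s) 2 volume := (Lp.memLp (ρ s)).ae_eq (hrρ s hs0').symm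
  refine hcw _ _ (hr2.locallyIntegrable one_le_two) hsD fun φ hφ i => ?_
  have h1 := hs φ hφ i
  rw [max_eq_left hs0', inner_toLp_right, h.integral_xMeasure] at h1
  have j1 : Integrable (fun x => r s x * fderiv ℝ φ.1 x (e i)) volume :=
    hr2.integrable_mul (memLp_xTest (φ.deriv (e i)))
  have j2 : Integrable (fun x => r s x * adjGrad gradV φ (e i) x) volume :=
    hr2.integrable_mul (h.memLp_adjGrad φ (e i))
  have j3 : Integrable (fun x => φ.1 x • (xWeight V x • R x (κ (s, x)))) volume :=
    hsR.integrable_smul_left_of_hasCompactSupport φ.continuous φ.2.2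
  have j4 : Integrable (fun x => inner ℝ (φ.1 x • (xWeight V x • R x (κ (s, x)))) (e i)) volume :=
    j3.inner_const _
  have e1 : ∫ x, inner ℝ (ρ s x) (adjGrad gradV φ (e i) x)
      = ∫ x, r s x * adjGrad gradV φ (e i) x := by
    refine integral_congr_ae ?_
    filter_upwards [hrρ s hs0'] with x hx
    rw [hx, RCLike.inner_apply, conj_trivial, mul_comm]
  have e2 : ∫ x, xWeight V x • inner ℝ (κ (s, x)) (R x (φ.1 x • e i))
      = ∫ x, inner ℝ (φ.1 x • (xWeight V x • R x (κ (s, x)))) (e i) := by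
    refine integral_congr_ae ?_
    filter_upwards [hR.symmR] with x hx
    rw [← hx]
    simp only [inner_smul_left, inner_smul_right, conj_trivial, smul_eq_mul]
    ring
  have e3 : ∀ x, inner ℝ (limitGrad V gradV R r κ s x) (e i) * φ.1 x
      = (r s x * adjGrad gradV φ (e i) x - r s x * fderiv ℝ φ.1 x (e i))
        - inner ℝ (φ.1 x • (xWeight V x • R x (κ (s, x)))) (e i) := by
    intro x
    simp only [limitGrad, adjGrad, inner_neg_left, inner_add_left, inner_smul_left, conj_trivial]
    ring
  simp_rw [e3]
  have j5 : Integrable (fun x => r s x * adjGrad gradV φ (e i) x - r s x * fderiv ℝ φ.1 x (e i))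
      volume := j2.sub j1
  rw [integral_sub j5 j4, integral_sub j2 j1, ← e2, ← e1]
  linarith

/-- The limit density solves the Smoluchowski equation. -/
theorem isSmoluchowskiSolution_of_limit (h : Admissible V gradV G) {R Q : E n → E n →L[ℝ] E n}
    (hR : IsSqrtField G R Q) {ρ : ℝ → Lp ℝ 2 (volume : Measure (E n))} {C : ℝ}
    (hC : ∀ t, 0 ≤ t → ‖ρ t‖ ≤ C)
    (hρc : ∀ y, ContinuousOn (fun t => inner ℝ (ρ t) y) (Ici 0))
    {κ : Lp (E n) 2 (timeProd (xMeasure V))}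
    (hκQ : ∀ (φ : XTest n) (t : ℝ), 0 ≤ t →
      inner ℝ (ρ t) ((memLp_xTest φ).toLp _) - inner ℝ (ρ 0) ((memLp_xTest φ).toLp _)
        = inner ℝ κ (timeSlab 0 t
          ((h.memLp_xMeasure (memLp_clm_gradient_xTest hR.measQ hR.locQ φ)).toLp _)))
    (hκ : ∀ (φ : XTest n) (w : E n) (t : ℝ), 0 ≤ t →
      ∫ s in (0 : ℝ)..t, inner ℝ (ρ (max s 0)) ((h.memLp_adjGrad φ w).toLp _)
        = inner ℝ κ (timeSlab 0 t
          ((h.memLp_xMeasure (memLp_clm_smul_xTest hR.measR hR.locR φ w)).toLp _)))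
    {r : ℝ → E n → ℝ} (hr : StronglyMeasurable (Function.uncurry r))
    (hrρ : ∀ t, 0 ≤ t → r t =ᵐ[volume] ρ t) : IsSmoluchowskiSolution gradV G r := by
  have hfin := h.isFiniteMeasure_xMeasure
  have hRi : ∀ (T : ℝ) (K : Set (E n)), 0 < T → IsCompact K → IntegrableOn
      (Function.uncurry fun s x => xWeight V x • R x (κ (s, x))) (Ioc 0 T ×ˢ K) volume :=
    fun T K _ hK => h.integrableOn_xWeight_smul_clm hR.measR hR.locR κ T hK
  have hDi : ∀ (T : ℝ) (K : Set (E n)), 0 < T → IsCompact K → IntegrableOn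
      (Function.uncurry (limitGrad V gradV R r κ)) (Ioc 0 T ×ˢ K) volume := fun T K hT hK =>
    ((h.integrableOn_smul_gradV hr hK (integrableOn_sq_of_norm_le hC hr hrρ T K)).add
      (hRi T K hT hK)).neg
  -- The bracket is `-xWeight · Rκ` by construction, and `G⁻¹R = QQR = Q`. This matches the flux in
  -- the first moment relation.
  have hflux : ∀ᵐ x, ∀ s, matVec (G x)⁻¹ (limitGrad V gradV R r κ s x + r s x • gradV x)
      = -(xWeight V x • Q x (κ (s, x))) := by
    filter_upwards [hR.QQ, hR.QR] with x h1 h2 s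
    have e : limitGrad V gradV R r κ s x + r s x • gradV x
        = (-xWeight V x) • R x (κ (s, x)) := by
      simp only [limitGrad]; module
    rw [e, matVec_smul, ← h1, h2, neg_smul]
  refine ⟨hr.aestronglyMeasurable, limitGrad V gradV R r κ,
    h.ae_isWeakGrad_limitGrad hR hρc hκ hrρ (ae_locallyIntegrable_of_integrableOn_prod hDi)
      (ae_locallyIntegrable_of_integrableOn_prod hRi),
    fun T K hT hK => ⟨hDi T K hT hK, ?_⟩, fun t₁ t₂ φ ht₁ ht₁₂ hφ hφc => ?_⟩
  · refine ((h.integrableOn_xWeight_smul_clm hR.measQ hR.locQ κ T hK).neg).congr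
      (ae_restrict_of_ae ?_)
    have : ∀ᵐ q : ℝ × E n, ∀ s, matVec (G q.2)⁻¹
        (limitGrad V gradV R r κ s q.2 + r s q.2 • gradV q.2)
          = -(xWeight V q.2 • Q q.2 (κ (s, q.2))) := Measure.quasiMeasurePreserving_snd.ae hflux
    filter_upwards [this] with q hq
    exact (hq q.1).symm
  · set φ' : XTest n := ⟨φ, hφ, hφc⟩
    have hz := h.memLp_xMeasure (memLp_clm_gradient_xTest hR.measQ hR.locQ φ')
    have ht₂ : 0 ≤ t₂ := ht₁.trans ht₁₂
    have e1 : ∀ t, 0 ≤ t → ∫ x, φ x * r t x = inner ℝ (ρ t) ((memLp_xTest φ').toLp _) := by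
      intro t ht
      rw [inner_toLp_right]
      refine integral_congr_ae ?_
      filter_upwards [hrρ t ht] with x hx
      rw [hx, RCLike.inner_apply, conj_trivial]
    have e2 : ∀ s, ∫ x, fderiv ℝ φ x
        (matVec (G x)⁻¹ (limitGrad V gradV R r κ s x + r s x • gradV x))
        = -∫ x, inner ℝ (κ (s, x)) (Q x (gradient φ'.1 x)) ∂(xMeasure V) := by
      intro s
      rw [h.integral_xMeasure, ← integral_neg]
      refine integral_congr_ae ?_
      filter_upwards [hflux, hR.symmQ] with x h1 h2
      rw [h1 s, map_neg, map_smul, ← h2, real_inner_comm, φ'.inner_gradient]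
    have f1 := intervalIntegrable_and_inner_timeSlab κ hz ht₁
    have f2 := intervalIntegrable_and_inner_timeSlab κ hz ht₂
    have f3 := hκQ φ' t₁ ht₁
    have f4 := hκQ φ' t₂ ht₂
    rw [f1.2] at f3
    rw [f2.2] at f4
    rw [e1 t₁ ht₁, e1 t₂ ht₂]
    simp_rw [e2]
    rw [intervalIntegral.integral_neg, neg_neg,
      ← intervalIntegral.integral_interval_sub_left f2.1 f1.1]
    linarith

end Admissible

end KineticFP

/-! ### Densities of mild solutions and the conclusion -/

namespace KineticFP

variable {n : ℕ}

namespace Admissible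

variable {V : E n → ℝ} {gradV : E n → E n} {G : E n → Matrix (Fin n) (Fin n) ℝ}
  {ε : ℝ} {S : ℝ → L2eq V →L[ℝ] L2eq V} {f : ℝ → E n × E n → ℝ} {h₀ : L2eq V}

/-- The adjoint of `h.lift` is the velocity average, so testing the density means testing the orbit
with a function of `x` alone. -/
theorem integral_mul_density (h : Admissible V gradV G)
    (hf : ∀ t, 0 ≤ t → (fun p => f t p / equilibrium V p) =ᵐ[eqMeasure V] S t h₀) {t : ℝ}
    (ht : 0 ≤ t) {ψ : E n → ℝ} (hψ : MemLp ψ 2 volume) :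
    ∫ x, ψ x * density f t x = inner ℝ (S t h₀) (h.lift (hψ.toLp ψ)) := by
  rw [← ContinuousLinearMap.adjoint_inner_left, inner_toLp_right]
  refine integral_congr_ae ?_
  filter_upwards [(h.ae_integrable_and_integral_eq (hf t ht)).2] with x hx
  rw [density, hx, RCLike.inner_apply, conj_trivial]

theorem weaklyContinuousL2_density (h : Admissible V gradV G) (hS : IsC0Semigroup S)
    (hf : ∀ t, 0 ≤ t → (fun p => f t p / equilibrium V p) =ᵐ[eqMeasure V] S t h₀) :
    WeaklyContinuousL2 (density f) := by
  refine ⟨fun t ht => (Lp.memLp _).ae_eq (h.ae_integrable_and_integral_eq (hf t ht)).2.symm,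
    fun ψ hψ => ?_⟩
  have h1 : Continuous fun t => inner ℝ (S (max t 0) h₀) (h.lift (hψ.toLp ψ)) :=
    (hS.continuous_orbit h₀).inner continuous_const
  refine h1.continuousOn.congr fun t ht => ?_
  simp only [max_eq_left (mem_Ici.mp ht)]
  exact h.integral_mul_density hf ht hψ

theorem norm_le_of_normL2eq_le (hS : IsC0Semigroup S)
    (hf : ∀ t, 0 ≤ t → (fun p => f t p / equilibrium V p) =ᵐ[eqMeasure V] S t h₀) {C : ℝ≥0}
    (hC : normL2eq V (f 0) ≤ C) : ‖h₀‖ ≤ C := by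
  have h1 := hf 0 le_rfl
  rw [hS.zero_apply] at h1
  rw [normL2eq, eLpNorm_congr_ae h1] at hC
  rw [Lp.norm_def]
  exact ENNReal.toReal_le_coe_of_le_coe hC

end Admissible

end KineticFP

theorem theorem1 (n : ℕ) (V : KineticFP.E n → ℝ) (gradV : KineticFP.E n → KineticFP.E n)
    (G : KineticFP.E n → Matrix (Fin n) (Fin n) ℝ)
    (hV : KineticFP.IsWeakGrad V gradV)
    (hVbelow : ∃ c : ℝ, ∀ᵐ x, c ≤ V x)
    (hexp : Integrable (fun x => Real.exp (-V x)) volume)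
    (hGpos : ∀ᵐ x, (G x).PosDef)
    (hG : ∀ i j, LocallyIntegrable (fun x => G x i j) volume)
    (hGinv : ∀ i j, LocallyIntegrable (fun x => (G x)⁻¹ i j) volume)
    (hgradV : LocallyIntegrable (fun x => ‖gradV x‖ ^ 2) volume)
    -- `|G^{-1/2} ∇V|² = ∇V · G⁻¹ ∇V` is locally integrable
    (hGgradV : LocallyIntegrable
      (fun x => inner ℝ (gradV x) (KineticFP.matVec (G x)⁻¹ (gradV x))) volume)
    -- for every `ε > 0`, `-L_ε` generates the strongly continuous semigroup `S ε` in `L²_{M_eq}`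
    (S : ℝ → ℝ → KineticFP.L2eq V →L[ℝ] KineticFP.L2eq V)
    (hS : ∀ ε : ℝ, 0 < ε → KineticFP.IsC0Semigroup (S ε))
    (hgen : ∀ ε : ℝ, 0 < ε → KineticFP.IsGenerator (S ε)
      (fun h g => KineticFP.IsKFPOperator ε V gradV G h (-g)))
    (f : ℝ → ℝ → KineticFP.E n × KineticFP.E n → ℝ)
    (hf : ∀ ε : ℝ, 0 < ε → KineticFP.IsMildWeakSolution ε V gradV G (S ε) (f ε))
    (hbound : ∃ C : ℝ≥0, ∀ ε : ℝ, 0 < ε → KineticFP.normL2eq V (f ε 0) ≤ C) :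
    -- the densities are well defined and lie in `C([0,∞), w-L²(dx))`
    (∀ ε : ℝ, 0 < ε →
      (∀ t : ℝ, 0 ≤ t → ∀ᵐ x, Integrable (fun v => f ε t (x, v)) volume) ∧
      KineticFP.WeaklyContinuousL2 (KineticFP.density (f ε))) ∧
    -- every sequence `ε_k → 0` has a subsequence along which they converge
    ∀ ε : ℕ → ℝ, (∀ k, 0 < ε k) → Tendsto ε atTop (𝓝 0) →
      ∃ (σ : ℕ → ℕ) (ρ : ℝ → KineticFP.E n → ℝ), StrictMono σ ∧
        KineticFP.WeaklyContinuousL2 ρ ∧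
        (∀ T : ℝ, 0 < T → ∀ ψ : KineticFP.E n → ℝ, MemLp ψ 2 volume →
          TendstoUniformlyOn
            (fun k t => ∫ x, ψ x * KineticFP.density (f (ε (σ k))) t x)
            (fun t => ∫ x, ψ x * ρ t x) atTop (Icc 0 T)) ∧
        KineticFP.IsSmoluchowskiSolution gradV G ρ := by

  have h : KineticFP.Admissible V gradV G := ⟨hV, hVbelow, hexp, hGpos, hG, hGinv, hgradV⟩
  choose h₀ hh₀ using fun (ε : ℝ) (hε : 0 < ε) => (hf ε hε).mild
  refine ⟨fun ε hε => ⟨fun t ht => (h.ae_integrable_and_integral_eq (hh₀ ε hε t ht)).1,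
    h.weaklyContinuousL2_density (hS ε hε) (hh₀ ε hε)⟩, fun ε hε hε0 => ?_⟩
  obtain ⟨C, hC⟩ := hbound
  obtain ⟨R, Q, hR⟩ := KineticFP.exists_isSqrtField G hGpos hG hGinv
  obtain ⟨σ, ρ, κ, hσ, ⟨B, hB⟩, hlim, hQ, hRκ⟩ := h.exists_hydrodynamic_limit hR C.coe_nonneg hε
    hε0 (fun k => hS _ (hε k)) (fun k => hgen _ (hε k)) (h₀ := fun k => h₀ _ (hε k))
    fun k => KineticFP.Admissible.norm_le_of_normL2eq_le (hS _ (hε k)) (hh₀ _ (hε k))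
      (hC _ (hε k))
  -- Uniform limits of continuous functions are continuous; the interval up to `t + 1` is a
  -- neighbourhood of `t` within the half-line.
  have hcont : ∀ y, ContinuousOn (fun t => inner ℝ (ρ t) y) (Ici 0) := by
    intro y t ht
    have h1 : ContinuousOn (fun t => inner ℝ (ρ t) y) (Icc 0 (t + 1)) := by
      refine (hlim y (t + 1)).continuousOn (Frequently.of_forall fun k => ?_)
      have h2 : Continuous fun t => inner ℝ (S (ε (σ k)) (max t 0) (h₀ _ (hε (σ k)))) (h.lift y) :=
        ((hS _ (hε (σ k))).continuous_orbit _).inner continuous_const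
      refine h2.continuousOn.congr fun s hs => ?_
      simp only [max_eq_left hs.1]
    refine (h1 t ⟨ht, by linarith⟩).mono_of_mem_nhdsWithin ?_
    rw [← Ici_inter_Iic]
    exact inter_mem_nhdsWithin _ (Iic_mem_nhds (by linarith))
  -- `ρ t` is a class in `L²` for each `t` separately; a jointly measurable choice is required
  -- before space-time integrals make sense.
  obtain ⟨r, hr, hrρ⟩ := KineticFP.exists_stronglyMeasurable_representative ρ hcont
  have hint : ∀ (ψ : KineticFP.E n → ℝ) (hψ : MemLp ψ 2 volume) (t : ℝ), 0 ≤ t →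
      ∫ x, ψ x * r t x = inner ℝ (ρ t) (hψ.toLp ψ) := by
    intro ψ hψ t ht
    rw [KineticFP.inner_toLp_right]
    refine integral_congr_ae ?_
    filter_upwards [hrρ t ht] with x hx
    rw [hx, RCLike.inner_apply, conj_trivial]
  refine ⟨σ, r, hσ, ⟨fun t ht => (Lp.memLp (ρ t)).ae_eq (hrρ t ht).symm, fun ψ hψ =>
    (hcont (hψ.toLp ψ)).congr fun t ht => hint ψ hψ t ht⟩, fun T hT ψ hψ => ?_,
    h.isSmoluchowskiSolution_of_limit hR hB hcont hQ hRκ hr hrρ⟩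
  refine ((hlim (hψ.toLp ψ) T).congr (Eventually.of_forall fun k t ht => ?_)).congr_right
    fun t ht => (hint ψ hψ t ht.1).symm
  exact (h.integral_mul_density (hh₀ _ (hε (σ k))) ht.1 hψ).symm

end
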